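/- Let $\mathfrak g_0$ be a finite-dimensional nonabelian real Lie algebra, $\mathfrak g=\mathfrak g_0\otimes\mathbb C$, and let $z\mapsto\bar z$ be the induced conjugation of $\mathfrak g^*$. Let $c$ be the holomorphic linear Poisson bivector of $\mathfrak g^*$, $c(z)(\xi,\eta)=\langle z,[\xi,\eta]\rangle$, let $\operatorname{Sing}\mathfrak g^*$ be the set of points where the rank of $c$ is not maximal, and assume $\operatorname{codim}_{\mathbb C}\operatorname{Sing}\mathfrak g^*\ge 3$. Let $G$ and $G_0$ be connected Lie groups with Lie algebras $\mathfrak g$ and $\mathfrak g_0$, acting on $\mathfrak g^*$ by the (complexified) coadjoint action. Put $$\mathcal C=\{z\in\mathfrak g^*:\ \lambda_1z+\lambda_2\bar z\in\operatorname{Sing}\mathfrak g^*\text{ for some }(\lambda_1,\lambda_2)\in\mathbb C^2\setminus\{0\}\},\qquad \mu(z)=\dim_{\mathbb C}\big(\ker c(z)\cap\ker c(\bar z)\big)$$ (kernels in $\mathfrak g$, the space of $(1,0)$-covectors), and let the Kronecker irregularity set be $\mathcal R=\mathcal C\cup\{z:\mu(z)>\min_{\mathfrak g^*}\mu\}$.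 Let $M\subset\mathfrak g^*$ be a $G$-orbit with holomorphic symplectic form $\omega=(c|_M)^{-1}$, and let $U\subset M$ be open (in the manifold topology of $M$) such that $U'=U/G_0$ (the points of $U$ modulo the relation of lying in one $G_0$-orbit) is a smooth manifold for which the canonical map $p:U\to U'$ is a smooth submersion. Let $J$ be the real span of $\operatorname{Re}c|_M$ and $\operatorname{Im}c|_M$. For $z\in U$ put $T_z\mathcal K=\ker dp_z$ and $T^{1,0}_z\mathcal K=(T_z\mathcal K\otimes\mathbb C)\cap T^{1,0}_zM$. For real bivector fields $c_1',c_2'$ on $U'$ let $R_0'$ be the maximum of the rank of $(\lambda_1c_1'+\lambda_2c_2')(x)$ over $\lambda\in\mathbb R^2$ and $x\in U'$. Their span is called complete at $x$ if $\operatorname{rank}(\lambda_1c_1'+\lambda_2c_2')(x)=R_0'$ for all $(\lambda_1,\lambda_2)\in\mathbb C^2\setminus\{0\}$, and complete if it is so at all points of an open dense subset of $U'$. Then: 1. $\operatorname{Re}c|_U$ and $\operatorname{Im}c|_U$ have smooth push-forwards $c_1',c_2'$ along $p$; let $J'$ (the reduction of $J|_U$) be their real span. $J'$ is complete at every $z'\in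 U'\setminus p(U\cap\mathcal R)$. 2. If $U\not\subset\mathcal R$, then $J'$ is a bihamiltonian structure (all $\lambda_1c'_1+\lambda_2c'_2$ with $\lambda\in\mathbb R^2$ are Poisson, and $c_1',c_2'$ are linearly independent or both zero), $J'$ is complete, and the realization $(U,J,\mathcal K)$ of $J'$ is minimal, i.e. the foliation of $U$ by the leaves of $p$ is CR-isotropic: $\dim T^{1,0}_z\mathcal K$ is constant along the fibres of $p$, and $\omega$ vanishes on $T^{1,0}_z\mathcal K$ for every $z\in U$. 3. If $M\cap\operatorname{Sing}\mathfrak g^*=\emptyset$ (a generic orbit), then the foliation of $U$ by the leaves of $p$ is CR-isotropic, whether or not $U\subset\mathcal R$. -/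

import Mathlib

open scoped Manifold ContDiff Topology Matrix
open Matrix

noncomputable section

namespace Coadjoint

/-! ### The Lie algebra, its complexification and the linear Poisson structure

`𝔤₀` is a real Lie algebra with basis `e`, and `𝔤 = ℂ ⊗ 𝔤₀`.  Elements of `𝔤` are written by their
complex coordinates `ξ` with respect to `e`, and elements of `𝔤*` by the coordinates
`z k = ⟨z, e k⟩`; both are functions `ι → ℂ`.  The conjugation of `𝔤` and of `𝔤*` defined by `𝔤₀`
is `star`, and `𝔤₀ ⊆ 𝔤` consists of the real vectors. -/

section Algebra

variable {𝔤₀ : Type*} [LieRing 𝔤₀] [LieAlgebra ℝ 𝔤₀] {ι : Type*} [Fintype ι]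

/-- The structure constants: `⁅e i, e j⁆ = ∑ k, structConst e i j k • e k`. -/
def structConst (e : Module.Basis ι ℝ 𝔤₀) (i j k : ι) : ℝ := e.repr ⁅e i, e j⁆ k

/-- The matrix at `z` of the linear Poisson bivector `c` of `𝔤*`: its `(i, j)` entry is
`{z_i, z_j} = ⟨z, [e i, e j]⟩`. -/
def poissonMatrix (e : Module.Basis ι ℝ 𝔤₀) (z : ι → ℂ) : Matrix ι ι ℂ :=
  Matrix.of fun i j => ∑ k, (structConst e i j k : ℂ) * z k

/-- `⟨z, [ξ, η]⟩` for `z ∈ 𝔤*` and `ξ, η ∈ 𝔤`. -/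
def liePairing (e : Module.Basis ι ℝ 𝔤₀) (z ξ η : ι → ℂ) : ℂ := ξ ⬝ᵥ poissonMatrix e z *ᵥ η

/-- `ξ ↦ ad*(ξ) z`, where `⟨ad*(ξ) z, η⟩ = ⟨z, [ξ, η]⟩`: the infinitesimal coadjoint action
at `z`. -/
def coadAt (e : Module.Basis ι ℝ 𝔤₀) (z : ι → ℂ) : (ι → ℂ) →ₗ[ℂ] (ι → ℂ) :=
  (poissonMatrix e z).vecMulLinear

/-- The matrix of the endomorphism `z ↦ ad*(ξ) z` of `𝔤*`. -/
def coadMatrix (e : Module.Basis ι ℝ 𝔤₀) (ξ : ι → ℂ) : Matrix ι ι ℂ :=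
  Matrix.of fun j k => ∑ i, ξ i * (structConst e i j k : ℂ)

lemma coadMatrix_mulVec (e : Module.Basis ι ℝ 𝔤₀) (ξ z : ι → ℂ) :
    coadMatrix e ξ *ᵥ z = coadAt e z ξ := by
  funext j
  simp only [coadMatrix, coadAt, poissonMatrix, Matrix.mulVec, dotProduct, Matrix.of_apply,
    Matrix.vecMulLinear_apply, Matrix.vecMul, Finset.sum_mul, Finset.mul_sum]
  rw [Finset.sum_comm]
  simp only [mul_assoc]

lemma coadAt_dotProduct (e : Module.Basis ι ℝ 𝔤₀) (z ξ η : ι → ℂ) :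
    coadAt e z ξ ⬝ᵥ η = liePairing e z ξ η := by
  simp [coadAt, liePairing, Matrix.dotProduct_mulVec]

lemma liePairing_skew (e : Module.Basis ι ℝ 𝔤₀) (z ξ η : ι → ℂ) :
    liePairing e z ξ η = - liePairing e z η ξ := by
  have h : (poissonMatrix e z)ᵀ = - poissonMatrix e z := by
    ext i j
    have hs : ∀ k, structConst e j i k = - structConst e i j k := fun k => by
      have hl : ⁅e j, e i⁆ = -⁅e i, e j⁆ := (lie_skew (e j) (e i)).symm
      rw [structConst, structConst, hl, map_neg, Finsupp.neg_apply]
    simp [poissonMatrix, hs, Finset.sum_neg_distrib]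
  have h' : poissonMatrix e z = - (poissonMatrix e z)ᵀ := by rw [h, neg_neg]
  unfold liePairing
  rw [h', Matrix.neg_mulVec, dotProduct_neg, Matrix.mulVec_transpose, dotProduct_comm,
    Matrix.dotProduct_mulVec, ← h']

variable [DecidableEq ι]

/-- The flow `exp(ad*(ξ))` on `𝔤*`. -/
def coadExp (e : Module.Basis ι ℝ 𝔤₀) (ξ z : ι → ℂ) : ι → ℂ :=
  NormedSpace.exp (coadMatrix e ξ) *ᵥ z

/-- The image in `GL(𝔤*)` of the connected complex Lie group `G` with Lie algebra `𝔤` under its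
coadjoint representation: a connected Lie group is generated by exponentials, so it is the
group generated by the `exp(ad*(ξ))`, `ξ ∈ 𝔤`. -/
def coadjointGroup (e : Module.Basis ι ℝ 𝔤₀) : Subgroup (Matrix ι ι ℂ)ˣ :=
  Subgroup.closure {u | ∃ ξ : ι → ℂ, (u : Matrix ι ι ℂ) = NormedSpace.exp (coadMatrix e ξ)}

/-- The image in `GL(𝔤*)` of the connected real Lie group `G₀` with Lie algebra `𝔤₀`: the group
generated by the `exp(ad*(ξ))`, `ξ ∈ 𝔤₀`. -/
def realCoadjointGroup (e : Module.Basis ι ℝ 𝔤₀) : Subgroup (Matrix ι ι ℂ)ˣ :=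
  Subgroup.closure {u | ∃ ξ : ι → ℝ,
    (u : Matrix ι ι ℂ) = NormedSpace.exp (coadMatrix e fun i => (ξ i : ℂ))}

/-- The `G`-orbit of `z₀` in `𝔤*`. -/
def coadjointOrbit (e : Module.Basis ι ℝ 𝔤₀) (z₀ : ι → ℂ) : Set (ι → ℂ) :=
  {z | ∃ u ∈ coadjointGroup e, (u : Matrix ι ι ℂ) *ᵥ z₀ = z}

/-- The leaf topology of `𝔤*`: the disjoint union topology of the `G`-orbits, each of which
carries its topology as a homogeneous space (which can be finer than the subspace topology).
A set is open if with each point `z` it contains `exp(ad*(ξ)) z` for all small `ξ ∈ 𝔤`. -/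
@[reducible]
def orbitTopology (e : Module.Basis ι ℝ 𝔤₀) : TopologicalSpace (ι → ℂ) where
  IsOpen V := ∀ z ∈ V, ∀ᶠ ξ in 𝓝 (0 : ι → ℂ), coadExp e ξ z ∈ V
  isOpen_univ := by simp
  isOpen_inter := fun s t hs ht z hz => (hs z hz.1).and (ht z hz.2)
  isOpen_sUnion := fun S hS z ⟨t, ht, hz⟩ =>
    (hS t ht z hz).mono fun _ h => ⟨t, ht, h⟩

/-- The maximal (over `𝔤*`) rank of the linear Poisson bivector `c`. -/
def genericRank (e : Module.Basis ι ℝ 𝔤₀) : ℕ := sSup (Set.range fun z => (poissonMatrix e z).rank)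

/-- `Sing 𝔤*`: the union of the symplectic leaves of `c` of nonmaximal dimension. -/
def singularSet (e : Module.Basis ι ℝ 𝔤₀) : Set (ι → ℂ) :=
  {z | (poissonMatrix e z).rank < genericRank e}

/-- The codimension of the complex algebraic set `Sing 𝔤*`, as the height of its ideal. -/
def singularCodim (e : Module.Basis ι ℝ 𝔤₀) : ℕ∞ :=
  (MvPolynomial.vanishingIdeal ℂ (singularSet e)).height

/-- The incompleteness set `𝒞`. -/
def incompletenessSet (e : Module.Basis ι ℝ 𝔤₀) : Set (ι → ℂ) :=
  {z | ∃ l₁ l₂ : ℂ, (l₁, l₂) ≠ (0, 0) ∧ l₁ • z + l₂ • star z ∈ singularSet e}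

/-- `μ(z) = dim (ker c(z) ∩ ker c̃(z))` on `(1,0)`-covectors, where `c̃(z) = c(z̄)` as matrices. -/
def commonKernelDim (e : Module.Basis ι ℝ 𝔤₀) (z : ι → ℂ) : ℕ :=
  Module.finrank ℂ
    (LinearMap.ker (poissonMatrix e z).mulVecLin ⊓
      LinearMap.ker (poissonMatrix e (star z)).mulVecLin : Submodule ℂ (ι → ℂ))

/-- The trivial Kronecker dimension `μ`, the minimal value of `μ(z)`. -/
def kroneckerDim (e : Module.Basis ι ℝ 𝔤₀) : ℕ := sInf (Set.range (commonKernelDim e))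

/-- The Kronecker irregularity set `ℛ`: the smallest set that contains `𝒞` and outside of which
`μ(z)` is constant and minimal. -/
def irregularitySet (e : Module.Basis ι ℝ 𝔤₀) : Set (ι → ℂ) :=
  incompletenessSet e ∪ {z | commonKernelDim e z ≠ kroneckerDim e}

/-- The component on `∂/∂z_i` of a real covector `φ` of `𝔤*`, i.e. `φ(∂/∂z_i)`, where
`∂/∂z_i = (∂/∂x_i - I ∂/∂y_i) / 2`. -/
def holComponent (φ : (ι → ℂ) →ₗ[ℝ] ℝ) (i : ι) : ℂ :=
  ((φ (Pi.single i 1) : ℂ) - Complex.I * (φ (Pi.single i Complex.I) : ℂ)) / 2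

/-- The value `c(z)(φ, ψ)` of the holomorphic linear Poisson bivector on real covectors of `𝔤*`.
It is tangent to the orbits: it depends only on the restrictions of `φ` and `ψ` to the tangent
space at `z` of the orbit of `z`, and so it is also the value of `c|_M = ω⁻¹` on these. -/
def linearPoisson (e : Module.Basis ι ℝ 𝔤₀) (z : ι → ℂ) (φ ψ : (ι → ℂ) →ₗ[ℝ] ℝ) : ℂ :=
  liePairing e z (holComponent φ) (holComponent ψ)

open Classical in
/-- The holomorphic symplectic form `ω = (c|_M)⁻¹` of the orbit through `z`, on tangent vectors
`v, w ∈ T_z M = {ad*(ξ) z}`, see `symplecticForm_apply`. -/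
def symplecticForm (e : Module.Basis ι ℝ 𝔤₀) (z v w : ι → ℂ) : ℂ :=
  v ⬝ᵥ Classical.epsilon fun η => coadAt e z η = w

lemma symplecticForm_apply (e : Module.Basis ι ℝ 𝔤₀) (z ξ η : ι → ℂ) :
    symplecticForm e z (coadAt e z ξ) (coadAt e z η) = liePairing e z ξ η := by
  have h : coadAt e z (Classical.epsilon fun η' => coadAt e z η' = coadAt e z η) =
      coadAt e z η :=
    Classical.epsilon_spec (p := fun η' => coadAt e z η' = coadAt e z η) ⟨η, rfl⟩
  unfold symplecticForm
  rw [coadAt_dotProduct, liePairing_skew, ← coadAt_dotProduct, h, coadAt_dotProduct,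
    ← liePairing_skew]

open Classical in
/-- The exponential parametrization `ξ ↦ exp(ad*(ξ)) z` of a neighbourhood of `z` in an open
subset `U` of an orbit (with a dummy value where it leaves `U`). -/
def expAt (e : Module.Basis ι ℝ 𝔤₀) {U : Set (ι → ℂ)} (z : U) (ξ : ι → ℂ) : U :=
  if h : coadExp e ξ z ∈ U then ⟨coadExp e ξ z, h⟩ else z

end Algebra

/-! ### Bivector fields and bihamiltonian structures on a real manifold -/

section Bihamiltonian

variable (E : Type*) [NormedAddCommGroup E] [NormedSpace ℝ E]
  (N : Type*) [TopologicalSpace N] [ChartedSpace E N]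

/-- A field of bilinear forms on the cotangent spaces; a bivector field if alternating. -/
abbrev BivectorField := (x : N) → LinearMap.BilinForm ℝ (Module.Dual ℝ (TangentSpace 𝓘(ℝ, E) x))

variable {E N}

/-- The bracket `{f, g}_c = c(df, dg)`. -/
def bracket (c : BivectorField E N) (f g : N → ℝ) (x : N) : ℝ :=
  c x (mfderiv 𝓘(ℝ, E) 𝓘(ℝ, ℝ) f x).toLinearMap (mfderiv 𝓘(ℝ, E) 𝓘(ℝ, ℝ) g x).toLinearMap

/-- A smooth bivector field: alternating, and the bracket of smooth functions defined on an open
set is smooth. -/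
structure IsSmoothBivector (c : BivectorField E N) : Prop where
  alt : ∀ x, (c x).IsAlt
  smooth : ∀ (V : Set N) (f g : N → ℝ), IsOpen V →
    ContMDiffOn 𝓘(ℝ, E) 𝓘(ℝ, ℝ) ∞ f V → ContMDiffOn 𝓘(ℝ, E) 𝓘(ℝ, ℝ) ∞ g V →
    ContMDiffOn 𝓘(ℝ, E) 𝓘(ℝ, ℝ) ∞ (bracket c f g) V

/-- A Poisson bivector field: the bracket satisfies the Jacobi identity. -/
structure IsPoisson (c : BivectorField E N) : Prop extends IsSmoothBivector c where
  jacobi : ∀ (V : Set N) (f g h : N → ℝ), IsOpen V →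
    ContMDiffOn 𝓘(ℝ, E) 𝓘(ℝ, ℝ) ∞ f V → ContMDiffOn 𝓘(ℝ, E) 𝓘(ℝ, ℝ) ∞ g V →
    ContMDiffOn 𝓘(ℝ, E) 𝓘(ℝ, ℝ) ∞ h V → ∀ x ∈ V,
    bracket c f (bracket c g h) x + bracket c g (bracket c h f) x +
      bracket c h (bracket c f g) x = 0

/-- The real span of `c₁, c₂` is a bihamiltonian structure: all its elements are Poisson, and
`c₁, c₂` are linearly independent or both zero (the trivial structure). -/
structure IsBihamiltonian (c₁ c₂ : BivectorField E N) : Prop where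
  poisson : ∀ a b : ℝ, IsPoisson fun x => a • c₁ x + b • c₂ x
  indep_or_trivial :
    (∀ a b : ℝ, (∀ x, a • c₁ x + b • c₂ x = 0) → a = 0 ∧ b = 0) ∨
      ((∀ x, c₁ x = 0) ∧ ∀ x, c₂ x = 0)

/-- The rank at `x` of `l₁ c₁ + l₂ c₂`, a bivector on the complexified cotangent space. -/
def pencilRank (c₁ c₂ : BivectorField E N) (l₁ l₂ : ℂ) (x : N) : ℕ :=
  Module.finrank ℂ (LinearMap.range
    (l₁ • (c₁ x).baseChange ℂ + l₂ • (c₂ x).baseChange ℂ))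

/-- The maximal rank `R₀` of the bivectors of the real bihamiltonian structure, over all points. -/
def maxRank (c₁ c₂ : BivectorField E N) : ℕ :=
  sSup {k | ∃ (a b : ℝ) (x : N), k = pencilRank c₁ c₂ a b x}

/-- Completeness at `x`: all nonzero bivectors of the complexified structure have rank `R₀`
at `x`. (The trivial structure satisfies this, in agreement with the convention for it.) -/
def IsCompleteAt (c₁ c₂ : BivectorField E N) (x : N) : Prop :=
  ∀ l₁ l₂ : ℂ, (l₁, l₂) ≠ (0, 0) → pencilRank c₁ c₂ l₁ l₂ x = maxRank c₁ c₂

/-- Completeness: completeness at all points of an open dense set. -/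
def IsComplete (c₁ c₂ : BivectorField E N) : Prop :=
  ∃ V : Set N, IsOpen V ∧ Dense V ∧ ∀ x ∈ V, IsCompleteAt c₁ c₂ x

end Bihamiltonian

/-! ### The quotient of an open subset of a coadjoint orbit by the real form, and the reduction -/

section Reduction

variable {𝔤₀ : Type*} [LieRing 𝔤₀] [LieAlgebra ℝ 𝔤₀] {ι : Type*} [Fintype ι] [DecidableEq ι]
  {E : Type*} [NormedAddCommGroup E] [NormedSpace ℝ E]
  {N : Type*} [TopologicalSpace N] [ChartedSpace E N]

/-- The differential of `p : U → N` at `z`, composed with `𝔤 → T_z M, ξ ↦ ad*(ξ) z`: the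
derivative at `0` of `ξ ↦ p (exp(ad*(ξ)) z)`. -/
def orbitDifferential (e : Module.Basis ι ℝ 𝔤₀) {U : Set (ι → ℂ)} (p : U → N) (z : U) :
    (ι → ℂ) →ₗ[ℝ] TangentSpace 𝓘(ℝ, E) (p z) :=
  (mfderiv 𝓘(ℝ, ι → ℂ) 𝓘(ℝ, E) (fun ξ => p (expAt e z ξ)) 0 : (ι → ℂ) →L[ℝ] E).toLinearMap

/-- `p : U → N` presents the manifold `N` as `U / G₀`: it is onto, its fibres are the
intersections of `U` with the `G₀`-orbits, and it is a smooth submersion (for the manifold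
structure of the `G`-orbit, which is given by the exponential parametrizations). -/
structure IsQuotientByRealForm (E : Type*) [NormedAddCommGroup E] [NormedSpace ℝ E]
    {N : Type*} [TopologicalSpace N] [ChartedSpace E N]
    (e : Module.Basis ι ℝ 𝔤₀) {U : Set (ι → ℂ)} (p : U → N) : Prop where
  surjective : Function.Surjective p
  fiber : ∀ z w : U, p z = p w ↔
    ∃ u ∈ realCoadjointGroup e, (u : Matrix ι ι ℂ) *ᵥ (z : ι → ℂ) = w
  smooth : ∀ z : U, ContMDiffAt 𝓘(ℝ, ι → ℂ) 𝓘(ℝ, E) ∞ (fun ξ => p (expAt e z ξ)) 0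
  submersion : ∀ z : U, Function.Surjective (orbitDifferential (E := E) e p z)

/-- `c₁, c₂` are the push-forwards along `p` of `Re c|_M` and `Im c|_M`: they are smooth, and
their values on covectors `α, β` at `p z` are those of `Re c|_M, Im c|_M` on the covectors
`α ∘ dp_z, β ∘ dp_z` of `M` (the restrictions to `T_z M` of covectors `φ, ψ` of `𝔤*`). -/
structure IsReduction (e : Module.Basis ι ℝ 𝔤₀) {U : Set (ι → ℂ)} (p : U → N)
    (c₁ c₂ : BivectorField E N) : Prop where
  smooth₁ : IsSmoothBivector c₁
  smooth₂ : IsSmoothBivector c₂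
  push : ∀ (z : U) (α β : Module.Dual ℝ (TangentSpace 𝓘(ℝ, E) (p z)))
    (φ ψ : (ι → ℂ) →ₗ[ℝ] ℝ),
    (∀ ξ, φ (coadAt e z ξ) = α (orbitDifferential e p z ξ)) →
    (∀ ξ, ψ (coadAt e z ξ) = β (orbitDifferential e p z ξ)) →
    c₁ (p z) α β = (linearPoisson e z φ ψ).re ∧ c₂ (p z) α β = (linearPoisson e z φ ψ).im

/-- The tangent space `T_z 𝒦 = ker dp_z ⊆ T_z M` of the leaves of `p`. -/
def leafTangent (E : Type*) [NormedAddCommGroup E] [NormedSpace ℝ E]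
    {N : Type*} [TopologicalSpace N] [ChartedSpace E N]
    (e : Module.Basis ι ℝ 𝔤₀) {U : Set (ι → ℂ)} (p : U → N) (z : U) : Submodule ℝ (ι → ℂ) :=
  (LinearMap.ker (orbitDifferential (E := E) e p z)).map ((coadAt e z).restrictScalars ℝ)

/-- `T^{CR}_z 𝒦 = T_z 𝒦 ∩ I T_z 𝒦`, isomorphic to `T^{1,0}_z 𝒦` by `v ↦ v - I 𝒥 v`. -/
def leafCRTangent (E : Type*) [NormedAddCommGroup E] [NormedSpace ℝ E]
    {N : Type*} [TopologicalSpace N] [ChartedSpace E N]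
    (e : Module.Basis ι ℝ 𝔤₀) {U : Set (ι → ℂ)} (p : U → N) (z : U) : Submodule ℝ (ι → ℂ) :=
  leafTangent E e p z ⊓
    (leafTangent E e p z).map
      ((Complex.I • (LinearMap.id : (ι → ℂ) →ₗ[ℂ] (ι → ℂ))).restrictScalars ℝ)

/-- The leaves of `p` form a CR-isotropic foliation of `U`: the dimension of `T^{1,0}𝒦` is constant
along the leaves, and `T^{1,0}𝒦` is contained in its `ω`-orthogonal complement.  Since `ω` is of
type `(2,0)`, its value on `v - I 𝒥 v, w - I 𝒥 w` is four times that on `v, w`. -/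
structure IsCRIsotropicFoliation (E : Type*) [NormedAddCommGroup E] [NormedSpace ℝ E]
    {N : Type*} [TopologicalSpace N] [ChartedSpace E N]
    (e : Module.Basis ι ℝ 𝔤₀) {U : Set (ι → ℂ)} (p : U → N) : Prop where
  cr : ∀ z w : U, p z = p w →
    Module.finrank ℝ (leafCRTangent E e p z) = Module.finrank ℝ (leafCRTangent E e p w)
  isotropic : ∀ z : U, ∀ v ∈ leafCRTangent E e p z, ∀ w ∈ leafCRTangent E e p z,
    symplecticForm e z v w = 0

/-- `(U, J, 𝒦)` is a minimal realization of the reduction spanned by `c₁, c₂`. -/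
structure IsMinimalRealization (e : Module.Basis ι ℝ 𝔤₀) {U : Set (ι → ℂ)} (p : U → N)
    (c₁ c₂ : BivectorField E N) : Prop where
  reduction : IsReduction e p c₁ c₂
  complete : IsComplete c₁ c₂
  isotropic : IsCRIsotropicFoliation E e p

end Reduction

end Coadjoint

end

open scoped Manifold ContDiff Topology Matrix
open Matrix

noncomputable section

namespace Coadjoint

/-! ### Local subgroups of a Banach algebra tangent to a Lie subalgebra -/

section BanachAlgebra

open NormedSpace Set Filter

variable {𝔸 : Type*} [NormedRing 𝔸] [NormedAlgebra ℝ 𝔸]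

/-! The bivector `c` is `G`-equivariant, hence `G₀`-invariant, so the value of `Re (a c)` on two
covectors pulled back from the quotient is the same at all points of a fibre (`pushBivector_apply`).
A function on the quotient lifts locally to a smooth function on `𝔤*` through a retraction onto a
plaque of the orbit (`exists_smooth_lift`), and smoothness and the Jacobi identity descend from the
linear Poisson structure.

Everything else is a rank computation. The hypothesis only says which sets the fibres of `p` are;
that `ker dp` is exactly the tangent space of the `G₀`-orbit is proved by dimension. A fibre
contains a piece as large as `ker dp`, while it lies in a `G₀`-orbit, a countable union of `C¹`
images of its tangent space (`dimH_orbit_le`, `leafTangent_eq`). Comparing dimensions then makes `μ`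
constant on `U`.

Write `A`, `B` for the matrices of `c` at `z` and at `z̄`. Covectors of the quotient at `p z`,
complexified, become pairs `(a, b)` with `A a + B b = 0`, modulo `ker A × ker B`, and `l₁ c₁' + l₂
c₂'` becomes `l a·Aa' + m b·Bb'` with `l = (l₁ - i l₂)/2` and `m = (l₁ + i l₂)/2`. An element `(a,
b)` is in the radical of this form when some `y` satisfies `A y = l A a`, `B y = m B b`; such `y`
are annihilated by `m A + l B`. For regular `z` the count gives `rank (l₁ c₁' + l₂ c₂') = const +
rank c(m z + l z̄)` (`pencilRank_pushBivector`), with a constant independent of the point of `U`. So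
the reduction is complete at `p z` as soon as `z ∉ 𝒞`.

For completeness on an open dense set, a resultant of minors yields a real analytic function which
is nonzero at one good point and vanishes wherever the rank of some `A + t B` drops
(`exists_analytic_certificate`). By the identity theorem along the orbit it vanishes identically
near no point.

CR-isotropy rests on one fact of linear algebra: if `B` has maximal rank in the pencil `B + t A`,
then `A (ker B) ⊆ range B`, so the skew form `A` vanishes on `ker B`. The complex tangent space of a
leaf is the image of `ker B` under the action at `z`. -/

lemma exists_continuous_complement_projection [FiniteDimensional ℝ 𝔸] (𝔥 : Submodule ℝ 𝔸) :
    ∃ π : 𝔸 →L[ℝ] 𝔸, (∀ x, x - π x ∈ 𝔥) ∧ ∀ x ∈ 𝔥, π x = 0 := by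
  obtain ⟨q, hq⟩ := 𝔥.exists_isCompl
  refine ⟨LinearMap.toContinuousLinearMap (q.subtype ∘ₗ q.projectionOnto 𝔥 hq.symm), ?_, ?_⟩
  · intro x
    have h := Submodule.projection_add_projection_eq_self hq x
    have h2 : x - q.projection 𝔥 hq.symm x = 𝔥.projection q hq x := sub_eq_of_eq_add h.symm
    simpa [← Submodule.coe_projectionOnto_apply, h2] using
      (h2 ▸ Submodule.coe_mem (𝔥.projectionOnto q hq x) :
        x - q.projection 𝔥 hq.symm x ∈ 𝔥)
  · intro x hx
    simp [hx]

variable [CompleteSpace 𝔸]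

lemma exp_neg_mul_exp (X : 𝔸) : exp (-X) * exp X = 1 := by
  let _ : NormedAlgebra ℚ 𝔸 := NormedAlgebra.restrictScalars ℚ ℝ 𝔸
  rw [← exp_add_of_commute (Commute.refl X).neg_left, neg_add_cancel, exp_zero]

lemma exp_mul_exp_neg (X : 𝔸) : exp X * exp (-X) = 1 := by
  simpa using exp_neg_mul_exp (-X)

lemma continuous_exp_real : Continuous (exp : 𝔸 → 𝔸) :=
  continuous_iff_continuousAt.2 fun x => (exp_analytic (𝕂 := ℝ) x).continuousAt

lemma contDiff_exp_real {n : WithTop ℕ∞} : ContDiff ℝ n (exp : 𝔸 → 𝔸) :=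
  contDiff_iff_contDiffAt.2 fun x => (exp_analytic (𝕂 := ℝ) x).contDiffAt

lemma hasDerivAt_exp_neg_smul (X : 𝔸) (s : ℝ) :
    HasDerivAt (fun s : ℝ => exp (-(s • X))) (-(exp (-(s • X)) * X)) s := by
  simpa using hasDerivAt_exp_smul_const (𝕂 := ℝ) (-X) s

/-- Conjugation by the exponential of an element of a Lie subalgebra preserves the subalgebra. -/
lemma exp_conj_mem [FiniteDimensional ℝ 𝔸] {𝔥 : Submodule ℝ 𝔸}
    (h𝔥 : ∀ X ∈ 𝔥, ∀ Y ∈ 𝔥, X * Y - Y * X ∈ 𝔥) {X H : 𝔸} (hX : X ∈ 𝔥) (hH : H ∈ 𝔥) :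
    exp (-X) * H * exp X ∈ 𝔥 := by
  obtain ⟨π, hπ, hπ0⟩ := exists_continuous_complement_projection 𝔥
  set Y : ℝ → 𝔸 := fun s => exp (-(s • X)) * H * exp (s • X) with hY
  have hd : ∀ s, HasDerivAt Y (Y s * X - X * Y s) s := fun s => by
    have h1 := ((hasDerivAt_exp_neg_smul X s).mul_const H).mul
      (hasDerivAt_exp_smul_const (𝕂 := ℝ) X s)
    have hc : exp (-(s • X)) * X = X * exp (-(s • X)) :=
      ((Commute.refl X).smul_right s).neg_right.exp_right.eq.symm
    have he : Y s * X - X * Y s = -(exp (-(s • X)) * X) * H * exp (s • X) +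
        exp (-(s • X)) * H * (exp (s • X) * X) := by
      rw [hc]
      simp only [hY, mul_assoc, neg_mul]
      abel
    rw [he]
    exact h1
  have hq : ∀ s ∈ Icc (0 : ℝ) 1, π (Y s) = 0 := by
    refine eq_zero_of_abs_deriv_le_mul_abs_self_of_eq_zero_right
      (K := ‖π‖ * (‖X‖ + ‖X‖)) (f' := fun s => π (Y s * X - X * Y s)) ?_ ?_ ?_ ?_
    · exact fun s _ => ((π.hasFDerivAt.comp_hasDerivAt s (hd s)).continuousAt).continuousWithinAt
    · exact fun s _ => (π.hasFDerivAt.comp_hasDerivAt s (hd s)).hasDerivWithinAt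
    · simpa [hY] using hπ0 H hH
    · intro s _
      -- The component `Y s - π (Y s)` is in `𝔥`, so its commutator with `X` is killed by `π`; only
      -- the defect `π (Y s)` drives the equation.
      have h1 : π (Y s * X - X * Y s) = π (π (Y s) * X - X * π (Y s)) := by
        have := hπ0 _ (h𝔥 _ (hπ (Y s)) _ hX)
        rw [← sub_eq_zero, ← map_sub, ← this]
        congr 1
        noncomm_ring
      rw [h1]
      calc ‖π (π (Y s) * X - X * π (Y s))‖ ≤ ‖π‖ * ‖π (Y s) * X - X * π (Y s)‖ :=
            π.le_opNorm _
        _ ≤ ‖π‖ * (‖π (Y s)‖ * ‖X‖ + ‖X‖ * ‖π (Y s)‖) := by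
            gcongr
            exact (norm_sub_le _ _).trans (add_le_add (norm_mul_le _ _) (norm_mul_le _ _))
        _ = ‖π‖ * (‖X‖ + ‖X‖) * ‖π (Y s)‖ := by ring
  have h1 := hπ (Y 1)
  rw [hq 1 (by simp), sub_zero] at h1
  simpa [hY] using h1

/-- Duhamel's formula: integrate the derivative of `exp (-s X) exp (s Z)` over `[0, 1]`. -/
lemma exp_neg_mul_exp_sub_one (X Z : 𝔸) :
    exp (-X) * exp Z - 1 = ∫ s in (0 : ℝ)..1, exp (-(s • X)) * (Z - X) * exp (s • Z) := by
  have hd : ∀ s ∈ uIcc (0 : ℝ) 1, HasDerivAt (fun s : ℝ => exp (-(s • X)) * exp (s • Z))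
      (exp (-(s • X)) * (Z - X) * exp (s • Z)) s := fun s _ => by
    convert! (hasDerivAt_exp_neg_smul X s).mul (hasDerivAt_exp_smul_const' (𝕂 := ℝ) Z s) using 1
    noncomm_ring
  rw [intervalIntegral.integral_eq_sub_of_hasDerivAt hd]
  · simp
  · have := continuous_exp_real (𝔸 := 𝔸)
    apply Continuous.intervalIntegrable
    fun_prop

/-- Duhamel's formula for `Z = X + t H` has a factor `t`; dividing by it and letting `t → 0` gives
the differential of the exponential. -/
lemma exp_neg_mul_fderiv_exp (X H : 𝔸) :
    exp (-X) * fderiv ℝ exp X H = ∫ s in (0 : ℝ)..1, exp (-(s • X)) * H * exp (s • X) := by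
  have hc := continuous_exp_real (𝔸 := 𝔸)
  have h1 : HasDerivAt (fun t : ℝ => exp (-X) * exp (X + t • H) - 1)
      (exp (-X) * fderiv ℝ exp X H) 0 := by
    have hl : HasDerivAt (fun t : ℝ => X + t • H) H 0 := by
      simpa using ((hasDerivAt_id (0 : ℝ)).smul_const H).const_add X
    have he : HasFDerivAt exp (fderiv ℝ exp X) (X + (0 : ℝ) • H) := by
      simpa using (contDiff_exp_real (n := 1)).differentiable one_ne_zero X |>.hasFDerivAt
    exact ((he.comp_hasDerivAt 0 hl).const_mul _).sub_const _
  set I : ℝ → 𝔸 := fun t => ∫ s in (0 : ℝ)..1, exp (-(s • X)) * H * exp (s • (X + t • H)) with hI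
  have hIc : Continuous I := by
    apply intervalIntegral.continuous_parametric_intervalIntegral_of_continuous'
    dsimp only [Function.uncurry_def]
    fun_prop
  have h2 : (fun t : ℝ => exp (-X) * exp (X + t • H) - 1) = fun t => t • I t := by
    funext t
    rw [exp_neg_mul_exp_sub_one, hI, ← intervalIntegral.integral_smul]
    simp
  have h3 : HasDerivAt (fun t : ℝ => t • I t) (I 0) 0 := by
    rw [hasDerivAt_iff_tendsto_slope]
    refine (hIc.continuousAt.tendsto (x := 0)).mono_left nhdsWithin_le_nhds |>.congr' ?_
    filter_upwards [self_mem_nhdsWithin] with t ht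
    simp [slope_def_module, smul_smul, inv_mul_cancel₀ (show t ≠ 0 from ht)]
  rw [h2] at h1
  simpa [hI] using h1.unique h3

/-- The integrand of the preceding formula consists of conjugates of `H` by exponentials from `𝔥`,
and `π` commutes with the integral. -/
lemma exp_neg_mul_fderiv_exp_mem [FiniteDimensional ℝ 𝔸] {𝔥 : Submodule ℝ 𝔸}
    (h𝔥 : ∀ X ∈ 𝔥, ∀ Y ∈ 𝔥, X * Y - Y * X ∈ 𝔥) {X H : 𝔸} (hX : X ∈ 𝔥) (hH : H ∈ 𝔥) :
    exp (-X) * fderiv ℝ exp X H ∈ 𝔥 := by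
  obtain ⟨π, hπ, hπ0⟩ := exists_continuous_complement_projection 𝔥
  have hc := continuous_exp_real (𝔸 := 𝔸)
  have h1 : π (exp (-X) * fderiv ℝ exp X H) = 0 := by
    rw [exp_neg_mul_fderiv_exp, ← ContinuousLinearMap.intervalIntegral_comp_comm]
    · simp [fun s : ℝ => hπ0 _ (exp_conj_mem h𝔥 (𝔥.smul_mem s hX) hH)]
    · apply Continuous.intervalIntegrable
      fun_prop
  simpa [h1] using hπ (exp (-X) * fderiv ℝ exp X H)

variable (𝔸) in
lemma exists_local_log : ∃ log : 𝔸 → 𝔸, ContDiffAt ℝ ∞ log 1 ∧ log 1 = 0 ∧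
    HasStrictFDerivAt log (ContinuousLinearMap.id ℝ 𝔸) 1 ∧
    (∀ᶠ X in 𝓝 (0 : 𝔸), log (exp X) = X) ∧ ∀ᶠ g in 𝓝 (1 : 𝔸), exp (log g) = g := by
  have hs : ContDiffAt ℝ ∞ (exp : 𝔸 → 𝔸) 0 := contDiff_exp_real.contDiffAt
  have hf : HasFDerivAt (exp : 𝔸 → 𝔸) ((ContinuousLinearEquiv.refl ℝ 𝔸 : 𝔸 ≃L[ℝ] 𝔸) : 𝔸 →L[ℝ] 𝔸) 0 :=
    hasFDerivAt_exp_zero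
  have hn : (∞ : WithTop ℕ∞) ≠ 0 := by simp
  have hst := hs.hasStrictFDerivAt' hf hn
  refine ⟨hs.localInverse hf hn, ?_, ?_, ?_, hst.eventually_left_inverse, ?_⟩
  · simpa using hs.to_localInverse hf hn
  · simpa using hs.localInverse_apply_image hf hn
  · have := hst.to_localInverse
    rwa [exp_zero] at this
  · have := hst.eventually_right_inverse
    rwa [exp_zero] at this

/-- The local multiplication in exponential coordinates; it preserves every Lie subalgebra. -/
lemma exists_local_mul [FiniteDimensional ℝ 𝔸] (𝔥 : Submodule ℝ 𝔸)
    (h𝔥 : ∀ X ∈ 𝔥, ∀ Y ∈ 𝔥, X * Y - Y * X ∈ 𝔥) :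
    ∃ m : 𝔸 × 𝔸 → 𝔸, m 0 = 0 ∧
      HasStrictFDerivAt m (ContinuousLinearMap.fst ℝ 𝔸 𝔸 + ContinuousLinearMap.snd ℝ 𝔸 𝔸) 0 ∧
      (∀ X, m (-X, X) = 0) ∧ (∀ᶠ q in 𝓝 (0 : 𝔸 × 𝔸), ContinuousAt m q) ∧
      (∀ᶠ q in 𝓝 (0 : 𝔸 × 𝔸), exp (m q) = exp q.1 * exp q.2) ∧
      ∀ᶠ q in 𝓝 (0 : 𝔸 × 𝔸), q.1 ∈ 𝔥 → q.2 ∈ 𝔥 → m q ∈ 𝔥 := by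
  obtain ⟨log, hlog, hlog1, hlogd, hle, hel⟩ := exists_local_log 𝔸
  obtain ⟨π, hπ, hπ0⟩ := exists_continuous_complement_projection 𝔥
  have hexp := continuous_exp_real (𝔸 := 𝔸)
  have hg : Continuous fun q : 𝔸 × 𝔸 => exp q.1 * exp q.2 := by fun_prop
  have hg0 : Tendsto (fun q : 𝔸 × 𝔸 => exp q.1 * exp q.2) (𝓝 0) (𝓝 1) := by
    simpa using hg.tendsto 0
  have hlogc : ∀ᶠ g in 𝓝 (1 : 𝔸), ContDiffAt ℝ 1 log g :=
    (hlog.of_le (by simp)).eventually (by simp)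
  set m : 𝔸 × 𝔸 → 𝔸 := fun q => log (exp q.1 * exp q.2) with hm
  have hm0 : m 0 = 0 := by simp [hm, hlog1]
  have hmc : Tendsto m (𝓝 0) (𝓝 0) := by
    have := hlog.continuousAt.tendsto.comp hg0
    rwa [hlog1] at this
  refine ⟨m, hm0, ?_, ?_, ?_, hg0.eventually hel, ?_⟩
  · have h1 := (hasStrictFDerivAt_exp_zero (𝕂 := ℝ) (𝔸 := 𝔸))
    have h2 : HasStrictFDerivAt (fun q : 𝔸 × 𝔸 => exp q.1)
        ((1 : 𝔸 →L[ℝ] 𝔸).comp (ContinuousLinearMap.fst ℝ 𝔸 𝔸)) 0 :=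
      HasStrictFDerivAt.comp (0 : 𝔸 × 𝔸) (f := Prod.fst) h1 hasStrictFDerivAt_fst
    have h3 : HasStrictFDerivAt (fun q : 𝔸 × 𝔸 => exp q.2)
        ((1 : 𝔸 →L[ℝ] 𝔸).comp (ContinuousLinearMap.snd ℝ 𝔸 𝔸)) 0 :=
      HasStrictFDerivAt.comp (0 : 𝔸 × 𝔸) (f := Prod.snd) h1 hasStrictFDerivAt_snd
    have h4 := h2.mul' h3
    have h5 : HasStrictFDerivAt log (ContinuousLinearMap.id ℝ 𝔸)
        (exp (0 : 𝔸 × 𝔸).1 * exp (0 : 𝔸 × 𝔸).2) := by simpa using hlogd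
    convert! h5.comp (0 : 𝔸 × 𝔸) h4 using 1
    ext q <;> simp
  · intro X
    simp [hm, exp_neg_mul_exp, hlog1]
  · filter_upwards [hg0.eventually hlogc] with q hq
    exact ContinuousAt.comp (f := fun q : 𝔸 × 𝔸 => exp q.1 * exp q.2) hq.continuousAt
      hg.continuousAt
  -- the vector field of the flow `t ↦ m (η, t ζ)`
  set V : 𝔸 × 𝔸 → 𝔸 := fun p => fderiv ℝ log (exp p.1) (exp p.1 * p.2) with hV
  have hVd : ContDiffAt ℝ 1 V 0 := by
    have h1 : ContDiffAt ℝ 1 (fderiv ℝ log) (exp (0 : 𝔸 × 𝔸).1) := by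
      simpa using hlog.fderiv_right (m := ∞) le_rfl |>.of_le (by simp)
    have h2 : ContDiffAt ℝ 1 (fun p : 𝔸 × 𝔸 => exp p.1) 0 :=
      (contDiff_exp_real.comp contDiff_fst).contDiffAt
    exact (h1.comp (0 : 𝔸 × 𝔸) h2).clm_apply (h2.mul contDiffAt_snd)
  obtain ⟨K, t, ht, hK⟩ := hVd.exists_lipschitzOnWith
  -- Near `0` the logarithm inverts `exp`, so `exp (-Y) · d exp_Y` is injective. It maps the
  -- finite-dimensional `𝔥` to itself, hence onto. If it takes `H` to `ζ`, then `V (Y, ζ) = H`, so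
  -- the field is tangent to `𝔥` along `𝔥`.
  have hVmem : ∀ᶠ Y in 𝓝 (0 : 𝔸), Y ∈ 𝔥 → ∀ ζ ∈ 𝔥, V (Y, ζ) ∈ 𝔥 := by
    have hexp0 : Tendsto (exp : 𝔸 → 𝔸) (𝓝 0) (𝓝 1) := by simpa using hexp.tendsto (0 : 𝔸)
    filter_upwards [hle.eventually_nhds, hexp0.eventually hlogc] with Y hY1 hY2 hY ζ hζ
    have hid : ∀ H, fderiv ℝ log (exp Y) (fderiv ℝ exp Y H) = H := fun H => by
      have h1 : HasFDerivAt (fun X => log (exp X))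
          ((fderiv ℝ log (exp Y)).comp (fderiv ℝ exp Y)) Y :=
        (hY2.differentiableAt one_ne_zero).hasFDerivAt.comp Y
          ((contDiff_exp_real (n := 1)).differentiable one_ne_zero Y).hasFDerivAt
      have h2 : HasFDerivAt (fun X => log (exp X)) (ContinuousLinearMap.id ℝ 𝔸) Y :=
        (hasFDerivAt_id Y).congr_of_eventuallyEq hY1
      exact DFunLike.congr_fun (h1.unique h2) H
    let A : 𝔥 →ₗ[ℝ] 𝔥 := LinearMap.restrict
      ((LinearMap.mulLeft ℝ (exp (-Y))) ∘ₗ (fderiv ℝ exp Y : 𝔸 →L[ℝ] 𝔸).toLinearMap)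
      (fun H hH => exp_neg_mul_fderiv_exp_mem h𝔥 hY hH)
    have hA : ∀ H : 𝔥, exp Y * (A H : 𝔸) = fderiv ℝ exp Y H := fun H => by
      change exp Y * (exp (-Y) * fderiv ℝ exp Y H) = _
      rw [← mul_assoc, exp_mul_exp_neg, one_mul]
    have hinj : Function.Injective A := fun H₁ H₂ h => by
      apply Subtype.ext
      rw [← hid H₁, ← hid H₂, ← hA, ← hA, h]
    obtain ⟨H, hH⟩ := (LinearMap.injective_iff_surjective.1 hinj) ⟨ζ, hζ⟩
    have : V (Y, ζ) = H := by
      simp only [hV]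
      rw [← hid H, ← hA, hH]
    rw [this]
    exact H.2
  -- a neighbourhood where everything is defined
  have hT1 : Tendsto (fun p : (𝔸 × 𝔸) × 𝔸 => m p.1) (𝓝 0) (𝓝 0) :=
    hmc.comp (continuous_fst.tendsto' _ _ rfl)
  have hT2 : Tendsto (fun p : (𝔸 × 𝔸) × 𝔸 => m p.1 - π (m p.1)) (𝓝 0) (𝓝 0) := by
    simpa using hT1.sub ((π.continuous.tendsto 0).comp hT1)
  have hsnd : Tendsto (fun p : (𝔸 × 𝔸) × 𝔸 => p.2) (𝓝 0) (𝓝 0) :=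
    continuous_snd.tendsto' _ _ rfl
  have hfst : Tendsto (fun p : (𝔸 × 𝔸) × 𝔸 => p.1) (𝓝 0) (𝓝 0) :=
    continuous_fst.tendsto' _ _ rfl
  have hev : ∀ᶠ p in 𝓝 (0 : (𝔸 × 𝔸) × 𝔸), (m p.1, p.2) ∈ t ∧ (m p.1 - π (m p.1), p.2) ∈ t ∧
      ContDiffAt ℝ 1 log (exp p.1.1 * exp p.1.2) ∧ exp (m p.1) = exp p.1.1 * exp p.1.2 ∧
      log (exp p.1.1) = p.1.1 ∧ ∀ ζ ∈ 𝔥, V (m p.1 - π (m p.1), ζ) ∈ 𝔥 := by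
    have e1 := (hT1.prodMk_nhds hsnd).eventually ht
    have e2 := (hT2.prodMk_nhds hsnd).eventually ht
    have e3 := (hg0.comp hfst).eventually hlogc
    have e4 := (hg0.comp hfst).eventually hel
    have e5 := hT2.eventually hVmem
    have e6 := ((continuous_fst.comp continuous_fst).tendsto' (0 : (𝔸 × 𝔸) × 𝔸) 0 rfl).eventually hle
    filter_upwards [e1, e2, e3, e4, e5, e6] with p h1 h2 h3 h4 h5 h6
    exact ⟨h1, h2, h3, h4, h6, h5 (hπ _)⟩
  obtain ⟨δ, hδ, hball⟩ := Metric.eventually_nhds_iff_ball.1 hev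
  filter_upwards [Metric.ball_mem_nhds (0 : 𝔸 × 𝔸) hδ] with q hq hη hζ
  rw [mem_ball_zero_iff, Prod.norm_def, max_lt_iff] at hq
  have hin : ∀ s ∈ Icc (0 : ℝ) 1, ((q.1, s • q.2), q.2) ∈ Metric.ball (0 : (𝔸 × 𝔸) × 𝔸) δ := by
    intro s hs
    rw [mem_ball_zero_iff, Prod.norm_def, Prod.norm_def, max_lt_iff, max_lt_iff, norm_smul,
      Real.norm_of_nonneg hs.1]
    exact ⟨⟨hq.1, (mul_le_of_le_one_left (norm_nonneg _) hs.2).trans_lt hq.2⟩, hq.2⟩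
  set M : ℝ → 𝔸 := fun s => m (q.1, s • q.2) with hM
  have hMd : ∀ s ∈ Icc (0 : ℝ) 1, HasDerivAt M (V (M s, q.2)) s := by
    intro s hs
    obtain ⟨-, -, h3, h4, -, -⟩ := hball _ (hin s hs)
    have h5 := (hasDerivAt_exp_smul_const (𝕂 := ℝ) q.2 s).const_mul (exp q.1)
    have h6 := (h3.differentiableAt one_ne_zero).hasFDerivAt.comp_hasDerivAt s h5
    simp only [hV, hM]
    rw [h4, mul_assoc]
    exact h6
  have hz : ∀ s ∈ Icc (0 : ℝ) 1, π (M s) = 0 := by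
    refine eq_zero_of_abs_deriv_le_mul_abs_self_of_eq_zero_right
      (K := ‖π‖ * K) (f' := fun s => π (V (M s, q.2))) ?_ ?_ ?_ ?_
    · exact fun s hs => (π.hasFDerivAt.comp_hasDerivAt s (hMd s hs)).continuousAt.continuousWithinAt
    · exact fun s hs =>
        (π.hasFDerivAt.comp_hasDerivAt s (hMd s (Ico_subset_Icc_self hs))).hasDerivWithinAt
    · have h1 := (hball _ (hin 0 (by simp))).2.2.2.2.1
      simpa [hM, hm, h1] using hπ0 _ hη
    · intro s hs
      obtain ⟨h1, h2, -, -, -, h5⟩ := hball _ (hin s (Ico_subset_Icc_self hs))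
      -- `V` is tangent to `𝔥` at the nearby point `M s - π (M s)` of `𝔥`; the Lipschitz bound
      -- compares the two values and leaves a multiple of the defect `π (M s)`, as Gronwall needs.
      have h6 : π (V (M s, q.2)) = π (V (M s, q.2) - V (M s - π (M s), q.2)) := by
        rw [map_sub, hπ0 _ (h5 _ hζ), sub_zero]
      have h7 : ‖V (M s, q.2) - V (M s - π (M s), q.2)‖ ≤ K * ‖π (M s)‖ := by
        have := hK.dist_le_mul _ h1 _ h2
        rw [dist_eq_norm, dist_eq_norm, Prod.mk_sub_mk, sub_self, sub_sub_cancel,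
          Prod.norm_def, norm_zero, max_eq_left (norm_nonneg _)] at this
        exact this
      rw [h6]
      calc _ ≤ ‖π‖ * (K * ‖π (M s)‖) := (π.le_opNorm _).trans (by gcongr)
        _ = ‖π‖ * K * ‖π (M s)‖ := by ring
  have h1 := hπ (M 1)
  rw [hz 1 (by simp), sub_zero] at h1
  simpa [hM] using h1

end BanachAlgebra

/-! ### The infinitesimal coadjoint action -/

section LieIdentities

set_option linter.unusedSectionVars false

variable {𝔤₀ : Type*} [LieRing 𝔤₀] [LieAlgebra ℝ 𝔤₀] {ι : Type*} [Fintype ι]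

lemma structConst_skew (e : Module.Basis ι ℝ 𝔤₀) (i j k : ι) :
    structConst e j i k = -structConst e i j k := by
  rw [structConst, structConst, ← lie_skew (e i) (e j), map_neg, Finsupp.neg_apply, neg_neg]

lemma sum_structConst_mul (e : Module.Basis ι ℝ 𝔤₀) (i j l m : ι) :
    ∑ k, structConst e j l k * structConst e i k m = e.repr ⁅e i, ⁅e j, e l⁆⁆ m := by
  conv_rhs => rw [← e.sum_repr ⁅e j, e l⁆]
  rw [lie_sum]
  simp [structConst]

lemma structConst_jacobi (e : Module.Basis ι ℝ 𝔤₀) (i j l m : ι) :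
    ∑ k, structConst e j l k * structConst e i k m -
      ∑ k, structConst e i l k * structConst e j k m =
      ∑ k, structConst e i j k * structConst e k l m := by
  have h : ∑ k, structConst e i j k * structConst e k l m =
      -∑ k, structConst e i j k * structConst e l k m := by
    rw [← Finset.sum_neg_distrib]
    exact Finset.sum_congr rfl fun k _ => by rw [structConst_skew e l k]; ring
  rw [h, sum_structConst_mul, sum_structConst_mul, sum_structConst_mul, leibniz_lie (e i),
    ← lie_skew (e l), map_add, map_neg]
  simp

lemma poissonMatrix_transpose (e : Module.Basis ι ℝ 𝔤₀) (z : ι → ℂ) :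
    (poissonMatrix e z)ᵀ = -poissonMatrix e z := by
  ext i j
  simp [poissonMatrix, structConst_skew e i j, Finset.sum_neg_distrib]

lemma poissonMatrix_add (e : Module.Basis ι ℝ 𝔤₀) (z w : ι → ℂ) :
    poissonMatrix e (z + w) = poissonMatrix e z + poissonMatrix e w := by
  ext i j
  simp [poissonMatrix, mul_add, Finset.sum_add_distrib]

lemma poissonMatrix_smul (e : Module.Basis ι ℝ 𝔤₀) (a : ℂ) (z : ι → ℂ) :
    poissonMatrix e (a • z) = a • poissonMatrix e z := by
  ext i j
  simp only [poissonMatrix, Matrix.of_apply, Pi.smul_apply, smul_eq_mul, Matrix.smul_apply,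
    Finset.mul_sum]
  exact Finset.sum_congr rfl fun k _ => by ring

lemma poissonMatrix_star (e : Module.Basis ι ℝ 𝔤₀) (z : ι → ℂ) :
    poissonMatrix e (star z) = (poissonMatrix e z).map star := by
  ext i j
  simp [poissonMatrix]

lemma coadAt_apply (e : Module.Basis ι ℝ 𝔤₀) (z ξ : ι → ℂ) :
    coadAt e z ξ = ξ ᵥ* poissonMatrix e z := rfl

lemma coadAt_eq_neg_mulVec (e : Module.Basis ι ℝ 𝔤₀) (z ξ : ι → ℂ) :
    coadAt e z ξ = -(poissonMatrix e z *ᵥ ξ) := by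
  rw [coadAt_apply, ← Matrix.mulVec_transpose, poissonMatrix_transpose, Matrix.neg_mulVec]

/-- `coadMatrix` as a linear map. -/
def coadMatrixₗ (e : Module.Basis ι ℝ 𝔤₀) : (ι → ℂ) →ₗ[ℂ] Matrix ι ι ℂ where
  toFun := coadMatrix e
  map_add' ξ η := by ext j k; simp [coadMatrix, add_mul, Finset.sum_add_distrib]
  map_smul' a ξ := by
    ext j k
    simp only [coadMatrix, Matrix.of_apply, Pi.smul_apply, smul_eq_mul, Matrix.smul_apply,
      Finset.mul_sum, RingHom.id_apply]
    exact Finset.sum_congr rfl fun k _ => by ring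

@[simp] lemma coadMatrixₗ_apply (e : Module.Basis ι ℝ 𝔤₀) (ξ : ι → ℂ) :
    coadMatrixₗ e ξ = coadMatrix e ξ := rfl

/-- The bracket of `𝔤` in coordinates is `(ξ, η) ↦ (coadMatrix e ξ)ᵀ *ᵥ η`, and `ad*` is a
representation up to sign conventions. -/
lemma coadMatrix_commutator (e : Module.Basis ι ℝ 𝔤₀) (ξ η : ι → ℂ) :
    coadMatrix e ξ * coadMatrix e η - coadMatrix e η * coadMatrix e ξ =
      -coadMatrix e ((coadMatrix e ξ)ᵀ *ᵥ η) := by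
  ext l m
  have h : ∀ i j, ∑ k, (structConst e j l k : ℂ) * structConst e i k m -
      ∑ k, (structConst e i l k : ℂ) * structConst e j k m =
      ∑ k, (structConst e i j k : ℂ) * structConst e k l m := fun i j => by
    exact_mod_cast structConst_jacobi e i j l m
  have h1 : ∀ ξ η : ι → ℂ, (coadMatrix e ξ * coadMatrix e η) l m =
      ∑ i, ∑ j, ξ i * η j * ∑ k, (structConst e i l k : ℂ) * structConst e j k m := by
    intro ξ η
    simp only [Matrix.mul_apply, coadMatrix, Matrix.of_apply, Finset.sum_mul_sum]
    simp only [Finset.mul_sum]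
    rw [Finset.sum_comm]
    refine Finset.sum_congr rfl fun i _ => ?_
    rw [Finset.sum_comm]
    refine Finset.sum_congr rfl fun j _ => Finset.sum_congr rfl fun k _ => by ring
  have h2 : coadMatrix e ((coadMatrix e ξ)ᵀ *ᵥ η) l m =
      ∑ i, ∑ j, ξ i * η j * ∑ k, (structConst e i j k : ℂ) * structConst e k l m := by
    simp only [coadMatrix, Matrix.of_apply, Matrix.mulVec, dotProduct, Matrix.transpose_apply,
      Finset.sum_mul, Finset.mul_sum]
    rw [Finset.sum_comm]
    conv_lhs => enter [2, j]; rw [Finset.sum_comm]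
    rw [Finset.sum_comm]
    refine Finset.sum_congr rfl fun i _ => Finset.sum_congr rfl fun j _ =>
      Finset.sum_congr rfl fun k _ => by ring
  rw [Matrix.sub_apply, Matrix.neg_apply, h1, h1, h2, Finset.sum_comm (f := fun i j => η i * _ * _),
    ← Finset.sum_sub_distrib, ← Finset.sum_neg_distrib]
  refine Finset.sum_congr rfl fun i _ => ?_
  rw [← Finset.sum_sub_distrib, ← Finset.sum_neg_distrib]
  refine Finset.sum_congr rfl fun j _ => ?_
  rw [← h i j]
  ring

/-- The real vectors of `𝔤`, i.e. `𝔤₀ ⊆ 𝔤`. -/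
def realVectors (ι : Type*) : Submodule ℝ (ι → ℂ) :=
  LinearMap.range (Complex.ofRealCLM.toLinearMap.compLeft ι)

lemma mem_realVectors_iff_star {ξ : ι → ℂ} : ξ ∈ realVectors ι ↔ star ξ = ξ := by
  constructor
  · rintro ⟨x, rfl⟩
    ext i
    simp
  · intro h
    refine ⟨fun i => (ξ i).re, funext fun i => ?_⟩
    exact Complex.conj_eq_iff_re.1 (congrFun h i)

lemma coadMatrix_star (e : Module.Basis ι ℝ 𝔤₀) (ξ : ι → ℂ) :
    coadMatrix e (star ξ) = (coadMatrix e ξ).map star := by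
  ext i j
  simp [coadMatrix]

lemma coadMatrix_transpose_mulVec_mem (e : Module.Basis ι ℝ 𝔤₀) {ξ η : ι → ℂ}
    (hξ : ξ ∈ realVectors ι) (hη : η ∈ realVectors ι) :
    (coadMatrix e ξ)ᵀ *ᵥ η ∈ realVectors ι := by
  rw [mem_realVectors_iff_star] at *
  have h1 := coadMatrix_star e ξ
  rw [hξ] at h1
  ext j
  simp only [Matrix.mulVec, dotProduct, Pi.star_apply, star_sum, Matrix.transpose_apply, star_mul']
  refine Finset.sum_congr rfl fun k _ => ?_
  congr 1
  · exact (congrFun (congrFun h1 k) j).symm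
  · exact congrFun hη k

/-- `ad*(𝔮)` for a real subspace `𝔮` of `𝔤`. -/
def coadImage (e : Module.Basis ι ℝ 𝔤₀) (𝔮 : Submodule ℝ (ι → ℂ)) :
    Submodule ℝ (Matrix ι ι ℂ) :=
  𝔮.map ((coadMatrixₗ e).restrictScalars ℝ)

/-- Supplies the closure under commutators for the two Lie algebras of matrices in use: `𝔮 = 𝔤`, for
the `G`-orbits, and `𝔮 = 𝔤₀`, for the `G₀`-orbits. -/
lemma coadImage_commutator_mem (e : Module.Basis ι ℝ 𝔤₀) {𝔮 : Submodule ℝ (ι → ℂ)}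
    (h𝔮 : ∀ ξ ∈ 𝔮, ∀ η ∈ 𝔮, (coadMatrix e ξ)ᵀ *ᵥ η ∈ 𝔮) :
    ∀ X ∈ coadImage e 𝔮, ∀ Y ∈ coadImage e 𝔮, X * Y - Y * X ∈ coadImage e 𝔮 := by
  rintro _ ⟨ξ, hξ, rfl⟩ _ ⟨η, hη, rfl⟩
  have := coadMatrix_commutator e ξ η
  simp only [LinearMap.coe_restrictScalars, coadMatrixₗ_apply]
  rw [this]
  exact neg_mem ⟨_, h𝔮 ξ hξ η hη, rfl⟩

end LieIdentities

/-! ### Local structure of the orbits of a matrix Lie algebra -/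

section Plaques

set_option linter.unusedSectionVars false

open NormedSpace Set Filter
open scoped Matrix.Norms.Operator

variable {ι : Type*} [Fintype ι] [DecidableEq ι]

lemma matrix_exp_mul_exp_neg (X : Matrix ι ι ℂ) : exp X * exp (-X) = 1 := exp_mul_exp_neg X

lemma matrix_hasDerivAt_exp_smul (X : Matrix ι ι ℂ) (s : ℝ) :
    HasDerivAt (fun s : ℝ => exp (s • X)) (exp (s • X) * X) s :=
  hasDerivAt_exp_smul_const (𝕂 := ℝ) X s

lemma matrix_hasDerivAt_exp_smul' (X : Matrix ι ι ℂ) (s : ℝ) :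
    HasDerivAt (fun s : ℝ => exp (s • X)) (X * exp (s • X)) s :=
  hasDerivAt_exp_smul_const' (𝕂 := ℝ) X s

lemma matrix_hasDerivAt_exp_neg_smul (X : Matrix ι ι ℂ) (s : ℝ) :
    HasDerivAt (fun s : ℝ => exp (-(s • X))) (-(exp (-(s • X)) * X)) s :=
  hasDerivAt_exp_neg_smul X s

/-- `exists_local_mul` for matrices. -/
lemma exists_local_mul_matrix (𝔥 : Submodule ℝ (Matrix ι ι ℂ))
    (h𝔥 : ∀ X ∈ 𝔥, ∀ Y ∈ 𝔥, X * Y - Y * X ∈ 𝔥) :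
    ∃ m : Matrix ι ι ℂ × Matrix ι ι ℂ → Matrix ι ι ℂ, m 0 = 0 ∧
      HasStrictFDerivAt m (ContinuousLinearMap.fst ℝ (Matrix ι ι ℂ) (Matrix ι ι ℂ) +
        ContinuousLinearMap.snd ℝ (Matrix ι ι ℂ) (Matrix ι ι ℂ)) 0 ∧
      (∀ X, m (-X, X) = 0) ∧ (∀ᶠ q in 𝓝 0, ContinuousAt m q) ∧
      (∀ᶠ q in 𝓝 0, exp (m q) = exp q.1 * exp q.2) ∧
      ∀ᶠ q in 𝓝 0, q.1 ∈ 𝔥 → q.2 ∈ 𝔥 → m q ∈ 𝔥 :=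
  exists_local_mul 𝔥 h𝔥

/-- The evaluation `X ↦ X z`. -/
def mulVecAt (z : ι → ℂ) : Matrix ι ι ℂ →ₗ[ℝ] (ι → ℂ) where
  toFun X := X *ᵥ z
  map_add' X Y := Matrix.add_mulVec X Y z
  map_smul' a X := Matrix.smul_mulVec a X z

lemma exists_section_mulVecAt (𝔥 : Submodule ℝ (Matrix ι ι ℂ)) (z : ι → ℂ) :
    ∃ τ : (𝔥.map (mulVecAt z)) →ₗ[ℝ] Matrix ι ι ℂ,
      ∀ v, τ v ∈ 𝔥 ∧ τ v *ᵥ z = (v : ι → ℂ) := by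
  let f : 𝔥 →ₗ[ℝ] 𝔥.map (mulVecAt z) := (mulVecAt z).submoduleMap 𝔥
  obtain ⟨g, hg⟩ := f.exists_rightInverse_of_surjective
    (LinearMap.range_eq_top.2 ((mulVecAt z).submoduleMap_surjective 𝔥))
  refine ⟨𝔥.subtype ∘ₗ g, fun v => ⟨(g v).2, ?_⟩⟩
  exact congrArg Subtype.val (DFunLike.congr_fun hg v)

lemma exp_mulVec_of_mulVec_eq_zero {X : Matrix ι ι ℂ} {z : ι → ℂ} (h : X *ᵥ z = 0) :
    exp X *ᵥ z = z := by
  let c : Matrix ι ι ℂ →L[ℝ] (ι → ℂ) := LinearMap.toContinuousLinearMap (mulVecAt z)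
  have hd : ∀ s : ℝ, HasDerivAt (fun s : ℝ => exp (s • X) *ᵥ z) 0 s := fun s => by
    have h1 := c.hasFDerivAt.comp_hasDerivAt s (matrix_hasDerivAt_exp_smul X s)
    have h2 : c (exp (s • X) * X) = 0 := by
      change (exp (s • X) * X) *ᵥ z = 0
      rw [← Matrix.mulVec_mulVec, h, Matrix.mulVec_zero]
    exact h1.congr_deriv h2
  have := is_const_of_deriv_eq_zero (fun s => (hd s).differentiableAt) (fun s => (hd s).deriv) 1 0
  simpa using this

/-- Near `z`, the orbit of `z` is parametrized by the exponentials of a complement of the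
stabilizer. -/
lemma exists_exp_section (𝔥 : Submodule ℝ (Matrix ι ι ℂ))
    (h𝔥 : ∀ X ∈ 𝔥, ∀ Y ∈ 𝔥, X * Y - Y * X ∈ 𝔥) (z : ι → ℂ)
    (τ : (𝔥.map (mulVecAt z)) →ₗ[ℝ] Matrix ι ι ℂ)
    (hτ : ∀ v, τ v ∈ 𝔥 ∧ τ v *ᵥ z = (v : ι → ℂ))
    {W : Set (𝔥.map (mulVecAt z))} (hW : W ∈ 𝓝 0) :
    ∀ᶠ X in 𝓝 (0 : Matrix ι ι ℂ), X ∈ 𝔥 → ∃ v ∈ W, exp X *ᵥ z = exp (τ v) *ᵥ z := by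
  obtain ⟨m, hm0, hmd, -, -, hme, hm𝔥⟩ := exists_local_mul_matrix 𝔥 h𝔥
  -- The stabilizer of `z` in `𝔥`; together with the values of `τ` it spans `𝔥`.
  let 𝔰 : Submodule ℝ (Matrix ι ι ℂ) := 𝔥 ⊓ LinearMap.ker (mulVecAt z)
  obtain ⟨q, hq⟩ := 𝔥.exists_isCompl
  let pr : Matrix ι ι ℂ →L[ℝ] 𝔥 := LinearMap.toContinuousLinearMap (𝔥.projectionOnto q hq)
  have hpr : ∀ X : 𝔥, pr X = X := fun X => Submodule.projectionOnto_apply_left hq X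
  let j : ((𝔥.map (mulVecAt z)) × 𝔰) →L[ℝ] Matrix ι ι ℂ × Matrix ι ι ℂ :=
    LinearMap.toContinuousLinearMap (τ.prodMap 𝔰.subtype)
  have hj0 : Tendsto j (𝓝 0) (𝓝 0) := j.continuous.tendsto' _ _ (map_zero j)
  -- The map `(v, s) ↦ log (exp (τ v) exp s)` has derivative `(v, s) ↦ τ v + s`, onto `𝔥`, so it
  -- hits every small `X ∈ 𝔥`; the factor `exp s` fixes `z`. The projection `pr` only gives the map
  -- the codomain `𝔥`: near `0` the values lie there already.
  have hf : HasStrictFDerivAt (fun p => pr (m (j p)))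
      (pr.comp (((ContinuousLinearMap.fst ℝ (Matrix ι ι ℂ) (Matrix ι ι ℂ)) +
        ContinuousLinearMap.snd ℝ (Matrix ι ι ℂ) (Matrix ι ι ℂ)).comp j)) 0 := by
    have h1 : HasStrictFDerivAt m (ContinuousLinearMap.fst ℝ (Matrix ι ι ℂ) (Matrix ι ι ℂ) +
        ContinuousLinearMap.snd ℝ (Matrix ι ι ℂ) (Matrix ι ι ℂ)) (j 0) := by rwa [map_zero]
    exact pr.hasStrictFDerivAt.comp 0 (h1.comp 0 j.hasStrictFDerivAt)
  have hsurj : (pr.comp (((ContinuousLinearMap.fst ℝ (Matrix ι ι ℂ) (Matrix ι ι ℂ)) +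
        ContinuousLinearMap.snd ℝ (Matrix ι ι ℂ) (Matrix ι ι ℂ)).comp j)).range = ⊤ := by
    refine LinearMap.range_eq_top.2 fun X => ?_
    let v : 𝔥.map (mulVecAt z) := ⟨(X : Matrix ι ι ℂ) *ᵥ z, ⟨X, X.2, rfl⟩⟩
    have hs : (X : Matrix ι ι ℂ) - τ v ∈ 𝔰 := by
      refine ⟨sub_mem X.2 (hτ v).1, ?_⟩
      change ((X : Matrix ι ι ℂ) - τ v) *ᵥ z = 0
      rw [Matrix.sub_mulVec, (hτ v).2, sub_self]
    refine ⟨(v, ⟨_, hs⟩), ?_⟩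
    change pr (τ v + (X - τ v)) = X
    rw [add_sub_cancel, hpr]
  have hmap := hf.map_nhds_eq_of_surj hsurj
  rw [map_zero, hm0, map_zero] at hmap
  have hgood : ∀ᶠ p in 𝓝 (0 : (𝔥.map (mulVecAt z)) × 𝔰), p.1 ∈ W ∧ m (j p) ∈ 𝔥 ∧
      exp (m (j p)) = exp (τ p.1) * exp (p.2 : Matrix ι ι ℂ) := by
    have e1 : ∀ᶠ p in 𝓝 (0 : (𝔥.map (mulVecAt z)) × 𝔰), p.1 ∈ W :=
      (continuous_fst.tendsto' (0 : (𝔥.map (mulVecAt z)) × 𝔰) 0 rfl).eventually hW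
    filter_upwards [e1, hj0.eventually hme, hj0.eventually hm𝔥] with p h1 h2 h3
    exact ⟨h1, h3 (hτ p.1).1 p.2.2.1, h2⟩
  have him := hmap.ge (Filter.image_mem_map (m := fun p => pr (m (j p))) hgood)
  rw [mem_nhds_subtype] at him
  obtain ⟨u, hu, hsub⟩ := him
  filter_upwards [hu] with X hX hX𝔥
  obtain ⟨p, ⟨h1, h2, h3⟩, h4⟩ := hsub (show (⟨X, hX𝔥⟩ : 𝔥) ∈ Subtype.val ⁻¹' u from hX)
  refine ⟨p.1, h1, ?_⟩
  have h5 : m (j p) = X := by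
    have := hpr ⟨_, h2⟩
    exact congrArg Subtype.val (this.symm.trans h4)
  rw [← h5, h3, ← Matrix.mulVec_mulVec, exp_mulVec_of_mulVec_eq_zero p.2.2.2]

end Plaques

/-! ### Orbits -/

section Orbits

set_option linter.unusedSectionVars false

open NormedSpace Set Filter
open scoped Matrix.Norms.Operator

variable {ι : Type*} [Fintype ι] [DecidableEq ι]

/-- The group generated by the exponentials of a Lie subalgebra is covered by countably many
translates of the exponential image of any neighbourhood of `0`. -/
lemma exists_countable_cover (𝔥 : Submodule ℝ (Matrix ι ι ℂ))
    (h𝔥 : ∀ X ∈ 𝔥, ∀ Y ∈ 𝔥, X * Y - Y * X ∈ 𝔥) {W : Set (Matrix ι ι ℂ)} (hW : W ∈ 𝓝 0) :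
    ∃ Γ : Set (Matrix ι ι ℂ), Γ.Countable ∧
      ∀ u ∈ Subgroup.closure {u : (Matrix ι ι ℂ)ˣ | ∃ X ∈ 𝔥, (u : Matrix ι ι ℂ) = exp X},
        ∃ g ∈ Γ, ∃ X ∈ 𝔥, X ∈ W ∧ (u : Matrix ι ι ℂ) = g * exp X := by
  obtain ⟨m, hm0, hmd, hmX, hmc, hme, hm𝔥⟩ := exists_local_mul_matrix 𝔥 h𝔥
  have : SecondCountableTopology (Matrix ι ι ℂ) :=
    inferInstanceAs (SecondCountableTopology (ι → ι → ℂ))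
  have hsep : TopologicalSpace.SeparableSpace 𝔥 := by
    have h2 : SecondCountableTopology 𝔥 := TopologicalSpace.Subtype.secondCountableTopology _
    exact TopologicalSpace.SecondCountableTopology.to_separableSpace
  obtain ⟨D, hDc, hD⟩ := TopologicalSpace.exists_countable_dense 𝔥
  have := hDc.to_subtype
  -- Take `Y = m (-d, X)`, the logarithm of `exp (-d) exp X`. It vanishes at `d = X`, so it is as
  -- small as wanted once `d ∈ D` is close to `X`.
  have ha : ∀ᶠ X in 𝓝 (0 : Matrix ι ι ℂ), X ∈ 𝔥 → ∀ V ∈ 𝓝 (0 : Matrix ι ι ℂ),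
      ∃ d : D, ∃ Y ∈ 𝔥, Y ∈ V ∧ exp X = exp ((d : 𝔥) : Matrix ι ι ℂ) * exp Y := by
    have ht : Tendsto (fun X : Matrix ι ι ℂ => (-X, X)) (𝓝 0) (𝓝 0) := by
      have : Continuous (fun X : Matrix ι ι ℂ => (-X, X)) := by fun_prop
      exact this.tendsto' _ _ (by simp)
    filter_upwards [ht.eventually hmc, ht.eventually hme.eventually_nhds,
      ht.eventually hm𝔥.eventually_nhds] with X h1 h2 h3 hX V hV
    have h4 : ∀ᶠ q in 𝓝 (-X, X), m q ∈ V := h1.eventually (by rwa [hmX])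
    have h5 : Tendsto (fun d : 𝔥 => (-(d : Matrix ι ι ℂ), X)) (𝓝 ⟨X, hX⟩) (𝓝 (-X, X)) := by
      have : Continuous (fun d : 𝔥 => (-(d : Matrix ι ι ℂ), X)) := by fun_prop
      exact this.tendsto' _ _ rfl
    obtain ⟨d, ⟨h6, h7, h8⟩, hd⟩ := (hD.inter_nhds_nonempty
      (h5.eventually (h4.and (h2.and h3)))).imp fun d hd => And.symm hd
    refine ⟨⟨d, hd⟩, m (-(d : Matrix ι ι ℂ), X), h8 (neg_mem d.2) hX, h6, ?_⟩
    rw [h7, ← mul_assoc, matrix_exp_mul_exp_neg, one_mul]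
  have hmt : Tendsto m (𝓝 0) (𝓝 0) := by
    have h := hmd.hasFDerivAt.continuousAt.tendsto
    rwa [hm0] at h
  obtain ⟨W₁, hW₁, W₂, hW₂, hb⟩ := Filter.mem_prod_iff.1
    (show {q : Matrix ι ι ℂ × Matrix ι ι ℂ | (q.1 ∈ 𝔥 → q.2 ∈ 𝔥 → m q ∈ 𝔥) ∧
        exp (m q) = exp q.1 * exp q.2 ∧ (m q ∈ 𝔥 → ∀ V ∈ 𝓝 (0 : Matrix ι ι ℂ),
        ∃ d : D, ∃ Y ∈ 𝔥, Y ∈ V ∧ exp (m q) = exp ((d : 𝔥) : Matrix ι ι ℂ) * exp Y)} ∈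
        𝓝 (0 : Matrix ι ι ℂ) ×ˢ 𝓝 (0 : Matrix ι ι ℂ) by
      rw [← nhds_prod_eq]
      exact hm𝔥.and (hme.and (hmt.eventually ha)))
  let Γ : Set (Matrix ι ι ℂ) :=
    range fun l : List D => (l.map fun d => exp ((d : 𝔥) : Matrix ι ι ℂ)).prod
  let S : Set (Matrix ι ι ℂ) := {g | ∃ a ∈ Γ, ∃ X ∈ 𝔥, X ∈ W ∩ W₁ ∧ g = a * exp X}
  -- In `γ exp X exp Y` the last two factors combine to one exponential, which is split again as
  -- `exp d exp Z` with `Z` small; the letter `d` is absorbed into the word `γ`.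
  have hS : ∀ g ∈ S, ∀ Y ∈ 𝔥, Y ∈ W₂ → g * exp Y ∈ S := by
    rintro _ ⟨_, ⟨l, rfl⟩, X, hX, hXW, rfl⟩ Y hY hYW
    obtain ⟨h1, h2, h3⟩ := hb (Set.mk_mem_prod hXW.2 hYW)
    obtain ⟨d, Z, hZ, hZW, h4⟩ := h3 (h1 hX hY) (W ∩ W₁) (inter_mem hW hW₁)
    refine ⟨_, ⟨l ++ [d], rfl⟩, Z, hZ, hZW, ?_⟩
    dsimp only at h2 h4 ⊢
    rw [mul_assoc, ← h2, h4]
    simp [mul_assoc]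
  -- The smallness of `Y` is removed by writing `exp Y` as the `(k + 1)`-st power of `exp (Y / (k +
  -- 1))`.
  have hS' : ∀ g ∈ S, ∀ Y ∈ 𝔥, g * exp Y ∈ S := by
    intro g hg Y hY
    have ht : Tendsto (fun k : ℕ => ((k : ℝ) + 1)⁻¹ • Y) atTop (𝓝 0) := by
      have := (tendsto_one_div_add_atTop_nhds_zero_nat (𝕜 := ℝ)).smul_const Y
      simpa using this
    obtain ⟨k, hk⟩ := (ht.eventually hW₂).exists
    have hpow : ∀ n : ℕ, g * exp (((k : ℝ) + 1)⁻¹ • Y) ^ n ∈ S := by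
      intro n
      induction n with
      | zero => simpa using hg
      | succ n ih =>
        rw [pow_succ, ← mul_assoc]
        exact hS _ ih _ (𝔥.smul_mem _ hY) hk
    have h1 : exp (((k : ℝ) + 1)⁻¹ • Y) ^ (k + 1) = exp Y := by
      rw [← Matrix.exp_nsmul]
      congr 1
      rw [← Nat.cast_smul_eq_nsmul ℝ, smul_smul]
      push_cast
      rw [mul_inv_cancel₀ (by positivity), one_smul]
    rw [← h1]
    exact hpow (k + 1)
  refine ⟨Γ, countable_range _, fun u hu => ?_⟩
  suffices h : (u : Matrix ι ι ℂ) ∈ S by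
    obtain ⟨a, ha, X, hX, hXW, h⟩ := h
    exact ⟨a, ha, X, hX, hXW.1, h⟩
  induction hu using Subgroup.closure_induction_right with
  | one => exact ⟨1, ⟨[], by simp⟩, 0, zero_mem _,
      ⟨mem_of_mem_nhds hW, mem_of_mem_nhds hW₁⟩, by simp⟩
  | mul_right x hx y hy ih =>
    obtain ⟨Y, hY, h⟩ := hy
    rw [Units.val_mul, h]
    exact hS' _ ih Y hY
  | mul_inv_cancel x hx y hy ih =>
    obtain ⟨Y, hY, h⟩ := hy
    have h1 : ((y⁻¹ : (Matrix ι ι ℂ)ˣ) : Matrix ι ι ℂ) = exp (-Y) := by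
      rw [Units.inv_eq_of_mul_eq_one_right]
      rw [h, matrix_exp_mul_exp_neg]
    rw [Units.val_mul, h1]
    exact hS' _ ih _ (neg_mem hY)

lemma contDiff_mulVec_const {n : WithTop ℕ∞} (z : ι → ℂ) :
    ContDiff ℝ n fun X : Matrix ι ι ℂ => X *ᵥ z :=
  (LinearMap.toContinuousLinearMap (mulVecAt z)).contDiff

/-- An orbit of the group generated by the exponentials of a Lie subalgebra has Hausdorff dimension
at most the dimension of its tangent space. -/
lemma dimH_orbit_le (𝔥 : Submodule ℝ (Matrix ι ι ℂ))
    (h𝔥 : ∀ X ∈ 𝔥, ∀ Y ∈ 𝔥, X * Y - Y * X ∈ 𝔥) (z : ι → ℂ) :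
    dimH {w : ι → ℂ | ∃ u ∈ Subgroup.closure
      {u : (Matrix ι ι ℂ)ˣ | ∃ X ∈ 𝔥, (u : Matrix ι ι ℂ) = exp X},
        (u : Matrix ι ι ℂ) *ᵥ z = w} ≤ Module.finrank ℝ (𝔥.map (mulVecAt z)) := by
  obtain ⟨τ, hτ⟩ := exists_section_mulVecAt 𝔥 z
  -- The neighbourhood is chosen so that `exp X z` is already of the form `exp (τ v) z`. The orbit
  -- is then covered by countably many `C¹` images of its tangent space at `z`.
  obtain ⟨Γ, hΓ, hcov⟩ := exists_countable_cover 𝔥 h𝔥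
    (exists_exp_section 𝔥 h𝔥 z τ hτ (W := univ) univ_mem)
  let F : Matrix ι ι ℂ → 𝔥.map (mulVecAt z) → (ι → ℂ) := fun g v => (g * exp (τ v)) *ᵥ z
  have hF : ∀ g, ContDiff ℝ 1 (F g) := fun g => by
    have h1 : ContDiff ℝ 1 fun v => exp (τ v) :=
      contDiff_exp_real.comp (LinearMap.toContinuousLinearMap τ).contDiff
    exact (contDiff_mulVec_const z).comp (contDiff_const.mul h1)
  refine (dimH_mono (t := ⋃ g ∈ Γ, range (F g)) ?_).trans ?_
  · rintro _ ⟨u, hu, rfl⟩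
    obtain ⟨g, hg, X, hX, hXW, h⟩ := hcov u hu
    obtain ⟨v, -, hv⟩ := hXW hX
    refine mem_iUnion₂.2 ⟨g, hg, v, ?_⟩
    simp only [F]
    rw [h, ← Matrix.mulVec_mulVec, ← hv, Matrix.mulVec_mulVec]
  · rw [dimH_bUnion hΓ]
    exact iSup₂_le fun g _ => (hF g).dimH_range_le

end Orbits

section CoadjointAction

set_option linter.unusedSectionVars false

open NormedSpace Set Filter
open scoped Matrix.Norms.Operator

variable {𝔤₀ : Type*} [LieRing 𝔤₀] [LieAlgebra ℝ 𝔤₀] {ι : Type*} [Fintype ι] [DecidableEq ι]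

/-! ### The exponential parametrization of the orbits -/

/-- `coadMatrix` as a continuous real linear map. -/
def coadMatrixL (e : Module.Basis ι ℝ 𝔤₀) : (ι → ℂ) →L[ℝ] Matrix ι ι ℂ :=
  LinearMap.toContinuousLinearMap ((coadMatrixₗ e).restrictScalars ℝ)

/-- `coadAt` as a continuous real linear map. -/
def coadAtL (e : Module.Basis ι ℝ 𝔤₀) (z : ι → ℂ) : (ι → ℂ) →L[ℝ] (ι → ℂ) :=
  LinearMap.toContinuousLinearMap ((coadAt e z).restrictScalars ℝ)

@[simp] lemma coadMatrix_zero (e : Module.Basis ι ℝ 𝔤₀) : coadMatrix e 0 = 0 :=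
  map_zero (coadMatrixₗ e)

@[simp] lemma coadExp_zero (e : Module.Basis ι ℝ 𝔤₀) (z : ι → ℂ) : coadExp e 0 z = z := by
  simp [coadExp]

lemma contDiff_exp_coadMatrix (e : Module.Basis ι ℝ 𝔤₀) {n : WithTop ℕ∞} :
    ContDiff ℝ n fun ξ : ι → ℂ => exp (coadMatrix e ξ) :=
  contDiff_exp_real.comp (coadMatrixL e).contDiff

lemma contDiff_coadExp (e : Module.Basis ι ℝ 𝔤₀) (z : ι → ℂ) {n : WithTop ℕ∞} :
    ContDiff ℝ n fun ξ => coadExp e ξ z :=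
  (contDiff_mulVec_const z).comp (contDiff_exp_coadMatrix e)

lemma continuous_coadExp (e : Module.Basis ι ℝ 𝔤₀) (z : ι → ℂ) :
    Continuous fun ξ => coadExp e ξ z :=
  (contDiff_coadExp e z (n := 0)).continuous

lemma tendsto_coadExp (e : Module.Basis ι ℝ 𝔤₀) (z : ι → ℂ) :
    Tendsto (fun ξ => coadExp e ξ z) (𝓝 0) (𝓝 z) :=
  (continuous_coadExp e z).tendsto' _ _ (coadExp_zero e z)

lemma hasStrictFDerivAt_coadExp (e : Module.Basis ι ℝ 𝔤₀) (z : ι → ℂ) :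
    HasStrictFDerivAt (fun ξ => coadExp e ξ z) (coadAtL e z) 0 := by
  let c : Matrix ι ι ℂ →L[ℝ] (ι → ℂ) := LinearMap.toContinuousLinearMap (mulVecAt z)
  have h1 : HasStrictFDerivAt (exp : Matrix ι ι ℂ → Matrix ι ι ℂ)
      (1 : Matrix ι ι ℂ →L[ℝ] Matrix ι ι ℂ) (coadMatrixL e 0) := by
    rw [map_zero]
    exact hasStrictFDerivAt_exp_zero
  have h2 := c.hasStrictFDerivAt.comp (0 : ι → ℂ) (h1.comp 0 (coadMatrixL e).hasStrictFDerivAt)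
  convert! h2 using 1
  exact ContinuousLinearMap.ext fun ξ => (coadMatrix_mulVec e ξ z).symm

lemma map_mulVecAt_coadImage (e : Module.Basis ι ℝ 𝔤₀) (𝔮 : Submodule ℝ (ι → ℂ)) (z : ι → ℂ) :
    (coadImage e 𝔮).map (mulVecAt z) = 𝔮.map ((coadAt e z).restrictScalars ℝ) := by
  rw [coadImage, ← Submodule.map_comp]
  congr 1
  exact LinearMap.ext fun ξ => coadMatrix_mulVec e ξ z

/-- A smooth local retraction onto the exponential plaque of the orbit through `z`, written in
exponential coordinates. -/
lemma exists_plaque_retraction (e : Module.Basis ι ℝ 𝔤₀) (z : ι → ℂ) :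
    ∃ ρ : (ι → ℂ) → (ι → ℂ), ContDiffAt ℝ ∞ ρ z ∧ ρ z = 0 ∧
      ∀ᶠ q in 𝓝 (0 : (ι → ℂ) × (ι → ℂ)),
        coadExp e (ρ (coadExp e q.1 (coadExp e q.2 z))) z =
          coadExp e q.1 (coadExp e q.2 z) := by
  let 𝔥 := coadImage e (⊤ : Submodule ℝ (ι → ℂ))
  have h𝔥 := coadImage_commutator_mem e (𝔮 := ⊤) (fun _ _ _ _ => Submodule.mem_top)
  have hT := map_mulVecAt_coadImage e ⊤ z
  obtain ⟨σ, hσ⟩ : ∃ σ : 𝔥.map (mulVecAt z) →ₗ[ℝ] (ι → ℂ), ∀ v, coadAt e z (σ v) = v := by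
    let f : (ι → ℂ) →ₗ[ℝ] 𝔥.map (mulVecAt z) :=
      ((coadAt e z).restrictScalars ℝ).codRestrict _ fun ξ => by
        rw [hT]
        exact ⟨ξ, Submodule.mem_top, rfl⟩
    obtain ⟨g, hg⟩ := f.exists_rightInverse_of_surjective (LinearMap.range_eq_top.2 fun v => by
      obtain ⟨ξ, -, h⟩ := hT.le v.2
      exact ⟨ξ, Subtype.ext h⟩)
    exact ⟨g, fun v => congrArg Subtype.val (DFunLike.congr_fun hg v)⟩
  let σL : 𝔥.map (mulVecAt z) →L[ℝ] (ι → ℂ) := LinearMap.toContinuousLinearMap σ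
  obtain ⟨T', hT'⟩ := (𝔥.map (mulVecAt z)).exists_isCompl
  let S : (ι → ℂ) →L[ℝ] 𝔥.map (mulVecAt z) :=
    LinearMap.toContinuousLinearMap ((𝔥.map (mulVecAt z)).projectionOnto T' hT')
  have hS : ∀ v : 𝔥.map (mulVecAt z), S v = v :=
    fun v => Submodule.projectionOnto_apply_left hT' v
  -- The plaque `v ↦ exp (σ v) z`, projected back to the tangent space. Its differential at `0` is
  -- the identity, and its local inverse `θ` reads off the exponential coordinate of a point of the
  -- plaque.
  let f : 𝔥.map (mulVecAt z) → 𝔥.map (mulVecAt z) := fun v => S (coadExp e (σL v) z)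
  have hfs : ContDiffAt ℝ ∞ f 0 :=
    (S.contDiff.comp ((contDiff_coadExp e z).comp σL.contDiff)).contDiffAt
  have hfd : HasFDerivAt f ((ContinuousLinearEquiv.refl ℝ (𝔥.map (mulVecAt z)) :
      _ ≃L[ℝ] _) : 𝔥.map (mulVecAt z) →L[ℝ] 𝔥.map (mulVecAt z)) 0 := by
    have h1 : HasFDerivAt (fun ξ => coadExp e ξ z) (coadAtL e z) (σL 0) := by
      rw [map_zero]
      exact (hasStrictFDerivAt_coadExp e z).hasFDerivAt
    have h2 := S.hasFDerivAt.comp (0 : 𝔥.map (mulVecAt z)) (h1.comp 0 σL.hasFDerivAt)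
    convert! h2 using 1
    ext1 v
    change v = S (coadAt e z (σ v))
    rw [hσ, hS]
  have hn : (∞ : WithTop ℕ∞) ≠ 0 := by simp
  have hst := hfs.hasStrictFDerivAt' hfd hn
  set θ := hfs.localInverse hfd hn with hθ
  have hθs : ContDiffAt ℝ ∞ θ (S z) := by
    have := hfs.to_localInverse hfd hn
    simpa [f] using this
  have hθ0 : θ (S z) = 0 := by
    have := hfs.localInverse_apply_image hfd hn
    simpa [f] using this
  have hθf : ∀ᶠ v in 𝓝 0, θ (f v) = v := hst.eventually_left_inverse
  refine ⟨fun w => σL (θ (S w)), ?_, ?_, ?_⟩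
  · exact σL.contDiff.contDiffAt.comp z (hθs.comp z S.contDiff.contDiffAt)
  · simp [hθ0]
  -- A product of two small exponentials is one exponential from `𝔥`, so it moves `z` to a point
  -- `exp (σ v) z`; here `v` is required to lie where `θ (f v) = v`.
  · have hsec := exists_exp_section 𝔥 h𝔥 z ((coadMatrixₗ e).restrictScalars ℝ ∘ₗ σ)
      (fun v => ⟨⟨σ v, Submodule.mem_top, rfl⟩, (coadMatrix_mulVec e (σ v) z).trans (hσ v)⟩) hθf
    obtain ⟨m, hm0, hmd, -, -, hme, hm𝔥⟩ := exists_local_mul_matrix 𝔥 h𝔥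
    have hmt : Tendsto m (𝓝 0) (𝓝 0) := by
      have h := hmd.hasFDerivAt.continuousAt.tendsto
      rwa [hm0] at h
    have ht : Tendsto (fun q : (ι → ℂ) × (ι → ℂ) => (coadMatrixL e q.1, coadMatrixL e q.2))
        (𝓝 0) (𝓝 0) := by
      have : Continuous fun q : (ι → ℂ) × (ι → ℂ) => (coadMatrixL e q.1, coadMatrixL e q.2) := by
        fun_prop
      exact this.tendsto' _ _ (by simp)
    filter_upwards [ht.eventually hme, ht.eventually hm𝔥, ht.eventually (hmt.eventually hsec)]
      with q h1 h2 h3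
    obtain ⟨v, hv, h4⟩ := h3 (h2 ⟨_, Submodule.mem_top, rfl⟩ ⟨_, Submodule.mem_top, rfl⟩)
    have h5 : coadExp e q.1 (coadExp e q.2 z) = coadExp e (σ v) z := by
      simp only [coadExp]
      rw [Matrix.mulVec_mulVec]
      exact (congrArg (· *ᵥ z) h1.symm).trans h4
    have h6 : θ (S (coadExp e (σ v) z)) = v := hv
    simp only [h5, h6]
    rfl

/-! ### Equivariance -/

/-- With `η t = exp (t Xᵀ) ξ`, the curve `exp (t X) ad*(η t) exp (-t X)` has zero derivative by the
commutator formula; compare its values at `t = 0` and `t = 1`. Thus a group element `u` of the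
coadjoint action acts on `𝔤` by its transpose. -/
lemma coadMatrix_equivariant_exp (e : Module.Basis ι ℝ 𝔤₀) (ζ ξ : ι → ℂ) :
    exp (coadMatrix e ζ) * coadMatrix e ((exp (coadMatrix e ζ))ᵀ *ᵥ ξ) =
      coadMatrix e ξ * exp (coadMatrix e ζ) := by
  set X := coadMatrix e ζ with hX
  let η : ℝ → ι → ℂ := fun t => exp (t • Xᵀ) *ᵥ ξ
  have hη : ∀ t, HasDerivAt η (Xᵀ *ᵥ η t) t := fun t => by
    have h1 := (LinearMap.toContinuousLinearMap (mulVecAt ξ)).hasFDerivAt.comp_hasDerivAt t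
      (matrix_hasDerivAt_exp_smul' Xᵀ t)
    exact h1.congr_deriv (Matrix.mulVec_mulVec ξ Xᵀ _).symm
  let F : ℝ → Matrix ι ι ℂ := fun t => exp (t • X) * coadMatrix e (η t) * exp (-(t • X))
  have hF : ∀ t, HasDerivAt F 0 t := fun t => by
    have h1 : HasDerivAt (fun t => coadMatrix e (η t)) (coadMatrix e (Xᵀ *ᵥ η t)) t :=
      (coadMatrixL e).hasFDerivAt.comp_hasDerivAt t (hη t)
    have h2 := ((matrix_hasDerivAt_exp_smul X t).mul h1).mul (matrix_hasDerivAt_exp_neg_smul X t)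
    refine h2.congr_deriv ?_
    have hc : exp (-(t • X)) * X = X * exp (-(t • X)) :=
      ((Commute.refl X).smul_right t).neg_right.exp_right.eq.symm
    have h3 : coadMatrix e (Xᵀ *ᵥ η t) = coadMatrix e (η t) * X - X * coadMatrix e (η t) := by
      rw [← neg_sub (X * _), hX, coadMatrix_commutator, neg_neg]
    rw [h3, hc]
    simp only [Pi.mul_apply, add_mul, mul_sub, sub_mul, mul_assoc, mul_neg]
    abel
  have h1 := is_const_of_deriv_eq_zero (fun t => (hF t).differentiableAt) (fun t => (hF t).deriv) 1 0
  simp only [F, η, one_smul, zero_smul, neg_zero, exp_zero, one_mul, mul_one, Matrix.one_mulVec]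
    at h1
  rw [← Matrix.exp_transpose]
  have h2 : exp (-X) * exp X = 1 := exp_neg_mul_exp X
  rw [← h1, mul_assoc, h2, mul_one]

lemma coadMatrix_equivariant (e : Module.Basis ι ℝ 𝔤₀) {u : (Matrix ι ι ℂ)ˣ}
    (hu : u ∈ coadjointGroup e) (ξ : ι → ℂ) :
    (u : Matrix ι ι ℂ) * coadMatrix e ((u : Matrix ι ι ℂ)ᵀ *ᵥ ξ) =
      coadMatrix e ξ * (u : Matrix ι ι ℂ) := by
  induction hu using Subgroup.closure_induction generalizing ξ with
  | mem u hu =>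
    obtain ⟨ζ, h⟩ := hu
    rw [h]
    exact coadMatrix_equivariant_exp e ζ ξ
  | one => simp
  | mul u v _ _ hu hv =>
    rw [Units.val_mul, Matrix.transpose_mul, ← Matrix.mulVec_mulVec, mul_assoc, hv, ← mul_assoc, hu,
      mul_assoc]
  | inv u _ hu =>
    have h1 := hu (((u⁻¹ : (Matrix ι ι ℂ)ˣ) : Matrix ι ι ℂ)ᵀ *ᵥ ξ)
    rw [Matrix.mulVec_mulVec, ← Matrix.transpose_mul, Units.inv_mul, Matrix.transpose_one,
      Matrix.one_mulVec] at h1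
    calc _ = ((u⁻¹ : (Matrix ι ι ℂ)ˣ) : Matrix ι ι ℂ) *
          (coadMatrix e (((u⁻¹ : (Matrix ι ι ℂ)ˣ) : Matrix ι ι ℂ)ᵀ *ᵥ ξ) * (u : Matrix ι ι ℂ)) *
            ((u⁻¹ : (Matrix ι ι ℂ)ˣ) : Matrix ι ι ℂ) := by
          rw [mul_assoc, mul_assoc, Units.mul_inv, mul_one]
      _ = _ := by rw [← h1, ← mul_assoc, Units.inv_mul, one_mul]

lemma coadAt_equivariant (e : Module.Basis ι ℝ 𝔤₀) {u : (Matrix ι ι ℂ)ˣ}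
    (hu : u ∈ coadjointGroup e) (z ξ : ι → ℂ) :
    coadAt e ((u : Matrix ι ι ℂ) *ᵥ z) ξ =
      (u : Matrix ι ι ℂ) *ᵥ coadAt e z ((u : Matrix ι ι ℂ)ᵀ *ᵥ ξ) := by
  rw [← coadMatrix_mulVec, ← coadMatrix_mulVec, Matrix.mulVec_mulVec, Matrix.mulVec_mulVec,
    coadMatrix_equivariant e hu]

lemma liePairing_equivariant (e : Module.Basis ι ℝ 𝔤₀) {u : (Matrix ι ι ℂ)ˣ}
    (hu : u ∈ coadjointGroup e) (z ξ η : ι → ℂ) :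
    liePairing e ((u : Matrix ι ι ℂ) *ᵥ z) ξ η =
      liePairing e z ((u : Matrix ι ι ℂ)ᵀ *ᵥ ξ) ((u : Matrix ι ι ℂ)ᵀ *ᵥ η) := by
  rw [← coadAt_dotProduct, ← coadAt_dotProduct, coadAt_equivariant e hu, dotProduct_mulVec,
    Matrix.vecMul_transpose]

lemma poissonMatrix_equivariant (e : Module.Basis ι ℝ 𝔤₀) {u : (Matrix ι ι ℂ)ˣ}
    (hu : u ∈ coadjointGroup e) (z : ι → ℂ) :
    poissonMatrix e ((u : Matrix ι ι ℂ) *ᵥ z) =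
      (u : Matrix ι ι ℂ) * poissonMatrix e z * (u : Matrix ι ι ℂ)ᵀ := by
  refine Matrix.ext_of_mulVec_single fun i => ?_
  have h := coadAt_equivariant e hu z (Pi.single i 1)
  rw [coadAt_eq_neg_mulVec, coadAt_eq_neg_mulVec, Matrix.mulVec_neg, neg_inj] at h
  rw [h, Matrix.mulVec_mulVec, Matrix.mulVec_mulVec, mul_assoc]

lemma rank_poissonMatrix_orbit (e : Module.Basis ι ℝ 𝔤₀) {z₀ z : ι → ℂ}
    (hz : z ∈ coadjointOrbit e z₀) : (poissonMatrix e z).rank = (poissonMatrix e z₀).rank := by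
  obtain ⟨u, hu, rfl⟩ := hz
  rw [poissonMatrix_equivariant e hu]
  rw [Matrix.rank_mul_eq_left_of_isUnit_det, Matrix.rank_mul_eq_right_of_isUnit_det]
  · exact (Matrix.isUnit_iff_isUnit_det _).1 u.isUnit
  · rw [Matrix.det_transpose]
    exact (Matrix.isUnit_iff_isUnit_det _).1 u.isUnit

lemma realCoadjointGroup_le (e : Module.Basis ι ℝ 𝔤₀) :
    realCoadjointGroup e ≤ coadjointGroup e :=
  Subgroup.closure_mono fun _ ⟨_, h⟩ => ⟨_, h⟩

/-- `exp(ad*(ξ)) (u z) = u exp(ad*(uᵀ ξ)) z`. -/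
lemma coadExp_equivariant (e : Module.Basis ι ℝ 𝔤₀) {u : (Matrix ι ι ℂ)ˣ}
    (hu : u ∈ coadjointGroup e) (z ξ : ι → ℂ) :
    coadExp e ξ ((u : Matrix ι ι ℂ) *ᵥ z) =
      (u : Matrix ι ι ℂ) *ᵥ coadExp e ((u : Matrix ι ι ℂ)ᵀ *ᵥ ξ) z := by
  have h : (u : Matrix ι ι ℂ) * coadMatrix e ((u : Matrix ι ι ℂ)ᵀ *ᵥ ξ) *
      ((u⁻¹ : (Matrix ι ι ℂ)ˣ) : Matrix ι ι ℂ) = coadMatrix e ξ := by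
    rw [coadMatrix_equivariant e hu, mul_assoc, Units.mul_inv, mul_one]
  rw [coadExp, coadExp, ← h, Matrix.exp_units_conj, Matrix.mulVec_mulVec, Matrix.mulVec_mulVec,
    mul_assoc, Units.inv_mul, mul_one]

/-! ### Real orbits -/

/-- The tangent space at `z` of the orbit of the real form. -/
def realOrbitTangent (e : Module.Basis ι ℝ 𝔤₀) (z : ι → ℂ) : Submodule ℝ (ι → ℂ) :=
  (realVectors ι).map ((coadAt e z).restrictScalars ℝ)

lemma dimH_realOrbit_le (e : Module.Basis ι ℝ 𝔤₀) (z : ι → ℂ) :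
    dimH {w : ι → ℂ | ∃ u ∈ realCoadjointGroup e, (u : Matrix ι ι ℂ) *ᵥ z = w} ≤
      Module.finrank ℝ (realOrbitTangent e z) := by
  have h := dimH_orbit_le (coadImage e (realVectors ι)) (coadImage_commutator_mem e
    fun ξ hξ η hη => coadMatrix_transpose_mulVec_mem e hξ hη) z
  rw [map_mulVecAt_coadImage] at h
  have hg : realCoadjointGroup e = Subgroup.closure {u : (Matrix ι ι ℂ)ˣ |
      ∃ X ∈ coadImage e (realVectors ι), (u : Matrix ι ι ℂ) = exp X} := by
    rw [realCoadjointGroup]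
    congr 1
    ext u
    constructor
    · rintro ⟨ξ, h⟩
      exact ⟨_, ⟨_, ⟨ξ, rfl⟩, rfl⟩, h⟩
    · rintro ⟨_, ⟨_, ⟨ξ, rfl⟩, rfl⟩, h⟩
      exact ⟨ξ, h⟩
  rw [hg]
  exact h

/-! ### The identity theorem on an orbit -/

lemma analyticAt_exp_coadMatrix (e : Module.Basis ι ℝ 𝔤₀) {F : Type*} [NormedAddCommGroup F]
    [NormedSpace ℝ F] (l : F →L[ℝ] (ι → ℂ)) (x : F) :
    AnalyticAt ℝ (fun x => exp (coadMatrix e (l x))) x :=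
  AnalyticAt.comp (f := fun x => coadMatrixL e (l x)) (exp_analytic _)
    (((coadMatrixL e).comp l).analyticAt x)

lemma coadExp_coadExp (e : Module.Basis ι ℝ 𝔤₀) (z ξ η : ι → ℂ) :
    coadExp e ξ (coadExp e η z) = mulVecAt z (exp (coadMatrix e ξ) * exp (coadMatrix e η)) :=
  Matrix.mulVec_mulVec _ _ _

lemma analyticAt_coadExp_coadExp (e : Module.Basis ι ℝ 𝔤₀) (z : ι → ℂ)
    (q : (ι → ℂ) × (ι → ℂ)) :
    AnalyticAt ℝ (fun q : (ι → ℂ) × (ι → ℂ) => coadExp e q.1 (coadExp e q.2 z)) q := by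
  simp only [coadExp_coadExp]
  exact AnalyticAt.comp (g := (LinearMap.toContinuousLinearMap (mulVecAt z)))
    (ContinuousLinearMap.analyticAt _ _)
    ((analyticAt_exp_coadMatrix e (ContinuousLinearMap.fst ℝ (ι → ℂ) (ι → ℂ)) q).mul
      (analyticAt_exp_coadMatrix e (ContinuousLinearMap.snd ℝ (ι → ℂ) (ι → ℂ)) q))

/-- The function `(ξ, ζ) ↦ h (exp ξ exp ζ z)` is analytic on a vector space. For small arguments the
retraction returns the point to the plaque of `z`, where `h` vanishes; the identity theorem extends
this to all `ξ, ζ`. Keeping two exponentials lets vanishing pass from near `z` to near `exp ζ z`. -/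
lemma coadExp_eq_zero_of_eventually (e : Module.Basis ι ℝ 𝔤₀) {h : (ι → ℂ) → ℂ}
    (hh : ∀ w, AnalyticAt ℝ h w) {z : ι → ℂ} (hz : ∀ᶠ ξ in 𝓝 0, h (coadExp e ξ z) = 0)
    (ζ ξ : ι → ℂ) : h (coadExp e ξ (coadExp e ζ z)) = 0 := by
  obtain ⟨ρ, hρs, hρ0, hρ⟩ := exists_plaque_retraction e z
  have han : AnalyticOnNhd ℝ (fun q : (ι → ℂ) × (ι → ℂ) => h (coadExp e q.1 (coadExp e q.2 z)))
      univ := by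
    intro q _
    exact AnalyticAt.fun_comp (hh _) (analyticAt_coadExp_coadExp e z q)
  have ht : Tendsto (fun q : (ι → ℂ) × (ι → ℂ) => ρ (coadExp e q.1 (coadExp e q.2 z)))
      (𝓝 0) (𝓝 0) := by
    have h2 := (analyticAt_coadExp_coadExp e z 0).continuousAt.tendsto
    simp only [Prod.fst_zero, Prod.snd_zero, coadExp_zero] at h2
    have h3 := hρs.continuousAt.tendsto.comp h2
    rwa [hρ0] at h3
  have hev : (fun q : (ι → ℂ) × (ι → ℂ) => h (coadExp e q.1 (coadExp e q.2 z))) =ᶠ[𝓝 0]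
      fun _ => 0 := by
    filter_upwards [hρ, ht.eventually hz] with q h1 h2
    rw [← h1, h2]
  have h0 := han.eq_of_eventuallyEq analyticOnNhd_const hev
  have h1 := congrFun h0 (ξ, ζ)
  dsimp only at h1
  exact h1

/-- A real analytic function that does not vanish identically on an orbit does not vanish
identically near any point of the orbit. -/
lemma frequently_coadExp_ne_zero (e : Module.Basis ι ℝ 𝔤₀) {h : (ι → ℂ) → ℂ}
    (hh : ∀ w, AnalyticAt ℝ h w) {z₀ z₁ z₂ : ι → ℂ} (hz₁ : z₁ ∈ coadjointOrbit e z₀)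
    (hz₂ : z₂ ∈ coadjointOrbit e z₀) (hne : h z₁ ≠ 0) :
    ∃ᶠ ξ in 𝓝 0, h (coadExp e ξ z₂) ≠ 0 := by
  intro hcon
  simp only [not_not] at hcon
  obtain ⟨u₁, hu₁, rfl⟩ := hz₁
  obtain ⟨u₂, hu₂, rfl⟩ := hz₂
  -- Vanishing near one point is carried along a word of generators, one exponential or inverse
  -- exponential at a time, and so reaches the whole orbit.
  have key : ∀ u ∈ coadjointGroup e,
      ∀ᶠ ξ in 𝓝 0, h (coadExp e ξ ((u : Matrix ι ι ℂ) *ᵥ ((u₂ : Matrix ι ι ℂ) *ᵥ z₀))) = 0 := by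
    intro u hu
    induction hu using Subgroup.closure_induction_left with
    | one => simpa using hcon
    | mul_left x hx y hy ih =>
      obtain ⟨ζ, hζ⟩ := hx
      refine Eventually.of_forall fun ξ => ?_
      have := coadExp_eq_zero_of_eventually e hh ih ζ ξ
      rwa [coadExp.eq_1 e ζ, Matrix.mulVec_mulVec, ← hζ, ← Units.val_mul] at this
    | inv_mul_cancel x hx y hy ih =>
      obtain ⟨ζ, hζ⟩ := hx
      refine Eventually.of_forall fun ξ => ?_
      have := coadExp_eq_zero_of_eventually e hh ih (-ζ) ξ
      have h1 : ((x⁻¹ : (Matrix ι ι ℂ)ˣ) : Matrix ι ι ℂ) = exp (coadMatrix e (-ζ)) := by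
        rw [Units.inv_eq_of_mul_eq_one_right]
        have h2 : coadMatrix e (-ζ) = -coadMatrix e ζ := map_neg (coadMatrixₗ e) ζ
        rw [hζ, h2, matrix_exp_mul_exp_neg]
      rwa [coadExp.eq_1 e (-ζ), Matrix.mulVec_mulVec, ← h1, ← Units.val_mul] at this
  have h1 := (key (u₁ * u₂⁻¹) (mul_mem hu₁ (inv_mem hu₂))).self_of_nhds
  rw [coadExp_zero, Matrix.mulVec_mulVec, ← Units.val_mul, inv_mul_cancel_right] at h1
  exact hne h1

end CoadjointAction

/-! ### The linear Poisson structure on functions on `𝔤*` -/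

section Ambient

set_option linter.unusedSectionVars false

open Set Filter

variable {𝔤₀ : Type*} [LieRing 𝔤₀] [LieAlgebra ℝ 𝔤₀] {ι : Type*} [Fintype ι] [DecidableEq ι]

lemma liePairing_add_left (e : Module.Basis ι ℝ 𝔤₀) (z ξ ξ' η : ι → ℂ) :
    liePairing e z (ξ + ξ') η = liePairing e z ξ η + liePairing e z ξ' η :=
  add_dotProduct _ _ _

lemma liePairing_smul_left (e : Module.Basis ι ℝ 𝔤₀) (a : ℂ) (z ξ η : ι → ℂ) :
    liePairing e z (a • ξ) η = a * liePairing e z ξ η :=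
  smul_dotProduct _ _ _

lemma liePairing_add_right (e : Module.Basis ι ℝ 𝔤₀) (z ξ η η' : ι → ℂ) :
    liePairing e z ξ (η + η') = liePairing e z ξ η + liePairing e z ξ η' := by
  rw [liePairing, Matrix.mulVec_add, dotProduct_add, liePairing, liePairing]

lemma liePairing_smul_right (e : Module.Basis ι ℝ 𝔤₀) (a : ℂ) (z ξ η : ι → ℂ) :
    liePairing e z ξ (a • η) = a * liePairing e z ξ η := by
  rw [liePairing, Matrix.mulVec_smul, dotProduct_smul, liePairing, smul_eq_mul]

lemma liePairing_smul_point (e : Module.Basis ι ℝ 𝔤₀) (a : ℂ) (z ξ η : ι → ℂ) :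
    liePairing e (a • z) ξ η = a * liePairing e z ξ η := by
  rw [liePairing, poissonMatrix_smul, Matrix.smul_mulVec, dotProduct_smul, liePairing, smul_eq_mul]

lemma liePairing_eq_sum (e : Module.Basis ι ℝ 𝔤₀) (z ξ η : ι → ℂ) :
    liePairing e z ξ η =
      ∑ i, ∑ j, ∑ k, ξ i * ((structConst e i j k : ℂ) * z k) * η j := by
  simp only [liePairing, dotProduct, Matrix.mulVec, poissonMatrix, Matrix.of_apply,
    Finset.mul_sum, Finset.sum_mul, mul_assoc]

/-- The Jacobi identity of `𝔤` evaluated at `z`, read off from the commutator of `ad*(b)` and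
`ad*(a)`. -/
lemma liePairing_jacobi (e : Module.Basis ι ℝ 𝔤₀) (z a b c : ι → ℂ) :
    liePairing e (coadAt e z a) b c + liePairing e (coadAt e z b) c a +
      liePairing e (coadAt e z c) a b = 0 := by
  have h : ∀ a b c, liePairing e (coadAt e z a) b c =
      (coadMatrix e b *ᵥ coadMatrix e a *ᵥ z) ⬝ᵥ c := fun a b c => by
    rw [← coadAt_dotProduct, ← coadMatrix_mulVec, ← coadMatrix_mulVec]
  have h1 : liePairing e (coadAt e z a) b c - liePairing e (coadAt e z b) a c =
      liePairing e (coadAt e z c) b a := by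
    rw [h, h, h, ← sub_dotProduct, Matrix.mulVec_mulVec, Matrix.mulVec_mulVec, ← Matrix.sub_mulVec,
      coadMatrix_commutator, Matrix.neg_mulVec, coadMatrix_mulVec, neg_dotProduct,
      coadAt_dotProduct, ← liePairing_skew, ← coadAt_dotProduct, coadMatrix_mulVec e c,
      Matrix.dotProduct_mulVec, Matrix.vecMul_transpose, coadMatrix_mulVec]
  rw [liePairing_skew e _ c a, liePairing_skew e (coadAt e z c) a b]
  linear_combination h1

/-- `holComponent` as a linear map. -/
def holComponentₗ : ((ι → ℂ) →ₗ[ℝ] ℝ) →ₗ[ℝ] (ι → ℂ) where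
  toFun := holComponent
  map_add' φ ψ := by
    ext i
    simp only [holComponent, LinearMap.add_apply, Complex.ofReal_add, Pi.add_apply]
    ring
  map_smul' a φ := by
    ext i
    simp only [holComponent, LinearMap.smul_apply, smul_eq_mul, Complex.ofReal_mul, Pi.smul_apply,
      RingHom.id_apply, Complex.real_smul]
    ring

/-- The holomorphic gradient of a real function. -/
def holGradient : ((ι → ℂ) →L[ℝ] ℝ) →L[ℝ] (ι → ℂ) :=
  LinearMap.toContinuousLinearMap (holComponentₗ ∘ₗ ContinuousLinearMap.coeLM ℝ)

lemma holGradient_apply (φ : (ι → ℂ) →L[ℝ] ℝ) : holGradient φ = holComponent φ.toLinearMap := rfl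

/-- A real covector is the sum of its `(1,0)`-part and the conjugate, which is twice a real part;
this is the origin of the factors `2` and `a / 2` below. -/
lemma two_re_holComponent_dotProduct (φ : (ι → ℂ) →ₗ[ℝ] ℝ) (v : ι → ℂ) :
    2 * (holComponent φ ⬝ᵥ v).re = φ v := by
  have hv : v = ∑ i, ((v i).re • (Pi.single i 1 : ι → ℂ) +
      (v i).im • (Pi.single i Complex.I : ι → ℂ)) := by
    ext j
    simp [Finset.sum_apply, Pi.single_apply, Finset.sum_add_distrib, Complex.re_add_im]
  conv_rhs => rw [hv, map_sum]
  rw [dotProduct, Complex.re_sum, Finset.mul_sum]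
  refine Finset.sum_congr rfl fun i _ => ?_
  rw [map_add, map_smul, map_smul]
  simp [holComponent]
  ring

/-- The bracket of `Re (a c)` on functions on `𝔤*`. -/
def ambientBracket (e : Module.Basis ι ℝ 𝔤₀) (a : ℂ) (f g : (ι → ℂ) → ℝ) (w : ι → ℂ) : ℝ :=
  (a * liePairing e w (holGradient (fderiv ℝ f w)) (holGradient (fderiv ℝ g w))).re

/-- The Hamiltonian vector field of `f` with respect to `Re (a c)`. -/
def ambientField (e : Module.Basis ι ℝ 𝔤₀) (a : ℂ) (f : (ι → ℂ) → ℝ) (w : ι → ℂ) : ι → ℂ :=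
  (a / 2) • coadAt e w (holGradient (fderiv ℝ f w))

lemma re_liePairing_holGradient (e : Module.Basis ι ℝ 𝔤₀) (a : ℂ) (f : (ι → ℂ) → ℝ) (w : ι → ℂ)
    (φ : (ι → ℂ) →L[ℝ] ℝ) :
    (a * liePairing e w (holGradient (fderiv ℝ f w)) (holGradient φ)).re =
      φ (ambientField e a f w) := by
  have h := two_re_holComponent_dotProduct φ.toLinearMap (ambientField e a f w)
  rw [ContinuousLinearMap.coe_coe] at h
  rw [← h, ambientField, dotProduct_smul, dotProduct_comm, coadAt_dotProduct, ← holGradient_apply,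
    smul_eq_mul]
  set x := liePairing e w (holGradient (fderiv ℝ f w)) (holGradient φ)
  have : a * x = 2 * (a / 2 * x) := by ring
  rw [this]
  simp

lemma hasDerivAt_liePairing (e : Module.Basis ι ℝ 𝔤₀) {z ξ η : ℝ → ι → ℂ} {z' ξ' η' : ι → ℂ}
    {t : ℝ} (hz : HasDerivAt z z' t) (hξ : HasDerivAt ξ ξ' t) (hη : HasDerivAt η η' t) :
    HasDerivAt (fun t => liePairing e (z t) (ξ t) (η t))
      (liePairing e z' (ξ t) (η t) + liePairing e (z t) ξ' (η t) + liePairing e (z t) (ξ t) η')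
      t := by
  simp only [liePairing_eq_sum]
  rw [hasDerivAt_pi] at hz hξ hη
  have h := HasDerivAt.fun_sum (u := Finset.univ) fun i _ =>
    HasDerivAt.fun_sum (u := Finset.univ) fun j _ =>
    HasDerivAt.fun_sum (u := Finset.univ) fun k _ =>
      ((hξ i).mul ((hz k).const_mul (structConst e i j k : ℂ))).mul (hη j)
  refine h.congr_deriv ?_
  simp only [← Finset.sum_add_distrib]
  refine Finset.sum_congr rfl fun i _ => Finset.sum_congr rfl fun j _ =>
    Finset.sum_congr rfl fun k _ => ?_
  simp only [Pi.mul_apply]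
  ring

lemma contDiff_liePairing (e : Module.Basis ι ℝ 𝔤₀) {n : WithTop ℕ∞} :
    ContDiff ℝ n fun q : (ι → ℂ) × (ι → ℂ) × (ι → ℂ) => liePairing e q.1 q.2.1 q.2.2 := by
  simp only [liePairing_eq_sum]
  refine ContDiff.sum fun i _ => ContDiff.sum fun j _ => ContDiff.sum fun k _ => ?_
  fun_prop

lemma contDiffAt_ambientBracket (e : Module.Basis ι ℝ 𝔤₀) (a : ℂ) {f g : (ι → ℂ) → ℝ} {z : ι → ℂ}
    (hf : ContDiffAt ℝ ∞ f z) (hg : ContDiffAt ℝ ∞ g z) :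
    ContDiffAt ℝ ∞ (ambientBracket e a f g) z := by
  have h1 : ContDiffAt ℝ ∞ (fun w => holGradient (fderiv ℝ f w)) z :=
    (ContinuousLinearMap.contDiff (holGradient (ι := ι))).contDiffAt.comp z (hf.fderiv_right (m := ∞) le_rfl)
  have h2 : ContDiffAt ℝ ∞ (fun w => holGradient (fderiv ℝ g w)) z :=
    (ContinuousLinearMap.contDiff (holGradient (ι := ι))).contDiffAt.comp z (hg.fderiv_right (m := ∞) le_rfl)
  have h3 := (contDiff_liePairing e (n := ∞)).contDiffAt.comp z
    (contDiffAt_id.prodMk (h1.prodMk h2))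
  exact Complex.reCLM.contDiff.contDiffAt.comp z (contDiffAt_const.mul h3)

lemma ambientBracket_eq_fderiv (e : Module.Basis ι ℝ 𝔤₀) (a : ℂ) (f g : (ι → ℂ) → ℝ)
    (w : ι → ℂ) : ambientBracket e a f g w = fderiv ℝ g w (ambientField e a f w) :=
  re_liePairing_holGradient e a f w _

lemma fderiv_ambientBracket (e : Module.Basis ι ℝ 𝔤₀) (a : ℂ) {f g : (ι → ℂ) → ℝ} {z : ι → ℂ}
    (hf : ContDiffAt ℝ ∞ f z) (hg : ContDiffAt ℝ ∞ g z) (v : ι → ℂ) :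
    fderiv ℝ (ambientBracket e a f g) z v =
      (a * liePairing e v (holGradient (fderiv ℝ f z)) (holGradient (fderiv ℝ g z))).re -
      fderiv ℝ (fderiv ℝ f) z v (ambientField e a g z) +
      fderiv ℝ (fderiv ℝ g) z v (ambientField e a f z) := by
  have hl : HasDerivAt (fun t : ℝ => z + t • v) v 0 := by
    simpa using ((hasDerivAt_id (0 : ℝ)).smul_const v).const_add z
  have h0 : z + (0 : ℝ) • v = z := by simp
  have hD : ∀ {f : (ι → ℂ) → ℝ}, ContDiffAt ℝ ∞ f z →
      HasDerivAt (fun t : ℝ => holGradient (fderiv ℝ f (z + t • v)))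
        (holGradient (fderiv ℝ (fderiv ℝ f) z v)) 0 := by
    intro f hf
    have h1 : HasFDerivAt (fderiv ℝ f) (fderiv ℝ (fderiv ℝ f) z) (z + (0 : ℝ) • v) := by
      rw [h0]
      exact ((hf.fderiv_right (m := ∞) le_rfl).differentiableAt (by simp)).hasFDerivAt
    exact holGradient.hasFDerivAt.comp_hasDerivAt (0 : ℝ) (h1.comp_hasDerivAt (0 : ℝ) hl)
  have h1 := hasDerivAt_liePairing e hl (hD hf) (hD hg)
  have h2 := Complex.reCLM.hasFDerivAt.comp_hasDerivAt (0 : ℝ) (h1.const_mul a)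
  have h3 : HasDerivAt (fun t : ℝ => ambientBracket e a f g (z + t • v))
      (fderiv ℝ (ambientBracket e a f g) z v) 0 := by
    have h4 : HasFDerivAt (ambientBracket e a f g) (fderiv ℝ (ambientBracket e a f g) z)
        (z + (0 : ℝ) • v) := by
      rw [h0]
      exact ((contDiffAt_ambientBracket e a hf hg).differentiableAt (by simp)).hasFDerivAt
    exact h4.comp_hasDerivAt (0 : ℝ) hl
  have h5 := h3.unique h2
  rw [h5]
  simp only [h0, mul_add, map_add, Complex.reCLM_apply]
  rw [re_liePairing_holGradient, liePairing_skew e z (holGradient (fderiv ℝ (fderiv ℝ f) z v)),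
    mul_neg, Complex.neg_re, re_liePairing_holGradient]
  ring

/-- The terms with second derivatives cancel in pairs by symmetry of the Hessians. The remaining
terms are `Re` of `a²/2` times a cyclic sum that vanishes by `liePairing_jacobi`. Since `c` is
complex bilinear, this works for every complex `a`, so the whole real pencil is Poisson. -/
lemma ambientBracket_jacobi (e : Module.Basis ι ℝ 𝔤₀) (a : ℂ) {f g h : (ι → ℂ) → ℝ} {z : ι → ℂ}
    (hf : ContDiffAt ℝ ∞ f z) (hg : ContDiffAt ℝ ∞ g z) (hh : ContDiffAt ℝ ∞ h z) :
    ambientBracket e a f (ambientBracket e a g h) z +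
      ambientBracket e a g (ambientBracket e a h f) z +
      ambientBracket e a h (ambientBracket e a f g) z = 0 := by
  have hsymm : ∀ {f : (ι → ℂ) → ℝ}, ContDiffAt ℝ ∞ f z → ∀ v w,
      fderiv ℝ (fderiv ℝ f) z v w = fderiv ℝ (fderiv ℝ f) z w v := fun hf v w =>
    (hf.isSymmSndFDerivAt (by simpa using WithTop.coe_le_coe.2 (le_top : (2 : ℕ∞) ≤ ⊤))).eq v w
  have hX : ∀ (f g h : (ι → ℂ) → ℝ), (a * liePairing e (ambientField e a f z)
      (holGradient (fderiv ℝ g z)) (holGradient (fderiv ℝ h z))).re =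
      (a * (a / 2) * liePairing e (coadAt e z (holGradient (fderiv ℝ f z)))
      (holGradient (fderiv ℝ g z)) (holGradient (fderiv ℝ h z))).re := fun f g h => by
    rw [ambientField, liePairing_smul_point, mul_assoc]
  have hj : (a * (a / 2) * liePairing e (coadAt e z (holGradient (fderiv ℝ f z)))
      (holGradient (fderiv ℝ g z)) (holGradient (fderiv ℝ h z))).re +
      (a * (a / 2) * liePairing e (coadAt e z (holGradient (fderiv ℝ g z)))
      (holGradient (fderiv ℝ h z)) (holGradient (fderiv ℝ f z))).re +
      (a * (a / 2) * liePairing e (coadAt e z (holGradient (fderiv ℝ h z)))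
      (holGradient (fderiv ℝ f z)) (holGradient (fderiv ℝ g z))).re = 0 := by
    rw [← Complex.add_re, ← Complex.add_re, ← mul_add, ← mul_add, liePairing_jacobi, mul_zero,
      Complex.zero_re]
  rw [ambientBracket_eq_fderiv, ambientBracket_eq_fderiv e a g, ambientBracket_eq_fderiv e a h,
    fderiv_ambientBracket e a hg hh, fderiv_ambientBracket e a hh hf,
    fderiv_ambientBracket e a hf hg, hX, hX, hX,
    hsymm hf (ambientField e a g z), hsymm hg (ambientField e a f z),
    hsymm hh (ambientField e a f z)]
  linear_combination hj

end Ambient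

/-! ### The quotient map in exponential coordinates -/

section Quotient

set_option linter.unusedSectionVars false

open Set Filter

variable {𝔤₀ : Type*} [LieRing 𝔤₀] [LieAlgebra ℝ 𝔤₀] {ι : Type*} [Fintype ι] [DecidableEq ι]
  {E : Type*} [NormedAddCommGroup E] [NormedSpace ℝ E] [FiniteDimensional ℝ E]
  {N : Type*} [TopologicalSpace N] [ChartedSpace E N] [IsManifold 𝓘(ℝ, E) ∞ N]
  {e : Module.Basis ι ℝ 𝔤₀} {U : Set (ι → ℂ)} {p : U → N}

lemma expAt_coe (z : U) {ξ : ι → ℂ} (h : coadExp e ξ z ∈ U) :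
    (expAt e z ξ : ι → ℂ) = coadExp e ξ z := by
  rw [expAt, dif_pos h]

lemma expAt_eq (z : U) {ξ : ι → ℂ} {w : U} (h : coadExp e ξ z = w) : expAt e z ξ = w :=
  Subtype.ext ((expAt_coe z (h ▸ w.2)).trans h)

@[simp] lemma expAt_zero (z : U) : expAt e z 0 = z := expAt_eq z (coadExp_zero e z)

lemma eventually_coadExp_mem (hU : IsOpen[orbitTopology e] U) (z : U) :
    ∀ᶠ ξ in 𝓝 0, coadExp e ξ z ∈ U := hU z z.2

/-- The quotient map near `z`, in exponential coordinates on the orbit and a chart of the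
quotient. -/
def expCoord (e : Module.Basis ι ℝ 𝔤₀) (p : U → N) (z : U) (ξ : ι → ℂ) : E :=
  extChartAt 𝓘(ℝ, E) (p z) (p (expAt e z ξ))

/-- `orbitDifferential` as a continuous linear map into the model space. -/
def orbitDifferentialL (e : Module.Basis ι ℝ 𝔤₀) (p : U → N) (z : U) : (ι → ℂ) →L[ℝ] E :=
  mfderiv 𝓘(ℝ, ι → ℂ) 𝓘(ℝ, E) (fun ξ => p (expAt e z ξ)) 0

lemma contDiffAt_expCoord (hp : IsQuotientByRealForm E e p) (z : U) :
    ContDiffAt ℝ ∞ (expCoord (E := E) e p z) 0 := by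
  rw [← contMDiffAt_iff_contDiffAt]
  have h : ContMDiffAt 𝓘(ℝ, E) 𝓘(ℝ, E) ∞ (extChartAt 𝓘(ℝ, E) (p z)) (p (expAt e z 0)) := by
    rw [expAt_zero]
    exact contMDiffAt_extChartAt
  exact h.comp 0 (hp.smooth z)

lemma hasFDerivAt_expCoord (hp : IsQuotientByRealForm E e p) (z : U) :
    HasFDerivAt (expCoord (E := E) e p z) (orbitDifferentialL e p z) 0 := by
  have h := ((hp.smooth z).mdifferentiableAt (by simp)).hasMFDerivAt.2
  simp only [writtenInExtChartAt, mfld_simps] at h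
  rw [expAt_zero] at h
  exact hasFDerivWithinAt_univ.1 h

lemma surjective_orbitDifferentialL (hp : IsQuotientByRealForm E e p) (z : U) :
    Function.Surjective (orbitDifferentialL (E := E) e p z) := hp.submersion z

lemma hasStrictFDerivAt_expCoord (hp : IsQuotientByRealForm E e p) (z : U) :
    HasStrictFDerivAt (expCoord (E := E) e p z) (orbitDifferentialL e p z) 0 :=
  (contDiffAt_expCoord hp z).hasStrictFDerivAt' (hasFDerivAt_expCoord hp z) (by simp)

lemma continuousAt_comp_expAt (hp : IsQuotientByRealForm E e p) (z : U) :
    Tendsto (fun ξ => p (expAt e z ξ)) (𝓝 0) (𝓝 (p z)) := by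
  have h := (hp.smooth z).continuousAt.tendsto
  rwa [expAt_zero] at h

/-- The differential of a function on the quotient, as a covector of the model space. -/
def manifoldDifferential (k : N → ℝ) (x : N) : E →L[ℝ] ℝ := mfderiv 𝓘(ℝ, E) 𝓘(ℝ, ℝ) k x

lemma manifoldDifferential_congr {k : N → ℝ} {x y : N} (h : x = y) (v : E) :
    manifoldDifferential (E := E) k x v = manifoldDifferential (E := E) k y v := by
  subst h
  rfl

lemma hasFDerivAt_comp_expAt (hp : IsQuotientByRealForm E e p) (z : U) {k : N → ℝ}
    (hk : MDifferentiableAt 𝓘(ℝ, E) 𝓘(ℝ, ℝ) k (p z)) :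
    HasFDerivAt (fun ξ => k (p (expAt e z ξ)))
      ((manifoldDifferential (E := E) k (p z)).comp (orbitDifferentialL e p z)) 0 := by
  have h1 := ((hp.smooth z).mdifferentiableAt (by simp)).hasMFDerivAt
  have h2 : MDifferentiableAt 𝓘(ℝ, E) 𝓘(ℝ, ℝ) k (p (expAt e z 0)) := by rwa [expAt_zero]
  have h3 := (h2.hasMFDerivAt.comp 0 h1).hasFDerivAt
  refine HasFDerivAt.congr_fderiv h3 ?_
  refine ContinuousLinearMap.ext fun ξ => ?_
  exact manifoldDifferential_congr (E := E) (congrArg p (expAt_zero z)) (orbitDifferentialL e p z ξ)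

lemma orbitDifferentialL_eq_zero (hp : IsQuotientByRealForm E e p) (z : U) {ξ : ι → ℂ}
    (h : ∀ᶠ t : ℝ in 𝓝 0, p (expAt e z (t • ξ)) = p z) :
    orbitDifferentialL (E := E) e p z ξ = 0 := by
  have hl : HasDerivAt (fun t : ℝ => t • ξ) ξ 0 := by
    simpa using (hasDerivAt_id (0 : ℝ)).smul_const ξ
  have h1 : HasFDerivAt (expCoord (E := E) e p z) (orbitDifferentialL e p z)
      ((0 : ℝ) • ξ) := by
    rw [zero_smul]
    exact hasFDerivAt_expCoord hp z
  have h2 := h1.comp_hasDerivAt (0 : ℝ) hl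
  have h3 : HasDerivAt (expCoord (E := E) e p z ∘ fun t : ℝ => t • ξ) 0 0 := by
    refine (hasDerivAt_const (0 : ℝ) (extChartAt 𝓘(ℝ, E) (p z) (p z))).congr_of_eventuallyEq ?_
    filter_upwards [h] with t ht
    simp only [Function.comp_apply, expCoord, ht]
  exact h2.unique h3

/-- Exponentials of stabilizer directions fix `z`, so the differential written on `𝔤` descends to
the tangent space of the orbit. -/
lemma orbitDifferentialL_of_coadAt_eq_zero (hp : IsQuotientByRealForm E e p) (z : U) {ξ : ι → ℂ}
    (h : coadAt e z ξ = 0) : orbitDifferentialL (E := E) e p z ξ = 0 := by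
  refine orbitDifferentialL_eq_zero hp z (Eventually.of_forall fun t => ?_)
  rw [expAt_eq z (w := z)]
  refine exp_mulVec_of_mulVec_eq_zero ?_
  rw [coadMatrix_mulVec, ← Complex.coe_smul, map_smul, h, smul_zero]

lemma exp_mem_realCoadjointGroup {ξ : ι → ℂ} (h : ξ ∈ realVectors ι) :
    ∃ u ∈ realCoadjointGroup e, (u : Matrix ι ι ℂ) = NormedSpace.exp (coadMatrix e ξ) := by
  obtain ⟨x, rfl⟩ := h
  exact ⟨(Matrix.isUnit_exp _).unit, Subgroup.subset_closure ⟨x, rfl⟩, rfl⟩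

/-- Along `exp (t ξ) z` with `ξ` real the point stays in one `G₀`-orbit, hence in one fibre of `p`.
-/
lemma orbitDifferentialL_of_real (hU : IsOpen[orbitTopology e] U)
    (hp : IsQuotientByRealForm E e p) (z : U) {ξ : ι → ℂ} (h : ξ ∈ realVectors ι) :
    orbitDifferentialL (E := E) e p z ξ = 0 := by
  refine orbitDifferentialL_eq_zero hp z ?_
  have ht : Tendsto (fun t : ℝ => t • ξ) (𝓝 0) (𝓝 0) :=
    (continuous_id.smul continuous_const).tendsto' _ _ (zero_smul ℝ ξ)
  filter_upwards [ht.eventually (eventually_coadExp_mem hU z)] with t hmem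
  obtain ⟨u, hu, h1⟩ := exp_mem_realCoadjointGroup (e := e)
    ((realVectors ι).smul_mem t h)
  refine ((hp.fiber z (expAt e z (t • ξ))).2 ⟨u, hu, ?_⟩).symm
  rw [expAt_coe z hmem, h1]
  rfl

lemma orbitDifferentialL_equivariant (hU : IsOpen[orbitTopology e] U)
    (hp : IsQuotientByRealForm E e p) (z w : U) {u : (Matrix ι ι ℂ)ˣ}
    (hu : u ∈ realCoadjointGroup e) (huw : (u : Matrix ι ι ℂ) *ᵥ (z : ι → ℂ) = w) (ξ : ι → ℂ) :
    orbitDifferentialL (E := E) e p w ξ =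
      orbitDifferentialL (E := E) e p z ((u : Matrix ι ι ℂ)ᵀ *ᵥ ξ) := by
  let T : (ι → ℂ) →L[ℝ] (ι → ℂ) :=
    LinearMap.toContinuousLinearMap (((u : Matrix ι ι ℂ)ᵀ.mulVecLin).restrictScalars ℝ)
  have hpz : p w = p z := ((hp.fiber z w).2 ⟨u, hu, huw⟩).symm
  have hT : Tendsto T (𝓝 0) (𝓝 0) := T.continuous.tendsto' _ _ (map_zero T)
  have h1 : expCoord (E := E) e p w =ᶠ[𝓝 0] expCoord e p z ∘ T := by
    filter_upwards [eventually_coadExp_mem hU w, hT.eventually (eventually_coadExp_mem hU z)]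
      with ξ h1 h2
    have h3 : p (expAt e w ξ) = p (expAt e z (T ξ)) := by
      refine ((hp.fiber _ _).2 ⟨u, hu, ?_⟩).symm
      rw [expAt_coe _ h1, expAt_coe _ h2, ← huw, coadExp_equivariant e (realCoadjointGroup_le e hu)]
      rfl
    simp only [expCoord, Function.comp_apply, h3, hpz]
  have h2 : HasFDerivAt (expCoord (E := E) e p z) (orbitDifferentialL e p z) (T 0) := by
    rw [map_zero]
    exact hasFDerivAt_expCoord hp z
  have h3 := (h2.comp 0 T.hasFDerivAt).congr_of_eventuallyEq h1
  exact DFunLike.congr_fun ((hasFDerivAt_expCoord hp w).unique h3) ξ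

/-- Smooth local sections of the quotient map. -/
lemma exists_local_section (hp : IsQuotientByRealForm E e p) (z : U) :
    ∃ s : N → (ι → ℂ), ContMDiffAt 𝓘(ℝ, E) 𝓘(ℝ, ι → ℂ) ∞ s (p z) ∧ s (p z) = 0 ∧
      ∀ᶠ x in 𝓝 (p z), p (expAt e z (s x)) = x := by
  obtain ⟨R, hR⟩ := (orbitDifferentialL (E := E) e p z).toLinearMap.exists_rightInverse_of_surjective
    (LinearMap.range_eq_top.2 (surjective_orbitDifferentialL hp z))
  let RL : E →L[ℝ] (ι → ℂ) := LinearMap.toContinuousLinearMap R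
  let g : E → E := expCoord (E := E) e p z ∘ RL
  have h0 : RL 0 = 0 := map_zero RL
  have hgs : ContDiffAt ℝ ∞ g 0 := by
    have : ContDiffAt ℝ ∞ (expCoord (E := E) e p z) (RL 0) := by
      rw [h0]
      exact contDiffAt_expCoord hp z
    exact this.comp 0 RL.contDiff.contDiffAt
  have hgd : HasFDerivAt g ((ContinuousLinearEquiv.refl ℝ E : E ≃L[ℝ] E) : E →L[ℝ] E) 0 := by
    have h1 : HasFDerivAt (expCoord (E := E) e p z) (orbitDifferentialL e p z) (RL 0) := by
      rw [h0]
      exact hasFDerivAt_expCoord hp z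
    refine (h1.comp 0 RL.hasFDerivAt).congr_fderiv (ContinuousLinearMap.ext fun v => ?_)
    exact DFunLike.congr_fun hR v
  have hn : (∞ : WithTop ℕ∞) ≠ 0 := by simp
  have hg0 : g 0 = extChartAt 𝓘(ℝ, E) (p z) (p z) := by
    simp only [g, Function.comp_apply, h0, expCoord, expAt_zero]
  set θ := hgs.localInverse hgd hn with hθ
  have hθs : ContDiffAt ℝ ∞ θ (extChartAt 𝓘(ℝ, E) (p z) (p z)) := by
    have := hgs.to_localInverse hgd hn
    rwa [hg0] at this
  have hθ0 : θ (extChartAt 𝓘(ℝ, E) (p z) (p z)) = 0 := by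
    have := hgs.localInverse_apply_image hgd hn
    rwa [hg0] at this
  have hθg : ∀ᶠ y in 𝓝 (extChartAt 𝓘(ℝ, E) (p z) (p z)), g (θ y) = y := by
    have := (hgs.hasStrictFDerivAt' hgd hn).eventually_right_inverse
    rw [hg0] at this
    exact this
  let s : N → (ι → ℂ) := fun x => RL (θ (extChartAt 𝓘(ℝ, E) (p z) x))
  have hs : ContMDiffAt 𝓘(ℝ, E) 𝓘(ℝ, ι → ℂ) ∞ s (p z) :=
    ((RL.contDiff.contDiffAt.comp _ hθs).contMDiffAt).comp (p z) contMDiffAt_extChartAt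
  have hs0 : s (p z) = 0 := by simp only [s, hθ0, h0]
  refine ⟨s, hs, hs0, ?_⟩
  have hst : Tendsto s (𝓝 (p z)) (𝓝 0) := by
    have := hs.continuousAt.tendsto
    rwa [hs0] at this
  have h1 := ((continuousAt_comp_expAt hp z).comp hst).eventually
    (extChartAt_source_mem_nhds (I := 𝓘(ℝ, E)) (p z))
  have h2 := (continuousAt_extChartAt (I := 𝓘(ℝ, E)) (p z)).eventually hθg
  filter_upwards [h1, h2, extChartAt_source_mem_nhds (I := 𝓘(ℝ, E)) (p z)] with x h1 h2 h3
  exact (extChartAt 𝓘(ℝ, E) (p z)).injOn h1 h3 h2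

/-! ### Push-forward of the Poisson structure -/

/-- `a` is a `(1,0)`-covector of `𝔤*` at `z` whose associated real covector restricts to the
pull-back of `α` on the tangent space of the orbit. -/
def Represents (e : Module.Basis ι ℝ 𝔤₀) (p : U → N) (z : U) (α : E →ₗ[ℝ] ℝ) (a : ι → ℂ) : Prop :=
  ∀ ξ, 2 * (a ⬝ᵥ coadAt e z ξ).re = α (orbitDifferentialL e p z ξ)

/-- Replacing `ξ` by `I ξ` recovers the imaginary part, so the real covector on the orbit determines
the `(1,0)`-covector there; the pairing depends on nothing more. -/
lemma liePairing_congr_of_re {z a a' : ι → ℂ}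
    (h : ∀ ξ, (a ⬝ᵥ coadAt e z ξ).re = (a' ⬝ᵥ coadAt e z ξ).re) (b : ι → ℂ) :
    liePairing e z a b = liePairing e z a' b := by
  have h1 : ∀ ξ, a ⬝ᵥ coadAt e z ξ = a' ⬝ᵥ coadAt e z ξ := fun ξ => by
    refine Complex.ext (h ξ) ?_
    have := h (Complex.I • ξ)
    rw [map_smul, dotProduct_smul, dotProduct_smul] at this
    simpa using this
  have h2 : ∀ a : ι → ℂ, liePairing e z a b = -(a ⬝ᵥ coadAt e z b) := fun a => by
    rw [liePairing_skew, ← coadAt_dotProduct, dotProduct_comm]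
  rw [h2, h2, h1]

lemma Represents.liePairing_congr {z : U} {α β : E →ₗ[ℝ] ℝ} {a a' b b' : ι → ℂ}
    (ha : Represents e p z α a) (ha' : Represents e p z α a')
    (hb : Represents e p z β b) (hb' : Represents e p z β b') :
    liePairing e z a b = liePairing e z a' b' := by
  have h1 : ∀ ξ, (a ⬝ᵥ coadAt e z ξ).re = (a' ⬝ᵥ coadAt e z ξ).re := fun ξ => by
    have := (ha ξ).trans (ha' ξ).symm
    linarith
  have h2 : ∀ ξ, (b ⬝ᵥ coadAt e z ξ).re = (b' ⬝ᵥ coadAt e z ξ).re := fun ξ => by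
    have := (hb ξ).trans (hb' ξ).symm
    linarith
  rw [liePairing_congr_of_re h1, liePairing_skew, liePairing_congr_of_re h2, ← liePairing_skew]

lemma Represents.of_equivariant (hU : IsOpen[orbitTopology e] U)
    (hp : IsQuotientByRealForm E e p) {z w : U} {u : (Matrix ι ι ℂ)ˣ}
    (hu : u ∈ realCoadjointGroup e) (huw : (u : Matrix ι ι ℂ) *ᵥ (z : ι → ℂ) = w)
    {α : E →ₗ[ℝ] ℝ} {a : ι → ℂ} (h : Represents e p w α a) :
    Represents e p z α ((u : Matrix ι ι ℂ)ᵀ *ᵥ a) := by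
  intro ξ
  have h1 := h (((u⁻¹ : (Matrix ι ι ℂ)ˣ) : Matrix ι ι ℂ)ᵀ *ᵥ ξ)
  have h2 : (u : Matrix ι ι ℂ)ᵀ *ᵥ ((u⁻¹ : (Matrix ι ι ℂ)ˣ) : Matrix ι ι ℂ)ᵀ *ᵥ ξ = ξ := by
    rw [Matrix.mulVec_mulVec, ← Matrix.transpose_mul, Units.inv_mul, Matrix.transpose_one,
      Matrix.one_mulVec]
  rw [orbitDifferentialL_equivariant hU hp z w hu huw, ← huw,
    coadAt_equivariant e (realCoadjointGroup_le e hu), h2, Matrix.dotProduct_mulVec,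
    ← Matrix.mulVec_transpose] at h1
  exact h1

/-- The covector `α ∘ dp` of the orbit is extended to `𝔤*` through `S`, a projection to the tangent
space followed by a section of `ξ ↦ ad*(ξ) z`. The section is only defined up to the stabilizer,
which `dp` kills. Choosing `S` once makes the representative linear in `α`. -/
lemma exists_represents (hp : IsQuotientByRealForm E e p) (z : U) :
    ∃ j : (E →ₗ[ℝ] ℝ) →ₗ[ℝ] (ι → ℂ), ∀ α, Represents e p z α (j α) := by
  let f : (ι → ℂ) →ₗ[ℝ] (ι → ℂ) := (coadAt e z).restrictScalars ℝ
  obtain ⟨g, hg⟩ := f.rangeRestrict.exists_rightInverse_of_surjective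
    (LinearMap.range_eq_top.2 f.surjective_rangeRestrict)
  obtain ⟨q, hq⟩ := (LinearMap.range f).exists_isCompl
  let S : (ι → ℂ) →ₗ[ℝ] (ι → ℂ) := g ∘ₗ (LinearMap.range f).projectionOnto q hq
  have hS : ∀ ξ, coadAt e z (S (coadAt e z ξ)) = coadAt e z ξ := fun ξ => by
    have h1 : (LinearMap.range f).projectionOnto q hq (coadAt e z ξ) = f.rangeRestrict ξ :=
      Submodule.projectionOnto_apply_left hq (f.rangeRestrict ξ)
    have h2 := congrArg Subtype.val (DFunLike.congr_fun hg (f.rangeRestrict ξ))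
    simp only [S, LinearMap.comp_apply, h1]
    exact h2
  refine ⟨holComponentₗ ∘ₗ LinearMap.lcomp ℝ ℝ ((orbitDifferentialL e p z).toLinearMap ∘ₗ S),
    fun α ξ => ?_⟩
  refine (two_re_holComponent_dotProduct _ _).trans ?_
  change α (orbitDifferentialL e p z (S (coadAt e z ξ))) = _
  have h3 : orbitDifferentialL (E := E) e p z (S (coadAt e z ξ) - ξ) = 0 :=
    orbitDifferentialL_of_coadAt_eq_zero hp z (by rw [map_sub, hS, sub_self])
  rw [map_sub, sub_eq_zero] at h3
  rw [h3]

/-- `liePairing` as a real bilinear map. -/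
def liePairingₗ (e : Module.Basis ι ℝ 𝔤₀) (z : ι → ℂ) : (ι → ℂ) →ₗ[ℝ] (ι → ℂ) →ₗ[ℝ] ℂ :=
  LinearMap.mk₂ ℝ (liePairing e z) (liePairing_add_left e z)
    (fun a ξ η => by
      rw [← Complex.coe_smul, liePairing_smul_left, Complex.real_smul])
    (liePairing_add_right e z)
    (fun a ξ η => by
      rw [← Complex.coe_smul, liePairing_smul_right, Complex.real_smul])

/-- A set-theoretic section of the quotient map. -/
def quotientSection (hp : IsQuotientByRealForm E e p) : N → U := Function.surjInv hp.surjective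

lemma quotientSection_spec (hp : IsQuotientByRealForm E e p) (x : N) :
    p (quotientSection hp x) = x := Function.surjInv_eq hp.surjective x

/-- The value of `Re (a c)` at `z` on representatives of covectors of the quotient. -/
def pushBilin (hp : IsQuotientByRealForm E e p) (a : ℂ) (z : U) :
    LinearMap.BilinForm ℝ (E →ₗ[ℝ] ℝ) :=
  ((liePairingₗ e (z : ι → ℂ)).compl₁₂ (exists_represents hp z).choose
    (exists_represents hp z).choose).compr₂ (Complex.reLm ∘ₗ LinearMap.mulLeft ℝ a)

/-- The push-forward of `Re (a c)`, computed at the points of a set-theoretic section of `p`. -/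
def pushBivector (hp : IsQuotientByRealForm E e p) (a : ℂ) : BivectorField E N := fun x =>
  pushBilin (E := E) hp a (quotientSection hp x)

/-- The set-theoretic section may pick another point of the fibre; an element of `G₀` carries it to
`z`, transporting representatives by its transpose, and the pairing does not see the choice of
representative. -/
lemma pushBivector_apply (hU : IsOpen[orbitTopology e] U) (hp : IsQuotientByRealForm E e p) (a : ℂ)
    (z : U) {α β : E →ₗ[ℝ] ℝ} {ξ η : ι → ℂ} (hα : Represents e p z α ξ)
    (hβ : Represents e p z β η) :
    (pushBivector hp a (p z) : LinearMap.BilinForm ℝ (E →ₗ[ℝ] ℝ)) α β =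
      (a * liePairing e z ξ η).re := by
  set w := quotientSection hp (p z) with hw
  have hpw : p w = p z := quotientSection_spec hp (p z)
  obtain ⟨u, hu, huw⟩ := (hp.fiber z w).1 hpw.symm
  have hj := (exists_represents hp w).choose_spec
  change (a * liePairing e w ((exists_represents hp w).choose α)
    ((exists_represents hp w).choose β)).re = _
  rw [← huw, liePairing_equivariant e (realCoadjointGroup_le e hu),
    ((hj α).of_equivariant hU hp hu huw).liePairing_congr hα
      ((hj β).of_equivariant hU hp hu huw) hβ]

lemma pushBivector_alt (hp : IsQuotientByRealForm E e p) (a : ℂ) (x : N) :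
    (pushBivector hp a x).IsAlt := by
  intro α
  change (a * liePairing e _ _ _).re = 0
  have h : ∀ z ξ, liePairing e z ξ ξ = 0 := fun z ξ => by
    have := liePairing_skew e z ξ ξ
    exact self_eq_neg.1 this
  rw [h, mul_zero, Complex.zero_re]

/-- Since `s Re c + t Im c = Re ((s - t i) c)`, every member of the real pencil is of the form `Re
(a c)` already treated. -/
lemma pushBivector_add_smul (hp : IsQuotientByRealForm E e p) (s t : ℝ) (x : N) :
    s • pushBivector hp 1 x + t • pushBivector hp (-Complex.I) x =
      pushBivector hp (s - t * Complex.I) x := by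
  refine LinearMap.ext₂ fun α β => ?_
  change s * (1 * liePairing e _ _ _).re + t * (-Complex.I * liePairing e _ _ _).re =
    ((s - t * Complex.I) * liePairing e _ _ _).re
  simp [sub_mul]

/-! ### Brackets on the quotient -/

/-- Two functions agreeing along the exponential plaque have the same differential in the directions
`ad*(ξ) z`; agreement off the orbit is not needed. -/
lemma represents_of_eventuallyEq (hp : IsQuotientByRealForm E e p) (z : U) {k : N → ℝ}
    (hk : MDifferentiableAt 𝓘(ℝ, E) 𝓘(ℝ, ℝ) k (p z)) {f : (ι → ℂ) → ℝ}
    (hf : DifferentiableAt ℝ f z)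
    (h : ∀ᶠ ξ in 𝓝 0, f (coadExp e ξ z) = k (p (expAt e z ξ))) :
    Represents e p z (manifoldDifferential (E := E) k (p z)).toLinearMap
      (holGradient (fderiv ℝ f z)) := by
  intro ξ
  have h1 := hasFDerivAt_comp_expAt hp z hk
  have h2 : HasFDerivAt f (fderiv ℝ f z) (coadExp e 0 z) := by
    rw [coadExp_zero]
    exact hf.hasFDerivAt
  have h3 := (h2.comp 0 (hasStrictFDerivAt_coadExp e (z : ι → ℂ)).hasFDerivAt).congr_of_eventuallyEq
    (h.mono fun ξ h => h.symm)
  rw [holGradient_apply, two_re_holComponent_dotProduct]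
  exact (DFunLike.congr_fun (h1.unique h3) ξ).symm

/-- A function on the quotient lifts, near every point of `U`, to a smooth function on `𝔤*`. -/
lemma exists_smooth_lift (hU : IsOpen[orbitTopology e] U) (hp : IsQuotientByRealForm E e p) (z : U)
    {V : Set N} (hV : IsOpen V) (hz : p z ∈ V) {k : N → ℝ}
    (hk : ContMDiffOn 𝓘(ℝ, E) 𝓘(ℝ, ℝ) ∞ k V) :
    ∃ f : (ι → ℂ) → ℝ, ContDiffAt ℝ ∞ f z ∧
      ∀ᶠ η in 𝓝 0, Represents e p (expAt e z η)
        (manifoldDifferential (E := E) k (p (expAt e z η))).toLinearMap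
        (holGradient (fderiv ℝ f (coadExp e η z))) := by
  obtain ⟨ρ, hρs, hρ0, hρ⟩ := exists_plaque_retraction e (z : ι → ℂ)
  let F : (ι → ℂ) → ℝ := fun ξ => k (p (expAt e z ξ))
  have hF : ContDiffAt ℝ ∞ F (ρ z) := by
    rw [hρ0, ← contMDiffAt_iff_contDiffAt]
    have h1 : ContMDiffAt 𝓘(ℝ, E) 𝓘(ℝ, ℝ) ∞ k (p (expAt e z 0)) := by
      rw [expAt_zero]
      exact hk.contMDiffAt (hV.mem_nhds hz)
    exact h1.comp 0 (hp.smooth z)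
  have hf : ContDiffAt ℝ ∞ (F ∘ ρ) z := hF.comp _ hρs
  refine ⟨F ∘ ρ, hf, ?_⟩
  have hfd : ∀ᶠ w in 𝓝 (z : ι → ℂ), DifferentiableAt ℝ (F ∘ ρ) w :=
    ((hf.of_le (m := 1) (by simp)).eventually (by simp)).mono
      fun w hw => hw.differentiableAt one_ne_zero
  -- The factors are swapped so that `curry_nhds` first fixes the base point `exp η z` and then lets
  -- `ξ` vary: the lift agrees with `k ∘ p` near every nearby point of the orbit, not only near `z`.
  have hsw : ∀ᶠ q in 𝓝 ((0 : ι → ℂ), (0 : ι → ℂ)),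
      coadExp e (ρ (coadExp e q.2 (coadExp e q.1 z))) z = coadExp e q.2 (coadExp e q.1 z) :=
    (continuous_swap.tendsto' ((0 : ι → ℂ), (0 : ι → ℂ)) 0 rfl).eventually hρ
  filter_upwards [hsw.curry_nhds, eventually_coadExp_mem hU z,
    (tendsto_coadExp e (z : ι → ℂ)).eventually hfd,
    (continuousAt_comp_expAt hp z).eventually (hV.mem_nhds hz)] with η h1 h2 h3 h4
  have hw : (expAt e z η : ι → ℂ) = coadExp e η z := expAt_coe z h2
  have h5 : MDifferentiableAt 𝓘(ℝ, E) 𝓘(ℝ, ℝ) k (p (expAt e z η)) :=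
    (hk.contMDiffAt (hV.mem_nhds h4)).mdifferentiableAt (by simp)
  rw [← hw] at h3 h1 ⊢
  refine represents_of_eventuallyEq hp (expAt e z η) h5 h3 ?_
  filter_upwards [h1, eventually_coadExp_mem hU (expAt e z η)] with ξ h6 h7
  have h8 : expAt e z (ρ (coadExp e ξ (expAt e z η))) = expAt e (expAt e z η) ξ :=
    expAt_eq z (h6.trans (expAt_coe _ h7).symm)
  simp only [F, Function.comp_apply, h8]

lemma bracket_eq_ambientBracket (hU : IsOpen[orbitTopology e] U)
    (hp : IsQuotientByRealForm E e p) (a : ℂ) (z : U) {k l : N → ℝ} {f g : (ι → ℂ) → ℝ}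
    (hf : Represents e p z (manifoldDifferential (E := E) k (p z)).toLinearMap
      (holGradient (fderiv ℝ f z)))
    (hg : Represents e p z (manifoldDifferential (E := E) l (p z)).toLinearMap
      (holGradient (fderiv ℝ g z))) :
    bracket (pushBivector hp a) k l (p z) = ambientBracket e a f g z :=
  pushBivector_apply hU hp a z hf hg

/-- Along a smooth local section of `p`, the bracket on the quotient is the ambient bracket of local
lifts, a composition of smooth maps. -/
lemma isSmoothBivector_pushBivector (hU : IsOpen[orbitTopology e] U)
    (hp : IsQuotientByRealForm E e p) (a : ℂ) : IsSmoothBivector (pushBivector hp a) where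
  alt := pushBivector_alt hp a
  smooth V k l hV hk hl := by
    intro x hx
    obtain ⟨z, rfl⟩ := hp.surjective x
    obtain ⟨f, hfs, hf⟩ := exists_smooth_lift hU hp z hV hx hk
    obtain ⟨g, hgs, hg⟩ := exists_smooth_lift hU hp z hV hx hl
    obtain ⟨s, hs, hs0, hsp⟩ := exists_local_section hp z
    have hst : Tendsto s (𝓝 (p z)) (𝓝 0) := by
      have := hs.continuousAt.tendsto
      rwa [hs0] at this
    have h1 : bracket (pushBivector hp a) k l =ᶠ[𝓝 (p z)]
        fun x => ambientBracket e a f g (coadExp e (s x) z) := by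
      filter_upwards [hst.eventually hf, hst.eventually hg, hsp,
        hst.eventually (eventually_coadExp_mem hU z)] with x h1 h2 h3 h4
      have hw : (expAt e z (s x) : ι → ℂ) = coadExp e (s x) z := expAt_coe z h4
      rw [← hw] at h1 h2 ⊢
      conv_lhs => rw [← h3]
      exact bracket_eq_ambientBracket hU hp a _ h1 h2
    have h2 : ContDiffAt ℝ ∞ (fun ξ => ambientBracket e a f g (coadExp e ξ z)) (s (p z)) := by
      have h3 : ContDiffAt ℝ ∞ (ambientBracket e a f g) (coadExp e (s (p z)) z) := by
        rw [hs0, coadExp_zero]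
        exact contDiffAt_ambientBracket e a hfs hgs
      exact ContDiffAt.comp (g := ambientBracket e a f g) (f := fun ξ => coadExp e ξ (z : ι → ℂ)) (s (p z)) h3
        (contDiff_coadExp e (z : ι → ℂ)).contDiffAt
    exact ((h2.contMDiffAt.comp (p z) hs).congr_of_eventuallyEq h1).contMDiffWithinAt

lemma isPoisson_pushBivector (hU : IsOpen[orbitTopology e] U)
    (hp : IsQuotientByRealForm E e p) (a : ℂ) : IsPoisson (pushBivector hp a) where
  toIsSmoothBivector := isSmoothBivector_pushBivector hU hp a
  jacobi V k l m hV hk hl hm x hx := by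
    obtain ⟨z, rfl⟩ := hp.surjective x
    obtain ⟨f, hfs, hf⟩ := exists_smooth_lift hU hp z hV hx hk
    obtain ⟨g, hgs, hg⟩ := exists_smooth_lift hU hp z hV hx hl
    obtain ⟨h, hhs, hh⟩ := exists_smooth_lift hU hp z hV hx hm
    -- The ambient bracket of lifts is again a lift of the bracket, so nested brackets on the
    -- quotient are nested ambient brackets at `z`.
    have key : ∀ {k l : N → ℝ} {f g : (ι → ℂ) → ℝ}, ContMDiffOn 𝓘(ℝ, E) 𝓘(ℝ, ℝ) ∞ k V →
        ContMDiffOn 𝓘(ℝ, E) 𝓘(ℝ, ℝ) ∞ l V → ContDiffAt ℝ ∞ f z → ContDiffAt ℝ ∞ g z →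
        (∀ᶠ η in 𝓝 0, Represents e p (expAt e z η)
          (manifoldDifferential (E := E) k (p (expAt e z η))).toLinearMap
          (holGradient (fderiv ℝ f (coadExp e η z)))) →
        (∀ᶠ η in 𝓝 0, Represents e p (expAt e z η)
          (manifoldDifferential (E := E) l (p (expAt e z η))).toLinearMap
          (holGradient (fderiv ℝ g (coadExp e η z)))) →
        Represents e p z
          (manifoldDifferential (E := E) (bracket (pushBivector hp a) k l) (p z)).toLinearMap
          (holGradient (fderiv ℝ (ambientBracket e a f g) z)) := by
      intro k l f g hk hl hfs hgs hf hg
      refine represents_of_eventuallyEq hp z ?_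
        ((contDiffAt_ambientBracket e a hfs hgs).differentiableAt (by simp)) ?_
      · exact (((isSmoothBivector_pushBivector hU hp a).smooth V k l hV hk hl).contMDiffAt
          (hV.mem_nhds hx)).mdifferentiableAt (by simp)
      · filter_upwards [hf, hg, eventually_coadExp_mem hU z] with ξ h1 h2 h3
        have hw : (expAt e z ξ : ι → ℂ) = coadExp e ξ z := expAt_coe z h3
        rw [← hw] at h1 h2 ⊢
        exact (bracket_eq_ambientBracket hU hp a _ h1 h2).symm
    have self : ∀ {k : N → ℝ} {f : (ι → ℂ) → ℝ},
        (∀ᶠ η in 𝓝 0, Represents e p (expAt e z η)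
          (manifoldDifferential (E := E) k (p (expAt e z η))).toLinearMap
          (holGradient (fderiv ℝ f (coadExp e η z)))) →
        Represents e p z (manifoldDifferential (E := E) k (p z)).toLinearMap
          (holGradient (fderiv ℝ f z)) := by
      intro k f h
      have h1 := h.self_of_nhds
      rwa [expAt_zero, coadExp_zero] at h1
    rw [bracket_eq_ambientBracket hU hp a z (self hf) (key hl hm hgs hhs hg hh),
      bracket_eq_ambientBracket hU hp a z (self hg) (key hm hk hhs hfs hh hf),
      bracket_eq_ambientBracket hU hp a z (self hh) (key hk hl hfs hgs hf hg)]
    exact ambientBracket_jacobi e a hfs hgs hhs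

/-- The coefficient `-I` produces the imaginary part: `Re (-i c) = Im c`. -/
lemma isReduction_pushBivector (hU : IsOpen[orbitTopology e] U)
    (hp : IsQuotientByRealForm E e p) :
    IsReduction e p (pushBivector hp 1) (pushBivector hp (-Complex.I)) where
  smooth₁ := isSmoothBivector_pushBivector hU hp 1
  smooth₂ := isSmoothBivector_pushBivector hU hp _
  push z α β φ ψ hφ hψ := by
    have h1 : Represents (E := E) e p z α (holComponent φ) := fun ξ =>
      (two_re_holComponent_dotProduct φ _).trans (hφ ξ)
    have h2 : Represents (E := E) e p z β (holComponent ψ) := fun ξ =>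
      (two_re_holComponent_dotProduct ψ _).trans (hψ ξ)
    refine ⟨(pushBivector_apply hU hp 1 z h1 h2).trans ?_,
      (pushBivector_apply hU hp _ z h1 h2).trans ?_⟩ <;> simp [linearPoisson]

end Quotient

/-! ### The tangent spaces of the leaves -/

section Leaves

set_option linter.unusedSectionVars false

open Set Filter

lemma finrank_map_of_injective {K V W : Type*} [DivisionRing K] [AddCommGroup V] [Module K V]
    [AddCommGroup W] [Module K W] {f : V →ₗ[K] W} (hf : Function.Injective f) (q : Submodule K V) :
    Module.finrank K (q.map f) = Module.finrank K q :=
  (Submodule.equivMapOfInjective f hf q).finrank_eq.symm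

/-- A complex subspace stable under conjugation is the complexification of its real part. -/
lemma finrank_inf_realVectors {ι : Type*} [Fintype ι] (K : Submodule ℂ (ι → ℂ))
    (hK : ∀ x ∈ K, star x ∈ K) :
    Module.finrank ℝ (K.restrictScalars ℝ ⊓ realVectors ι : Submodule ℝ (ι → ℂ)) =
      Module.finrank ℂ K := by
  let KR : Submodule ℝ (ι → ℂ) := K.restrictScalars ℝ ⊓ realVectors ι
  let f : (KR × KR) →ₗ[ℝ] K.restrictScalars ℝ :=
    { toFun := fun q => ⟨(q.1 : ι → ℂ) + Complex.I • (q.2 : ι → ℂ),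
        K.add_mem q.1.2.1 (K.smul_mem _ q.2.2.1)⟩
      map_add' := fun q r => Subtype.ext (by
        simp only [Prod.fst_add, Prod.snd_add, Submodule.coe_add, smul_add]
        abel)
      map_smul' := fun a q => Subtype.ext (by
        simp only [Prod.smul_fst, Prod.smul_snd, Submodule.coe_smul, RingHom.id_apply, smul_add]
        rw [smul_comm]) }
  have hstar : ∀ x : KR, star (x : ι → ℂ) = x := fun x => mem_realVectors_iff_star.1 x.2.2
  have hinj : Function.Injective f := by
    rw [← LinearMap.ker_eq_bot, LinearMap.ker_eq_bot']
    rintro ⟨x, y⟩ h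
    have h1 : (x : ι → ℂ) + Complex.I • (y : ι → ℂ) = 0 := congrArg Subtype.val h
    have h2 := congrArg star h1
    rw [star_add, star_smul, hstar, hstar, star_zero] at h2
    have hx : (x : ι → ℂ) = 0 := by
      funext i
      have h3 := congrFun h1 i
      have h4 := congrFun h2 i
      simp only [Pi.add_apply, Pi.smul_apply, smul_eq_mul, Pi.zero_apply, RCLike.star_def,
        Complex.conj_I] at h3 h4 ⊢
      linear_combination (h3 + h4) / 2
    have hy : (y : ι → ℂ) = 0 := by
      rw [hx, zero_add] at h1
      exact (smul_eq_zero.1 h1).resolve_left Complex.I_ne_zero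
    exact Prod.ext (Subtype.ext hx) (Subtype.ext hy)
  have hsurj : Function.Surjective f := by
    rintro ⟨x, hx⟩
    have hx' : x ∈ K := hx
    refine ⟨⟨⟨(1 / 2 : ℂ) • (x + star x), K.smul_mem _ (K.add_mem hx' (hK x hx')), ?_⟩,
      ⟨(-Complex.I / 2) • (x - star x), K.smul_mem _ (K.sub_mem hx' (hK x hx')), ?_⟩⟩, ?_⟩
    · refine mem_realVectors_iff_star.2 (funext fun i => ?_)
      simp
      ring
    · refine mem_realVectors_iff_star.2 (funext fun i => ?_)
      simp
      ring
    · refine Subtype.ext ?_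
      funext i
      simp [f]
      linear_combination (-(x i - (starRingEnd ℂ) (x i)) / 2) * Complex.I_mul_I
  have h1 := (LinearEquiv.ofBijective f ⟨hinj, hsurj⟩).finrank_eq
  rw [Module.finrank_prod] at h1
  have h2 : Module.finrank ℝ (K.restrictScalars ℝ) = 2 * Module.finrank ℂ K :=
    (finrank_real_of_complex K)
  change Module.finrank ℝ KR = _
  omega

variable {𝔤₀ : Type*} [LieRing 𝔤₀] [LieAlgebra ℝ 𝔤₀] {ι : Type*} [Fintype ι] [DecidableEq ι]
  {E : Type*} [NormedAddCommGroup E] [NormedSpace ℝ E] [FiniteDimensional ℝ E]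
  {N : Type*} [TopologicalSpace N] [ChartedSpace E N] [IsManifold 𝓘(ℝ, E) ∞ N]
  {e : Module.Basis ι ℝ 𝔤₀} {U : Set (ι → ℂ)} {p : U → N}

lemma finrank_realVectors : Module.finrank ℝ (realVectors ι) = Fintype.card ι := by
  have h := finrank_inf_realVectors (⊤ : Submodule ℂ (ι → ℂ)) fun _ _ => Submodule.mem_top
  rw [Submodule.restrictScalars_top, top_inf_eq] at h
  rw [h, finrank_top, Module.finrank_pi]

lemma poissonMatrix_star_mulVec (e : Module.Basis ι ℝ 𝔤₀) (z ξ : ι → ℂ) :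
    poissonMatrix e (star z) *ᵥ star ξ = star (poissonMatrix e z *ᵥ ξ) := by
  rw [poissonMatrix_star]
  funext i
  simp [Matrix.mulVec, dotProduct]

lemma coadAt_eq_zero_iff {z ξ : ι → ℂ} : coadAt e z ξ = 0 ↔ poissonMatrix e z *ᵥ ξ = 0 := by
  rw [coadAt_eq_neg_mulVec, neg_eq_zero]

/-- The dimension of the tangent spaces of the orbits of the real group. -/
lemma finrank_realOrbitTangent_add (e : Module.Basis ι ℝ 𝔤₀) (z : ι → ℂ) :
    Module.finrank ℝ (realOrbitTangent e z) + commonKernelDim e z = Fintype.card ι := by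
  let f : realVectors ι →ₗ[ℝ] (ι → ℂ) :=
    ((coadAt e z).restrictScalars ℝ).domRestrict (realVectors ι)
  have h1 := LinearMap.finrank_range_add_finrank_ker f
  have h2 : LinearMap.range f = realOrbitTangent e z := LinearMap.range_domRestrict _ _
  let K : Submodule ℂ (ι → ℂ) := LinearMap.ker (poissonMatrix e z).mulVecLin ⊓
      LinearMap.ker (poissonMatrix e (star z)).mulVecLin
  have hK : ∀ x ∈ K, star x ∈ K := by
    rintro x ⟨h3, h4⟩
    simp only [SetLike.mem_coe, LinearMap.mem_ker, Matrix.mulVecLin_apply] at h3 h4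
    constructor
    · simp only [SetLike.mem_coe, LinearMap.mem_ker, Matrix.mulVecLin_apply]
      rw [← star_star z, poissonMatrix_star_mulVec, h4, star_zero]
    · simp only [SetLike.mem_coe, LinearMap.mem_ker, Matrix.mulVecLin_apply]
      rw [poissonMatrix_star_mulVec, h3, star_zero]
  -- A real vector annihilated at `z` is annihilated at `z̄` as well, by conjugation, so the real
  -- stabilizer is the real part of the common kernel.
  have h3 : (LinearMap.ker f).map (realVectors ι).subtype =
      (K.restrictScalars ℝ ⊓ realVectors ι : Submodule ℝ (ι → ℂ)) := by
    ext x
    constructor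
    · rintro ⟨⟨x, hx⟩, h, rfl⟩
      have h5 : poissonMatrix e z *ᵥ x = 0 := coadAt_eq_zero_iff.1 h
      refine ⟨⟨h5, ?_⟩, hx⟩
      have h6 := poissonMatrix_star_mulVec e z x
      rw [mem_realVectors_iff_star.1 hx, h5, star_zero] at h6
      exact h6
    · rintro ⟨⟨h, -⟩, hx⟩
      exact ⟨⟨x, hx⟩, coadAt_eq_zero_iff.2 h, rfl⟩
  have h4 : Module.finrank ℝ (LinearMap.ker f) = Module.finrank ℂ K := by
    rw [← finrank_inf_realVectors K hK, ← h3,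
      finrank_map_of_injective (realVectors ι).subtype_injective]
  rw [h2, h4, finrank_realVectors] at h1
  exact h1

lemma realOrbitTangent_le_leafTangent (hU : IsOpen[orbitTopology e] U)
    (hp : IsQuotientByRealForm E e p) (z : U) :
    realOrbitTangent e (z : ι → ℂ) ≤ leafTangent E e p z := by
  rintro _ ⟨ξ, hξ, rfl⟩
  exact ⟨ξ, orbitDifferentialL_of_real hU hp z hξ, rfl⟩

/-- The map `Φ`, formed by `p` in a chart and a projection of the orbit to `T`, is a submersion, so
the image of the fibre of `p` through `z` contains a neighbourhood in `T` and has Hausdorff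
dimension `dim T`. The fibre lies in a `G₀`-orbit, whose Hausdorff dimension is at most that of its
tangent space, and a Lipschitz projection does not increase it. -/
lemma finrank_leafTangent_le (hU : IsOpen[orbitTopology e] U)
    (hp : IsQuotientByRealForm E e p) (z : U) :
    Module.finrank ℝ (leafTangent E e p z) ≤
      Module.finrank ℝ (realOrbitTangent e (z : ι → ℂ)) := by
  set T := leafTangent E e p z with hT
  obtain ⟨S, hS⟩ := T.subtype.exists_leftInverse_of_injective T.ker_subtype
  let SL : (ι → ℂ) →L[ℝ] T := LinearMap.toContinuousLinearMap S
  have hSL : ∀ t : T, SL t = t := fun t => DFunLike.congr_fun hS t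
  let Φ : (ι → ℂ) → E × T := fun ξ => (expCoord e p z ξ, SL (coadExp e ξ z))
  have hΦ : HasStrictFDerivAt Φ
      ((orbitDifferentialL (E := E) e p z).prod (SL.comp (coadAtL e z))) 0 :=
    (hasStrictFDerivAt_expCoord hp z).prodMk
      (SL.hasStrictFDerivAt.comp 0 (hasStrictFDerivAt_coadExp e (z : ι → ℂ)))
  have hsurj : LinearMap.range
      ((orbitDifferentialL (E := E) e p z).prod (SL.comp (coadAtL e z))).toLinearMap = ⊤ := by
    refine LinearMap.range_eq_top.2 ?_
    rintro ⟨x, t⟩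
    obtain ⟨ξ₁, h1⟩ := surjective_orbitDifferentialL hp z x
    obtain ⟨ξ₂, h2, h3⟩ := (t - SL (coadAt e z ξ₁)).2
    have h2' : orbitDifferentialL (E := E) e p z ξ₂ = 0 := h2
    have h3' : coadAt e z ξ₂ = ((t - SL (coadAt e z ξ₁) : T) : ι → ℂ) := h3
    refine ⟨ξ₁ + ξ₂, Prod.ext ?_ ?_⟩
    · change orbitDifferentialL (E := E) e p z (ξ₁ + ξ₂) = x
      rw [map_add, h1, h2', add_zero]
    · change SL (coadAt e z (ξ₁ + ξ₂)) = t
      rw [map_add, map_add, h3', hSL]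
      abel
  have hmap := hΦ.map_nhds_eq_of_surj hsurj
  have hW := (eventually_coadExp_mem hU z).and ((continuousAt_comp_expAt hp z).eventually
    (extChartAt_source_mem_nhds (I := 𝓘(ℝ, E)) (p z)))
  have hV := image_mem_map (m := Φ) hW
  rw [hmap] at hV
  have hΦ0 : Φ 0 = (extChartAt 𝓘(ℝ, E) (p z) (p z), SL (z : ι → ℂ)) := by
    simp only [Φ, expCoord, expAt_zero, coadExp_zero]
  rw [hΦ0] at hV
  have hV2 : {t : T | (extChartAt 𝓘(ℝ, E) (p z) (p z), t) ∈ Φ '' {ξ | coadExp e ξ z ∈ U ∧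
      p (expAt e z ξ) ∈ (extChartAt 𝓘(ℝ, E) (p z)).source}} ∈ 𝓝 (SL (z : ι → ℂ)) :=
    (Continuous.prodMk_right (extChartAt 𝓘(ℝ, E) (p z) (p z))).continuousAt.preimage_mem_nhds hV
  have hd := Real.dimH_of_mem_nhds hV2
  have hsub : {t : T | (extChartAt 𝓘(ℝ, E) (p z) (p z), t) ∈ Φ '' {ξ | coadExp e ξ z ∈ U ∧
      p (expAt e z ξ) ∈ (extChartAt 𝓘(ℝ, E) (p z)).source}} ⊆
      SL '' {w : ι → ℂ | ∃ u ∈ realCoadjointGroup e,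
        (u : Matrix ι ι ℂ) *ᵥ (z : ι → ℂ) = w} := by
    rintro t ⟨ξ, ⟨h1, h2⟩, h3⟩
    have h4 : p (expAt e z ξ) = p z := (extChartAt 𝓘(ℝ, E) (p z)).injOn h2
      (mem_extChartAt_source (I := 𝓘(ℝ, E)) (p z)) (congrArg Prod.fst h3)
    obtain ⟨u, hu, h5⟩ := (hp.fiber z (expAt e z ξ)).1 h4.symm
    rw [expAt_coe z h1] at h5
    exact ⟨coadExp e ξ z, ⟨u, hu, h5⟩, congrArg Prod.snd h3⟩
  have h1 := (dimH_mono hsub).trans ((SL.lipschitz.dimH_image_le _).trans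
    (dimH_realOrbit_le e (z : ι → ℂ)))
  rw [hd] at h1
  exact_mod_cast h1

/-- The leaves of the quotient map have the tangent spaces of the orbits of the real group. -/
lemma leafTangent_eq (hU : IsOpen[orbitTopology e] U) (hp : IsQuotientByRealForm E e p) (z : U) :
    leafTangent E e p z = realOrbitTangent e (z : ι → ℂ) :=
  (Submodule.eq_of_le_of_finrank_le (realOrbitTangent_le_leafTangent hU hp z)
    (finrank_leafTangent_le hU hp z)).symm

lemma finrank_real_range_coadAt (e : Module.Basis ι ℝ 𝔤₀) (z : ι → ℂ) :
    Module.finrank ℝ (LinearMap.range ((coadAt e z).restrictScalars ℝ)) =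
      2 * (poissonMatrix e z).rank := by
  have h : Module.finrank ℂ (LinearMap.range (coadAt e z)) = (poissonMatrix e z).rank := by
    rw [← Matrix.rank_transpose, Matrix.rank, Matrix.mulVecLin_transpose]
    rfl
  rw [← h]
  exact finrank_real_of_complex (LinearMap.range (coadAt e z))

/-- Rank-nullity for `dp` on `T_z M`, whose real dimension is twice the rank of `c(z)`; the
stabilizer contributes equally to both kernels. -/
lemma finrank_add_finrank_leafTangent (hp : IsQuotientByRealForm E e p) (z : U) :
    Module.finrank ℝ E + Module.finrank ℝ (leafTangent E e p z) =
      2 * (poissonMatrix e z).rank := by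
  let D : (ι → ℂ) →ₗ[ℝ] E := (orbitDifferentialL (E := E) e p z).toLinearMap
  let f : (ι → ℂ) →ₗ[ℝ] (ι → ℂ) := (coadAt e z).restrictScalars ℝ
  have h1 := LinearMap.finrank_range_add_finrank_ker D
  have h2 := LinearMap.finrank_range_add_finrank_ker f
  have h3 : LinearMap.range D = ⊤ := LinearMap.range_eq_top.2 (surjective_orbitDifferentialL hp z)
  rw [h3, finrank_top] at h1
  have h4 := LinearMap.finrank_range_add_finrank_ker (f.domRestrict (LinearMap.ker D))
  have h5 : LinearMap.range (f.domRestrict (LinearMap.ker D)) = leafTangent E e p z :=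
    LinearMap.range_domRestrict _ _
  have h6 : Module.finrank ℝ (LinearMap.ker (f.domRestrict (LinearMap.ker D))) =
      Module.finrank ℝ (LinearMap.ker f) := by
    have h7 : (LinearMap.ker (f.domRestrict (LinearMap.ker D))).map (LinearMap.ker D).subtype =
        LinearMap.ker f := by
      ext x
      constructor
      · rintro ⟨⟨x, hx⟩, h, rfl⟩
        exact h
      · intro h
        exact ⟨⟨x, orbitDifferentialL_of_coadAt_eq_zero hp z h⟩, h, rfl⟩
    rw [← h7, finrank_map_of_injective (LinearMap.ker D).subtype_injective]
  rw [h5, h6] at h4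
  rw [finrank_real_range_coadAt] at h2
  omega

lemma finrank_add_card (hU : IsOpen[orbitTopology e] U) (hp : IsQuotientByRealForm E e p) (z : U) :
    Module.finrank ℝ E + Fintype.card ι =
      2 * (poissonMatrix e z).rank + commonKernelDim e z := by
  have h1 := finrank_add_finrank_leafTangent hp z
  have h2 := finrank_realOrbitTangent_add e (z : ι → ℂ)
  rw [leafTangent_eq hU hp] at h1
  omega

/-- The dimensions of the quotient and of the orbit fix the leaf dimension, which determines `μ`.
This makes ranks at different points of `U` comparable. -/
lemma commonKernelDim_eq (hU : IsOpen[orbitTopology e] U) (hp : IsQuotientByRealForm E e p)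
    {z₀ : ι → ℂ} (hUM : U ⊆ coadjointOrbit e z₀) (z w : U) :
    commonKernelDim e z = commonKernelDim e w := by
  have h1 := finrank_add_card hU hp z
  have h2 := finrank_add_card hU hp w
  rw [rank_poissonMatrix_orbit e (hUM z.2)] at h1
  rw [rank_poissonMatrix_orbit e (hUM w.2)] at h2
  omega

/-! ### The CR structure of the leaves -/

/-- Multiplication by `I` as a real linear map. -/
def mulI (ι : Type*) : (ι → ℂ) →ₗ[ℝ] (ι → ℂ) :=
  (Complex.I • (LinearMap.id : (ι → ℂ) →ₗ[ℂ] (ι → ℂ))).restrictScalars ℝ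

lemma mulI_injective : Function.Injective (mulI ι) := fun x y h => by
  have h' : Complex.I • x = Complex.I • y := h
  exact smul_right_injective _ Complex.I_ne_zero h'

lemma exists_real_add (ξ : ι → ℂ) : ∃ x ∈ realVectors ι, ∃ y ∈ realVectors ι,
    ξ = x + Complex.I • y := by
  refine ⟨fun i => ((ξ i).re : ℂ), ⟨fun i => (ξ i).re, rfl⟩, fun i => ((ξ i).im : ℂ),
    ⟨fun i => (ξ i).im, rfl⟩, ?_⟩
  funext i
  simp [mul_comm Complex.I, Complex.re_add_im]

lemma realOrbitTangent_sup_mulI (e : Module.Basis ι ℝ 𝔤₀) (z : ι → ℂ) :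
    realOrbitTangent e z ⊔ (realOrbitTangent e z).map (mulI ι) =
      LinearMap.range ((coadAt e z).restrictScalars ℝ) := by
  refine le_antisymm (sup_le ?_ ?_) ?_
  · rintro _ ⟨ξ, -, rfl⟩
    exact ⟨ξ, rfl⟩
  · rintro _ ⟨_, ⟨ξ, -, rfl⟩, rfl⟩
    exact ⟨Complex.I • ξ, (coadAt e z).map_smul _ _⟩
  · rintro _ ⟨ξ, rfl⟩
    obtain ⟨x, hx, y, hy, rfl⟩ := exists_real_add ξ
    refine Submodule.mem_sup.2 ⟨_, ⟨x, hx, rfl⟩, _, ⟨_, ⟨y, hy, rfl⟩, rfl⟩, ?_⟩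
    change coadAt e z x + Complex.I • coadAt e z y = coadAt e z (x + Complex.I • y)
    rw [map_add, map_smul]

/-- With `T` the leaf tangent space, `T + I T = T_z M` because `𝔤 = 𝔤₀ + i 𝔤₀`; hence `dim (T ∩ I T)
= 2 dim T - dim T_z M`. -/
lemma finrank_leafCRTangent_add (hU : IsOpen[orbitTopology e] U) (hp : IsQuotientByRealForm E e p)
    (z : U) :
    Module.finrank ℝ (leafCRTangent E e p z) + 2 * (poissonMatrix e z).rank +
      2 * Module.finrank ℝ E = 4 * (poissonMatrix e z).rank := by
  have h1 := Submodule.finrank_sup_add_finrank_inf_eq (realOrbitTangent e (z : ι → ℂ))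
    ((realOrbitTangent e (z : ι → ℂ)).map (mulI ι))
  rw [realOrbitTangent_sup_mulI, finrank_real_range_coadAt,
    finrank_map_of_injective mulI_injective] at h1
  have h2 := finrank_add_finrank_leafTangent hp z
  have h3 : leafCRTangent E e p z =
      realOrbitTangent e (z : ι → ℂ) ⊓ (realOrbitTangent e (z : ι → ℂ)).map (mulI ι) := by
    rw [leafCRTangent, leafTangent_eq hU hp]
    rfl
  rw [leafTangent_eq hU hp] at h2
  rw [h3]
  omega

/-- If the rank of `B` is maximal in the pencil `B + t A`, then `A` maps the kernel of `B` to the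
range of `B`. -/
lemma mem_range_of_finrank_range_le {V W : Type*} [NormedAddCommGroup V] [NormedSpace ℂ V]
    [FiniteDimensional ℂ V] [NormedAddCommGroup W] [NormedSpace ℂ W] [FiniteDimensional ℂ W]
    (A B : V →ₗ[ℂ] W)
    (h : ∀ t : ℂ, Module.finrank ℂ (LinearMap.range (B + t • A)) ≤
      Module.finrank ℂ (LinearMap.range B)) {y : V} (hy : B y = 0) :
    A y ∈ LinearMap.range B := by
  by_contra hA
  set r := Module.finrank ℂ (LinearMap.range B)
  let b := Module.finBasis ℂ (LinearMap.range B)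
  choose v hv using fun i => (b i).2
  -- If `A y ∉ range B`, then `A y` and a basis of `range B` are `r + 1` independent vectors.
  -- Independence survives a small `t ≠ 0`, and all of them then lie in `range (B + t A)`, since `(B
  -- + t A) (t⁻¹ y) = A y`. That exceeds the rank bound.
  let g : ℂ → Fin (r + 1) → W := fun t => Fin.cons (A y) fun i => (B + t • A) (v i)
  have hg : Continuous g := by
    refine continuous_pi fun i => ?_
    refine Fin.cases ?_ (fun i => ?_) i
    · exact continuous_const
    · exact continuous_const.add (continuous_id.smul continuous_const)
  have hg0 : LinearIndependent ℂ (g 0) := by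
    refine linearIndependent_finCons.2 ⟨?_, ?_⟩
    · have : (fun i => (B + (0 : ℂ) • A) (v i)) = fun i => ((b i : LinearMap.range B) : W) := by
        funext i
        simp [hv]
      rw [this]
      exact b.linearIndependent.map' (LinearMap.range B).subtype (Submodule.ker_subtype _)
    · intro hmem
      refine hA (Submodule.span_le.2 ?_ hmem)
      rintro _ ⟨i, rfl⟩
      exact ⟨v i, by simp⟩
  have h1 : ∀ᶠ t in 𝓝 (0 : ℂ), LinearIndependent ℂ (g t) :=
    hg.continuousAt.eventually (isOpen_setOfPred_linearIndependent.mem_nhds hg0)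
  have h2 : ∃ᶠ t in 𝓝 (0 : ℂ), t ≠ 0 :=
    (show ∃ᶠ t in 𝓝[≠] (0 : ℂ), t ≠ 0 from
      (eventually_mem_nhdsWithin (a := (0 : ℂ)) (s := {0}ᶜ)).frequently).filter_mono nhdsWithin_le_nhds
  obtain ⟨t, ht0, ht⟩ := (h2.and_eventually h1).exists
  have h3 : ∀ i, g t i ∈ LinearMap.range (B + t • A) := by
    intro i
    refine Fin.cases ?_ (fun i => ?_) i
    · refine ⟨t⁻¹ • y, ?_⟩
      rw [map_smul, LinearMap.add_apply, hy, zero_add, LinearMap.smul_apply, smul_smul,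
        inv_mul_cancel₀ ht0, one_smul]
      rfl
    · exact ⟨v i, rfl⟩
  have h4 : LinearIndependent ℂ fun i => (⟨g t i, h3 i⟩ : LinearMap.range (B + t • A)) :=
    LinearIndependent.of_comp (LinearMap.range (B + t • A)).subtype ht
  have h5 := h4.fintype_card_le_finrank
  rw [Fintype.card_fin] at h5
  have h6 := h t
  omega

lemma rank_le_genericRank (e : Module.Basis ι ℝ 𝔤₀) (z : ι → ℂ) :
    (poissonMatrix e z).rank ≤ genericRank e :=
  le_csSup ⟨Fintype.card ι, by rintro _ ⟨w, rfl⟩; exact Matrix.rank_le_card_width _⟩ ⟨z, rfl⟩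

lemma poissonMatrix_smul_add_smul (e : Module.Basis ι ℝ 𝔤₀) (a b : ℂ) (z w : ι → ℂ) :
    poissonMatrix e (a • z + b • w) = a • poissonMatrix e z + b • poissonMatrix e w := by
  rw [poissonMatrix_add, poissonMatrix_smul, poissonMatrix_smul]

/-- `A (ker B) ⊆ range B` for the matrices of two points, the second one regular. -/
lemma exists_mulVec_eq_of_ker (e : Module.Basis ι ℝ 𝔤₀) {z w : ι → ℂ}
    (hw : (poissonMatrix e w).rank = genericRank e) {y : ι → ℂ}
    (hy : poissonMatrix e w *ᵥ y = 0) :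
    ∃ x, poissonMatrix e w *ᵥ x = poissonMatrix e z *ᵥ y := by
  refine mem_range_of_finrank_range_le (poissonMatrix e z).mulVecLin (poissonMatrix e w).mulVecLin
    (fun t => ?_) hy
  have h := rank_le_genericRank e ((1 : ℂ) • w + t • z)
  rw [poissonMatrix_smul_add_smul, one_smul, ← hw] at h
  rw [Matrix.rank, Matrix.mulVecLin_add, show (t • poissonMatrix e z).mulVecLin =
    t • (poissonMatrix e z).mulVecLin from LinearMap.ext fun x => Matrix.smul_mulVec t _ x] at h
  exact h

lemma dotProduct_poissonMatrix_comm (e : Module.Basis ι ℝ 𝔤₀) (z x y : ι → ℂ) :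
    x ⬝ᵥ poissonMatrix e z *ᵥ y = -(poissonMatrix e z *ᵥ x ⬝ᵥ y) := by
  rw [Matrix.dotProduct_mulVec, ← coadAt_apply, coadAt_eq_neg_mulVec, neg_dotProduct]

lemma liePairing_eq_zero_of_ker (e : Module.Basis ι ℝ 𝔤₀) {z w : ι → ℂ}
    (hw : (poissonMatrix e w).rank = genericRank e) {x y : ι → ℂ}
    (hx : poissonMatrix e w *ᵥ x = 0) (hy : poissonMatrix e w *ᵥ y = 0) :
    liePairing e z x y = 0 := by
  obtain ⟨v, hv⟩ := exists_mulVec_eq_of_ker e (z := z) hw hy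
  rw [liePairing, ← hv, dotProduct_poissonMatrix_comm, hx, zero_dotProduct, neg_zero]

open scoped ComplexOrder in
lemma rank_poissonMatrix_star (e : Module.Basis ι ℝ 𝔤₀) (z : ι → ℂ) :
    (poissonMatrix e (star z)).rank = (poissonMatrix e z).rank := by
  have h : poissonMatrix e (star z) = -(poissonMatrix e z)ᴴ := by
    rw [poissonMatrix_star, Matrix.conjTranspose, poissonMatrix_transpose]
    ext i j
    simp
  rw [h, ← neg_one_smul ℂ, Matrix.rank_smul_of_mem_nonZeroDivisors _
    (mem_nonZeroDivisors_of_ne_zero (by norm_num)), Matrix.rank_conjTranspose]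

/-- The dimension of the complex tangent space depends only on the rank, constant on the orbit. Its
vectors come from `ker c(z̄)`, on which the form `c(z)` vanishes since `z̄` is regular. -/
lemma isCRIsotropicFoliation (hU : IsOpen[orbitTopology e] U) (hp : IsQuotientByRealForm E e p)
    {z₀ : ι → ℂ} (hUM : U ⊆ coadjointOrbit e z₀) (hz₀ : (poissonMatrix e z₀).rank = genericRank e) :
    IsCRIsotropicFoliation E e p where
  cr z w _ := by
    have h1 := finrank_leafCRTangent_add hU hp z
    have h2 := finrank_leafCRTangent_add hU hp w
    rw [rank_poissonMatrix_orbit e (hUM z.2)] at h1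
    rw [rank_poissonMatrix_orbit e (hUM w.2)] at h2
    omega
  isotropic z v hv w hw := by
    have key : ∀ v ∈ leafCRTangent E e p z, ∃ y, poissonMatrix e (star (z : ι → ℂ)) *ᵥ y = 0 ∧
        coadAt e z y = v := by
      intro v hv
      rw [leafCRTangent, leafTangent_eq hU hp] at hv
      obtain ⟨⟨x, hx, rfl⟩, ⟨_, ⟨y, hy, rfl⟩, h⟩⟩ := hv
      have h' : Complex.I • coadAt e z y = coadAt e z x := h
      have h1 : poissonMatrix e (z : ι → ℂ) *ᵥ (x - Complex.I • y) = 0 := by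
        rw [← coadAt_eq_zero_iff, map_sub, map_smul, h', sub_self]
      have h2 := poissonMatrix_star_mulVec e z (x - Complex.I • y)
      rw [h1, star_zero, star_sub, star_smul, mem_realVectors_iff_star.1 hx,
        mem_realVectors_iff_star.1 hy] at h2
      -- From `ad*(x) z = i ad*(y) z`, the vector `x - i y` lies in `ker c(z)` and its conjugate `x
      -- + i y` in `ker c(z̄)`. The latter acts at `z` as `2 ad*(x) z`, whence the factor `1/2`.
      refine ⟨(1 / 2 : ℂ) • (x - star Complex.I • y), ?_, ?_⟩
      · rw [Matrix.mulVec_smul, h2, smul_zero]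
      · change _ = coadAt e z x
        rw [map_smul, map_sub, map_smul]
        simp only [RCLike.star_def, Complex.conj_I, neg_smul, h']
        rw [sub_neg_eq_add, ← two_smul ℂ, smul_smul]
        norm_num
    obtain ⟨x, hx, rfl⟩ := key v hv
    obtain ⟨y, hy, rfl⟩ := key w hw
    rw [symplecticForm_apply]
    refine liePairing_eq_zero_of_ker e ?_ hx hy
    rw [rank_poissonMatrix_star, rank_poissonMatrix_orbit e (hUM z.2), hz₀]

end Leaves

/-! ### The rank of the reduced pencil -/

section LinearAlgebra

set_option linter.unusedSectionVars false

open Module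

variable {K V W : Type*} [Field K] [AddCommGroup V] [Module K V] [FiniteDimensional K V]
  [AddCommGroup W] [Module K W] [FiniteDimensional K W]

lemma finrank_map_add_finrank_inf_ker (f : V →ₗ[K] W) (Z : Submodule K V) :
    finrank K (Z.map f) + finrank K (Z ⊓ LinearMap.ker f : Submodule K V) = finrank K Z := by
  have h1 := LinearMap.finrank_range_add_finrank_ker (f.domRestrict Z)
  have h2 : (LinearMap.ker (f.domRestrict Z)).map Z.subtype = Z ⊓ LinearMap.ker f := by
    ext x
    constructor
    · rintro ⟨⟨x, hx⟩, h, rfl⟩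
      exact ⟨hx, h⟩
    · rintro ⟨hx, h⟩
      exact ⟨⟨x, hx⟩, h, rfl⟩
  rw [LinearMap.range_domRestrict] at h1
  rw [← h2, finrank_map_of_injective Z.subtype_injective, h1]

lemma finrank_map_fst_add (Z : Submodule K (V × W)) :
    finrank K (Z.map (LinearMap.fst K V W)) + finrank K (Z.comap (LinearMap.inr K V W)) =
      finrank K Z := by
  rw [← finrank_map_add_finrank_inf_ker (LinearMap.fst K V W) Z,
    ← finrank_map_of_injective (f := LinearMap.inr K V W) LinearMap.inr_injective (Z.comap (LinearMap.inr K V W)),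
    Submodule.map_comap_eq, LinearMap.ker_fst, inf_comm]

lemma finrank_map_snd_add (Z : Submodule K (V × W)) :
    finrank K (Z.map (LinearMap.snd K V W)) + finrank K (Z.comap (LinearMap.inl K V W)) =
      finrank K Z := by
  rw [← finrank_map_add_finrank_inf_ker (LinearMap.snd K V W) Z,
    ← finrank_map_of_injective (f := LinearMap.inl K V W) LinearMap.inl_injective (Z.comap (LinearMap.inl K V W)),
    Submodule.map_comap_eq, LinearMap.ker_snd, inf_comm]

lemma finrank_submodule_prod (P : Submodule K V) (Q : Submodule K W) :
    finrank K (P.prod Q) = finrank K P + finrank K Q := by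
  rw [← finrank_map_fst_add, Submodule.prod_map_fst, Submodule.prod_comap_inr]

/-- Codimensions are preserved under pull-back by maps that are onto modulo a subspace. -/
lemma finrank_add_finrank_of_sup_eq (J : V →ₗ[K] W) {Q R S : Submodule K W}
    (hS : S ≤ R) (hR : R ≤ Q) (hQ : LinearMap.range J ⊔ S = Q) :
    finrank K V + finrank K R = finrank K (R.comap J) + finrank K Q := by
  have h1 := LinearMap.finrank_range_add_finrank_ker (R.mkQ ∘ₗ J)
  have h2 := finrank_map_add_finrank_inf_ker R.mkQ Q
  rw [Submodule.ker_mkQ, inf_eq_right.2 hR, ← hQ, Submodule.map_sup,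
    show S.map R.mkQ = ⊥ from LinearMap.le_ker_iff_map.1 (by rwa [Submodule.ker_mkQ]), sup_bot_eq, hQ] at h2
  rw [LinearMap.range_comp, LinearMap.ker_comp, Submodule.ker_mkQ] at h1
  omega

variable {ι : Type*} [Fintype ι] [DecidableEq ι]

/-- The pairs `(a, b)` with `A a + B b = 0`. -/
def pencilSpace (A B : Matrix ι ι K) : Submodule K ((ι → K) × (ι → K)) :=
  LinearMap.ker (A.mulVecLin.coprod B.mulVecLin)

lemma mem_pencilSpace {A B : Matrix ι ι K} {q : (ι → K) × (ι → K)} :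
    q ∈ pencilSpace A B ↔ A *ᵥ q.1 + B *ᵥ q.2 = 0 := Iff.rfl

/-- The radical of the form `l a ⬝ A a' + m b ⬝ B b'` on `pencilSpace A B`. -/
def pencilRadical (A B : Matrix ι ι K) (l m : K) : Submodule K ((ι → K) × (ι → K)) where
  carrier := {q | q ∈ pencilSpace A B ∧
    ∃ y, A *ᵥ y = l • A *ᵥ q.1 ∧ B *ᵥ y = m • B *ᵥ q.2}
  zero_mem' := ⟨Submodule.zero_mem _, 0, by simp⟩
  add_mem' := by
    rintro q r ⟨hq, y, h1, h2⟩ ⟨hr, w, h3, h4⟩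
    refine ⟨Submodule.add_mem _ hq hr, y + w, ?_, ?_⟩
    · rw [Matrix.mulVec_add, h1, h3, Prod.fst_add, Matrix.mulVec_add, smul_add]
    · rw [Matrix.mulVec_add, h2, h4, Prod.snd_add, Matrix.mulVec_add, smul_add]
  smul_mem' := by
    rintro c q ⟨hq, y, h1, h2⟩
    refine ⟨Submodule.smul_mem _ c hq, c • y, ?_, ?_⟩
    · rw [Matrix.mulVec_smul, h1, Prod.smul_fst, Matrix.mulVec_smul, smul_comm]
    · rw [Matrix.mulVec_smul, h2, Prod.smul_snd, Matrix.mulVec_smul, smul_comm]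

lemma ker_prod_ker_le_pencilRadical (A B : Matrix ι ι K) (l m : K) :
    (LinearMap.ker A.mulVecLin).prod (LinearMap.ker B.mulVecLin) ≤ pencilRadical A B l m := by
  rintro q ⟨h1, h2⟩
  have h1' : A *ᵥ q.1 = 0 := h1
  have h2' : B *ᵥ q.2 = 0 := h2
  refine ⟨?_, 0, ?_, ?_⟩
  · rw [mem_pencilSpace, h1', h2', add_zero]
  · rw [h1', smul_zero, Matrix.mulVec_zero]
  · rw [h2', smul_zero, Matrix.mulVec_zero]

lemma pencilRadical_le (A B : Matrix ι ι K) (l m : K) : pencilRadical A B l m ≤ pencilSpace A B :=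
  fun _ h => h.1

lemma dotProduct_mulVec_of_skew {A : Matrix ι ι K} (hA : Aᵀ = -A) (x y : ι → K) :
    x ⬝ᵥ A *ᵥ y = -(A *ᵥ x ⬝ᵥ y) := by
  rw [Matrix.dotProduct_mulVec, ← Matrix.mulVec_transpose, hA, Matrix.neg_mulVec, neg_dotProduct]

/-- A functional on pairs vanishes on the kernel of `(a, b) ↦ A a + B b` exactly when it factors
through this map, i.e. is `w · (A a + B b)`. Skewness moves the matrices onto `w`, which becomes the
`y` of the radical. -/
lemma mem_pencilRadical_iff {A B : Matrix ι ι K} (hA : Aᵀ = -A) (hB : Bᵀ = -B) {l m : K}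
    {q : (ι → K) × (ι → K)} (hq : q ∈ pencilSpace A B) :
    q ∈ pencilRadical A B l m ↔
      ∀ r ∈ pencilSpace A B, l * (q.1 ⬝ᵥ A *ᵥ r.1) + m * (q.2 ⬝ᵥ B *ᵥ r.2) = 0 := by
  constructor
  · rintro ⟨-, y, h1, h2⟩ r hr
    have h3 : y ⬝ᵥ (A *ᵥ r.1 + B *ᵥ r.2) = 0 := by rw [mem_pencilSpace.1 hr, dotProduct_zero]
    rw [dotProduct_add, dotProduct_mulVec_of_skew hA, dotProduct_mulVec_of_skew hB, h1, h2,
      smul_dotProduct, smul_dotProduct, smul_eq_mul, smul_eq_mul] at h3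
    rw [dotProduct_mulVec_of_skew hA, dotProduct_mulVec_of_skew hB]
    linear_combination h3
  · intro h
    refine ⟨hq, ?_⟩
    let φ : Dual K ((ι → K) × (ι → K)) :=
      (l • dotProductBilin K K q.1 ∘ₗ A.mulVecLin).coprod
        (m • dotProductBilin K K q.2 ∘ₗ B.mulVecLin)
    have hφ : φ ∈ (LinearMap.ker (A.mulVecLin.coprod B.mulVecLin)).dualAnnihilator := by
      rw [Submodule.mem_dualAnnihilator]
      exact fun r hr => h r hr
    rw [← LinearMap.range_dualMap_eq_dualAnnihilator_ker] at hφ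
    obtain ⟨ψ, hψ⟩ := hφ
    let w : ι → K := fun i => ψ (Pi.single i 1)
    have hw : ∀ x, ψ x = w ⬝ᵥ x := fun x => by
      conv_lhs => rw [pi_eq_sum_univ' x]
      simp [w, dotProduct, mul_comm]
    have h1 : ∀ a b, w ⬝ᵥ (A *ᵥ a + B *ᵥ b) = l * (q.1 ⬝ᵥ A *ᵥ a) + m * (q.2 ⬝ᵥ B *ᵥ b) :=
      fun a b => (hw _).symm.trans (DFunLike.congr_fun hψ (a, b))
    refine ⟨w, ?_, ?_⟩
    · refine dotProduct_eq _ _ fun a => ?_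
      have h2 := h1 a 0
      rw [Matrix.mulVec_zero, add_zero, dotProduct_zero, mul_zero, add_zero,
        dotProduct_mulVec_of_skew hA, dotProduct_mulVec_of_skew hA] at h2
      rw [smul_dotProduct, smul_eq_mul]
      linear_combination -h2
    · refine dotProduct_eq _ _ fun b => ?_
      have h2 := h1 0 b
      rw [Matrix.mulVec_zero, zero_add, dotProduct_zero, mul_zero, zero_add,
        dotProduct_mulVec_of_skew hB, dotProduct_mulVec_of_skew hB] at h2
      rw [smul_dotProduct, smul_eq_mul]
      linear_combination -h2

lemma rank_add_finrank_ker (A : Matrix ι ι K) :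
    A.rank + finrank K (LinearMap.ker A.mulVecLin) = Fintype.card ι := by
  rw [Matrix.rank, LinearMap.finrank_range_add_finrank_ker, finrank_pi]

/-- The block matrix `(A | B)` has the rank of its transpose, whose kernel is `ker A ∩ ker B` by
skewness. -/
lemma finrank_pencilSpace {A B : Matrix ι ι K} (hA : Aᵀ = -A) (hB : Bᵀ = -B) :
    finrank K (pencilSpace A B) = Fintype.card ι +
      finrank K (LinearMap.ker A.mulVecLin ⊓ LinearMap.ker B.mulVecLin : Submodule K (ι → K)) := by
  have h1 := LinearMap.finrank_range_add_finrank_ker (A.mulVecLin.coprod B.mulVecLin)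
  have h2 : LinearMap.range (A.mulVecLin.coprod B.mulVecLin) =
      LinearMap.range (Matrix.fromCols A B).mulVecLin := by
    ext x
    constructor
    · rintro ⟨q, rfl⟩
      exact ⟨Sum.elim q.1 q.2, by simp [Matrix.fromCols_mulVec]⟩
    · rintro ⟨v, rfl⟩
      exact ⟨(v ∘ Sum.inl, v ∘ Sum.inr), by simp [Matrix.fromCols_mulVec]⟩
  have h3 : finrank K (LinearMap.range (Matrix.fromCols A B).mulVecLin) =
      (Matrix.fromCols A B)ᵀ.rank := by rw [Matrix.rank_transpose, Matrix.rank]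
  have h4 := LinearMap.finrank_range_add_finrank_ker (Matrix.fromCols A B)ᵀ.mulVecLin
  have h5 : LinearMap.ker (Matrix.fromCols A B)ᵀ.mulVecLin =
      LinearMap.ker A.mulVecLin ⊓ LinearMap.ker B.mulVecLin := by
    ext x
    have : Sum.elim (-(A *ᵥ x)) (-(B *ᵥ x)) = (0 : ι ⊕ ι → K) ↔ A *ᵥ x = 0 ∧ B *ᵥ x = 0 := by
      constructor
      · intro h
        refine ⟨?_, ?_⟩
        · funext i
          simpa using congrFun h (Sum.inl i)
        · funext i
          simpa using congrFun h (Sum.inr i)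
      · rintro ⟨h, h'⟩
        rw [h, h']
        funext i
        cases i <;> simp
    simpa [Matrix.transpose_fromCols, Matrix.fromRows_mulVec, hA, hB, Matrix.neg_mulVec] using this
  rw [h2, h3, finrank_prod, finrank_pi] at h1
  rw [h5, finrank_pi] at h4
  change Matrix.rank _ + _ = _ at h4
  change _ + finrank K (pencilSpace A B) = _ at h1
  omega

/-- The dimension of the radical, for matrices that are regular in their pencil. -/
lemma finrank_pencilRadical {A B : Matrix ι ι K} {l m : K} (hlm : l ≠ 0 ∨ m ≠ 0)
    (hAB : ∀ y, A *ᵥ y = 0 → ∃ x, A *ᵥ x = B *ᵥ y) (hBA : ∀ y, B *ᵥ y = 0 → ∃ x, B *ᵥ x = A *ᵥ y) :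
    finrank K (pencilRadical A B l m) + A.rank + B.rank + (m • A + l • B).rank +
      finrank K (LinearMap.ker A.mulVecLin ⊓ LinearMap.ker B.mulVecLin : Submodule K (ι → K)) =
      3 * Fintype.card ι := by
  -- Triples `(y, a, b)` with `(a, b)` in the radical and `y` a witness, counted in two ways. Over
  -- `(a, b)` the fibres are cosets of `ker A ∩ ker B`; over `y` the image is `ker (m A + l B)` and
  -- the fibre at `0` is `ker A × ker B`.
  let Z : Submodule K ((ι → K) × ((ι → K) × (ι → K))) :=
    (pencilSpace A B).comap (LinearMap.snd _ _ _) ⊓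
      (LinearMap.ker (A.mulVecLin.coprod (-(l • A.mulVecLin ∘ₗ LinearMap.fst _ _ _))) ⊓
        LinearMap.ker (B.mulVecLin.coprod (-(m • B.mulVecLin ∘ₗ LinearMap.snd _ _ _))))
  have hZ : ∀ y q, (y, q) ∈ Z ↔ A *ᵥ q.1 + B *ᵥ q.2 = 0 ∧
      A *ᵥ y = l • A *ᵥ q.1 ∧ B *ᵥ y = m • B *ᵥ q.2 := fun y q => by
    rw [← sub_eq_zero (a := A *ᵥ y), ← sub_eq_zero (a := B *ᵥ y), sub_eq_add_neg, sub_eq_add_neg]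
    exact Iff.rfl
  have h1 : Z.map (LinearMap.snd K (ι → K) ((ι → K) × (ι → K))) = pencilRadical A B l m := by
    ext q
    constructor
    · rintro ⟨⟨y, q⟩, h, rfl⟩
      obtain ⟨h1, h2, h3⟩ := (hZ y q).1 h
      exact ⟨h1, y, h2, h3⟩
    · rintro ⟨h1, y, h2, h3⟩
      exact ⟨(y, q), (hZ y q).2 ⟨h1, h2, h3⟩, rfl⟩
  have h2 : Z.comap (LinearMap.inl K (ι → K) ((ι → K) × (ι → K))) =
      LinearMap.ker A.mulVecLin ⊓ LinearMap.ker B.mulVecLin := by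
    ext y
    refine (hZ y 0).trans ?_
    simp
  have h3 : Z.comap (LinearMap.inr K (ι → K) ((ι → K) × (ι → K))) =
      (LinearMap.ker A.mulVecLin).prod (LinearMap.ker B.mulVecLin) := by
    ext ⟨a, b⟩
    refine (hZ 0 (a, b)).trans ?_
    simp only [Matrix.mulVec_zero, Submodule.mem_prod, LinearMap.mem_ker, Matrix.mulVecLin_apply]
    constructor
    · rintro ⟨h1, h2, h3⟩
      rcases hlm with h | h
      · have h4 := (smul_eq_zero.1 h2.symm).resolve_left h
        rw [h4, zero_add] at h1
        exact ⟨h4, h1⟩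
      · have h4 := (smul_eq_zero.1 h3.symm).resolve_left h
        rw [h4, add_zero] at h1
        exact ⟨h1, h4⟩
    · rintro ⟨h1, h2⟩
      simp [h1, h2]
  have h4 : Z.map (LinearMap.fst K (ι → K) ((ι → K) × (ι → K))) =
      LinearMap.ker (m • A + l • B).mulVecLin := by
    ext y
    rw [LinearMap.mem_ker, Matrix.mulVecLin_apply, Matrix.add_mulVec, Matrix.smul_mulVec,
      Matrix.smul_mulVec]
    constructor
    · rintro ⟨⟨y, q⟩, h, rfl⟩
      obtain ⟨h1, h2, h3⟩ := (hZ y q).1 h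
      change m • A *ᵥ y + l • B *ᵥ y = 0
      rw [h2, h3, smul_comm m l, ← smul_add, ← smul_add, h1, smul_zero, smul_zero]
    · intro h
      -- When both coefficients are nonzero, `a = l⁻¹ y`, `b = m⁻¹ y` work. When one vanishes, `y`
      -- lies in one of the kernels, and solving `A a + B b = 0` for the missing component is where
      -- regularity enters.
      by_cases hl : l = 0
      · have hm : m ≠ 0 := hlm.resolve_left (by simp [hl])
        rw [hl, zero_smul, add_zero] at h
        have hAy := (smul_eq_zero.1 h).resolve_left hm
        obtain ⟨x, hx⟩ := hAB y hAy
        refine ⟨(y, -(m⁻¹ • x), m⁻¹ • y), (hZ _ _).2 ⟨?_, ?_, ?_⟩, rfl⟩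
        · simp [Matrix.mulVec_neg, Matrix.mulVec_smul, hx]
        · simp [hAy, hl]
        · simp [Matrix.mulVec_smul, smul_smul, hm]
      by_cases hm : m = 0
      · rw [hm, zero_smul, zero_add] at h
        have hBy := (smul_eq_zero.1 h).resolve_left hl
        obtain ⟨x, hx⟩ := hBA y hBy
        refine ⟨(y, l⁻¹ • y, -(l⁻¹ • x)), (hZ _ _).2 ⟨?_, ?_, ?_⟩, rfl⟩
        · simp [Matrix.mulVec_neg, Matrix.mulVec_smul, hx]
        · simp [Matrix.mulVec_smul, smul_smul, hl]
        · simp [hBy, hm]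
      refine ⟨(y, l⁻¹ • y, m⁻¹ • y), (hZ _ _).2 ⟨?_, ?_, ?_⟩, rfl⟩
      · have h5 := congrArg (fun v => (l⁻¹ * m⁻¹) • v) h
        simp only [smul_add, smul_smul, smul_zero] at h5
        rw [mul_assoc, inv_mul_cancel₀ hm, mul_one, mul_comm l⁻¹, mul_assoc, inv_mul_cancel₀ hl,
          mul_one] at h5
        simpa [Matrix.mulVec_smul] using h5
      · simp [Matrix.mulVec_smul, smul_smul, hl]
      · simp [Matrix.mulVec_smul, smul_smul, hm]
  have h5 := finrank_map_snd_add Z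
  have h6 := finrank_map_fst_add Z
  rw [h1, h2] at h5
  rw [h3, h4, finrank_submodule_prod] at h6
  have h7 := rank_add_finrank_ker A
  have h8 := rank_add_finrank_ker B
  have h9 := rank_add_finrank_ker (m • A + l • B)
  omega

end LinearAlgebra

/-! ### Covectors of the quotient as pairs, and the rank of the reduced bivectors -/

section PencilRank

set_option linter.unusedSectionVars false

open Set Filter TensorProduct

variable {𝔤₀ : Type*} [LieRing 𝔤₀] [LieAlgebra ℝ 𝔤₀] {ι : Type*} [Fintype ι] [DecidableEq ι]
  {E : Type*} [NormedAddCommGroup E] [NormedSpace ℝ E] [FiniteDimensional ℝ E]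
  {N : Type*} [TopologicalSpace N] [ChartedSpace E N] [IsManifold 𝓘(ℝ, E) ∞ N]
  {e : Module.Basis ι ℝ 𝔤₀} {U : Set (ι → ℂ)} {p : U → N}

lemma re_dotProduct_real {x ξ : ι → ℂ} (hξ : ξ ∈ realVectors ι) :
    (x ⬝ᵥ ξ).re = (star x ⬝ᵥ ξ).re := by
  have h : star x ⬝ᵥ ξ = star (x ⬝ᵥ ξ) := by
    conv_lhs => rw [← mem_realVectors_iff_star.1 hξ]
    rw [Matrix.star_dotProduct_star, dotProduct_comm]
  rw [h]
  simp

/-- Representatives of covectors of the quotient. -/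
lemma Represents.mem_pencilSpace (hU : IsOpen[orbitTopology e] U)
    (hp : IsQuotientByRealForm E e p) {z : U} {α : E →ₗ[ℝ] ℝ} {a : ι → ℂ}
    (h : Represents e p z α a) :
    (a, star a) ∈ pencilSpace (poissonMatrix e z) (poissonMatrix e (star (z : ι → ℂ))) := by
  rw [Coadjoint.mem_pencilSpace, poissonMatrix_star_mulVec]
  funext i
  -- Testing on real basis vectors, which `dp` kills, shows that the entries of `c(z) a` have zero
  -- real part; adding the conjugate gives `0`.
  have h1 := h (Pi.single i 1)
  have h2 : (Pi.single i 1 : ι → ℂ) ∈ realVectors ι := by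
    rw [mem_realVectors_iff_star]
    funext j
    rcases eq_or_ne j i with rfl | hj
    · simp
    · simp [hj]
  rw [orbitDifferentialL_of_real hU hp z h2, map_zero, coadAt_eq_neg_mulVec, dotProduct_neg,
    dotProduct_poissonMatrix_comm, neg_neg, dotProduct_single, mul_one] at h1
  refine Complex.ext ?_ ?_
  · simp only [Pi.add_apply, Pi.star_apply, Complex.add_re, RCLike.star_def, Complex.conj_re,
      Pi.zero_apply, Complex.zero_re]
    linarith
  · simp

/-- Every real element of `pencilSpace` represents a covector of the quotient. -/
lemma exists_represents_of_mem_pencilSpace (hU : IsOpen[orbitTopology e] U)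
    (hp : IsQuotientByRealForm E e p) {z : U} {a : ι → ℂ}
    (h : (a, star a) ∈ pencilSpace (poissonMatrix e z) (poissonMatrix e (star (z : ι → ℂ)))) :
    ∃ α : E →ₗ[ℝ] ℝ, Represents e p z α a := by
  rw [Coadjoint.mem_pencilSpace, poissonMatrix_star_mulVec] at h
  let D : (ι → ℂ) →ₗ[ℝ] E := (orbitDifferentialL (E := E) e p z).toLinearMap
  obtain ⟨S, hS⟩ := D.exists_rightInverse_of_surjective
    (LinearMap.range_eq_top.2 (surjective_orbitDifferentialL hp z))
  let f : (ι → ℂ) →ₗ[ℝ] ℝ := (2 : ℝ) • Complex.reLm ∘ₗ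
    (dotProductBilin ℂ ℂ a ∘ₗ coadAt e (z : ι → ℂ)).restrictScalars ℝ
  have hf : ∀ ξ, f ξ = 2 * (a ⬝ᵥ coadAt e z ξ).re := fun ξ => rfl
  -- A direction killed by `dp` acts at `z` as some real `x`, because leaves have the tangent spaces
  -- of `G₀`-orbits. As `c(z) a` is purely imaginary, its pairing with `x` has no real part.
  have hf0 : ∀ ξ, D ξ = 0 → f ξ = 0 := fun ξ hξ => by
    have h1 : coadAt e (z : ι → ℂ) ξ ∈ leafTangent E e p z := ⟨ξ, hξ, rfl⟩
    rw [leafTangent_eq hU hp] at h1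
    obtain ⟨x, hx, h2⟩ := h1
    have h2' : coadAt e (z : ι → ℂ) x = coadAt e (z : ι → ℂ) ξ := h2
    have h3 : (poissonMatrix e z *ᵥ a ⬝ᵥ x).re = (star (poissonMatrix e z *ᵥ a) ⬝ᵥ x).re :=
      re_dotProduct_real hx
    have h4 : star (poissonMatrix e z *ᵥ a) = -(poissonMatrix e (z : ι → ℂ) *ᵥ a) :=
      (neg_eq_of_add_eq_zero_right h).symm
    rw [h4, neg_dotProduct, Complex.neg_re] at h3
    rw [hf, ← h2', coadAt_eq_neg_mulVec, dotProduct_neg, dotProduct_poissonMatrix_comm, neg_neg]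
    linarith
  refine ⟨f ∘ₗ S, fun ξ => ?_⟩
  have h5 : D (S (D ξ) - ξ) = 0 := by
    rw [map_sub, sub_eq_zero]
    exact DFunLike.congr_fun hS (D ξ)
  have h6 := hf0 _ h5
  rw [map_sub, sub_eq_zero] at h6
  exact (hf ξ).symm.trans h6.symm

/-- The rank of a combination of two real forms on the complexification. -/
def formRank {V : Type*} [AddCommGroup V] [Module ℝ V] (b₁ b₂ : LinearMap.BilinForm ℝ V)
    (l₁ l₂ : ℂ) : ℕ :=
  Module.finrank ℂ (LinearMap.range (l₁ • b₁.baseChange ℂ + l₂ • b₂.baseChange ℂ))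

/-- Insert `Re w = (w + w̄)/2` and `Im w = (w - w̄)/(2i)`, where the conjugate of `j v · A j w` is
the `B`-pairing of the conjugates; both sides are complex bilinear. -/
lemma complexify_form {V : Type*} [AddCommGroup V] [Module ℝ V] (b₁ b₂ : LinearMap.BilinForm ℝ V)
    (j : V →ₗ[ℝ] (ι → ℂ)) (J : ℂ ⊗[ℝ] V →ₗ[ℂ] (ι → ℂ) × (ι → ℂ))
    (hJ : ∀ a v, J (a ⊗ₜ v) = a • (j v, star (j v))) (A B : Matrix ι ι ℂ)
    (hAB : B = A.map star)
    (h₁ : ∀ v w, b₁ v w = (j v ⬝ᵥ A *ᵥ j w).re) (h₂ : ∀ v w, b₂ v w = (j v ⬝ᵥ A *ᵥ j w).im)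
    (l₁ l₂ : ℂ) (v w : ℂ ⊗[ℝ] V) :
    (l₁ • b₁.baseChange ℂ + l₂ • b₂.baseChange ℂ) v w =
      (l₁ - Complex.I * l₂) / 2 * ((J v).1 ⬝ᵥ A *ᵥ (J w).1) +
        (l₁ + Complex.I * l₂) / 2 * ((J v).2 ⬝ᵥ B *ᵥ (J w).2) := by
  induction v using TensorProduct.induction_on with
  | zero => simp
  | add v v' hv hv' =>
    rw [map_add, LinearMap.add_apply, hv, hv', map_add, Prod.fst_add, Prod.snd_add,
      add_dotProduct, add_dotProduct]
    ring
  | tmul a v =>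
    induction w using TensorProduct.induction_on with
    | zero => simp
    | add w w' hw hw' =>
      rw [map_add, hw, hw', map_add, Prod.fst_add, Prod.snd_add, Matrix.mulVec_add,
        Matrix.mulVec_add, dotProduct_add, dotProduct_add]
      ring
    | tmul b w =>
      have hs : star (j v) ⬝ᵥ B *ᵥ star (j w) = star (j v ⬝ᵥ A *ᵥ j w) := by
        simp [hAB, dotProduct, Matrix.mulVec]
      have hB : ∀ β : LinearMap.BilinForm ℝ V,
          β.baseChange ℂ (a ⊗ₜ v) (b ⊗ₜ w) = (β v w : ℂ) * (a * b) := fun β => by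
        rw [LinearMap.BilinForm.baseChange_tmul, Complex.real_smul]
      rw [LinearMap.add_apply, LinearMap.add_apply, LinearMap.smul_apply, LinearMap.smul_apply,
        LinearMap.smul_apply, LinearMap.smul_apply, hB, hB, hJ, hJ, Prod.smul_mk, Prod.smul_mk]
      simp only [Matrix.mulVec_smul, smul_dotProduct, dotProduct_smul, smul_eq_mul, hs]
      rw [h₁, h₂, Complex.re_eq_add_conj, Complex.im_eq_sub_conj, RCLike.star_def]
      linear_combination (a * b * l₂ * (j v ⬝ᵥ A *ᵥ j w -
        (starRingEnd ℂ) (j v ⬝ᵥ A *ᵥ j w)) / 2) * Complex.inv_I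

lemma pencilSpace_conj {A B : Matrix ι ι ℂ} (hAB : B = A.map star) {a b : ι → ℂ}
    (h : (a, b) ∈ pencilSpace A B) : (star b, star a) ∈ pencilSpace A B := by
  have h1 := congrArg star (mem_pencilSpace.1 h)
  rw [star_add, star_zero] at h1
  rw [mem_pencilSpace]
  have h2 : A *ᵥ star b = star (B *ᵥ b) := by
    funext i
    simp [hAB, Matrix.mulVec, dotProduct]
  have h3 : B *ᵥ star a = star (A *ᵥ a) := by
    funext i
    simp [hAB, Matrix.mulVec, dotProduct]
  rw [h2, h3, add_comm]
  exact h1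

/-- `pencilSpace` is the complexification of its conjugation invariant part. -/
lemma pencilSpace_le_of_real {A B : Matrix ι ι ℂ} (hAB : B = A.map star)
    {P : Submodule ℂ ((ι → ℂ) × (ι → ℂ))}
    (hP : ∀ a, (a, star a) ∈ pencilSpace A B → (a, star a) ∈ P) : pencilSpace A B ≤ P := by
  rintro ⟨a, b⟩ hab
  have hconj := pencilSpace_conj hAB hab
  have h1 := hP ((1 / 2 : ℂ) • (a + star b)) (by
    have : ((1 / 2 : ℂ) • (a + star b), star ((1 / 2 : ℂ) • (a + star b))) =
        (1 / 2 : ℂ) • ((a, b) + (star b, star a)) := by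
      simp [add_comm]
    rw [this]
    exact Submodule.smul_mem _ _ (Submodule.add_mem _ hab hconj))
  have h2 := hP ((-Complex.I / 2 : ℂ) • (a - star b)) (by
    have : ((-Complex.I / 2 : ℂ) • (a - star b), star ((-Complex.I / 2 : ℂ) • (a - star b))) =
        (-Complex.I / 2 : ℂ) • ((a, b) - (star b, star a)) := by
      refine Prod.ext rfl (funext fun i => ?_)
      simp
      ring
    rw [this]
    exact Submodule.smul_mem _ _ (Submodule.sub_mem _ hab hconj))
  have h3 := Submodule.add_mem _ h1 (Submodule.smul_mem _ Complex.I h2)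
  convert h3 using 1
  refine Prod.ext (funext fun i => ?_) (funext fun i => ?_)
  · simp
    linear_combination ((a i - (starRingEnd ℂ) (b i)) / 2) * Complex.I_mul_I
  · simp
    linear_combination (-((starRingEnd ℂ) (a i) - b i) / 2) * Complex.I_mul_I

/-- The rank of the reduced pencil, for forms on a real space that is mapped onto the real part of
`pencilSpace` modulo kernels. -/
lemma formRank_add {V : Type*} [AddCommGroup V] [Module ℝ V] [FiniteDimensional ℝ V]
    (b₁ b₂ : LinearMap.BilinForm ℝ V) (j : V →ₗ[ℝ] (ι → ℂ)) {A B : Matrix ι ι ℂ}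
    (hAs : Aᵀ = -A) (hBs : Bᵀ = -B) (hAB : B = A.map star)
    (hrank : B.rank = A.rank)
    (hA : ∀ y, A *ᵥ y = 0 → ∃ x, A *ᵥ x = B *ᵥ y) (hB : ∀ y, B *ᵥ y = 0 → ∃ x, B *ᵥ x = A *ᵥ y)
    (h₁ : ∀ v w, b₁ v w = (j v ⬝ᵥ A *ᵥ j w).re) (h₂ : ∀ v w, b₂ v w = (j v ⬝ᵥ A *ᵥ j w).im)
    (hj : ∀ v, (j v, star (j v)) ∈ pencilSpace A B)
    (hj' : ∀ a, (a, star a) ∈ pencilSpace A B → ∃ v, A *ᵥ (a - j v) = 0)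
    {l₁ l₂ : ℂ} (hl : (l₁, l₂) ≠ (0, 0)) :
    formRank b₁ b₂ l₁ l₂ + 2 * Fintype.card ι = 2 * A.rank + 2 * Module.finrank ℂ
      (LinearMap.ker A.mulVecLin ⊓ LinearMap.ker B.mulVecLin : Submodule ℂ (ι → ℂ)) +
        (((l₁ + Complex.I * l₂) / 2) • A + ((l₁ - Complex.I * l₂) / 2) • B).rank := by
  let j₂ : V →ₗ[ℝ] (ι → ℂ) × (ι → ℂ) :=
    { toFun := fun α => (j α, star (j α))
      map_add' := fun α β => by rw [map_add, star_add, Prod.mk_add_mk]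
      map_smul' := fun t α => by
        rw [map_smul, star_smul, star_trivial, RingHom.id_apply, Prod.smul_mk] }
  let J : ℂ ⊗[ℝ] V →ₗ[ℂ] (ι → ℂ) × (ι → ℂ) := j₂.liftBaseChange ℂ
  have hJ : ∀ a α, J (a ⊗ₜ α) = a • (j α, star (j α)) := fun a α =>
    LinearMap.liftBaseChange_tmul ℂ j₂ a α
  set l := (l₁ - Complex.I * l₂) / 2 with hl_def
  set m := (l₁ + Complex.I * l₂) / 2 with hm_def
  have hlm : l ≠ 0 ∨ m ≠ 0 := by
    by_contra! h
    have h1 : l₁ = 0 := by linear_combination h.1 + h.2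
    have h2 : Complex.I * l₂ = 0 := by linear_combination h.2 - h.1
    exact hl (by rw [h1, (mul_eq_zero.1 h2).resolve_left Complex.I_ne_zero])
  have hJmem : ∀ v, J v ∈ pencilSpace A B := fun v => by
    induction v using TensorProduct.induction_on with
    | zero => rw [map_zero]; exact Submodule.zero_mem _
    | add v w hv hw => rw [map_add]; exact Submodule.add_mem _ hv hw
    | tmul a α => rw [hJ]; exact Submodule.smul_mem _ _ (hj α)
  set S := (LinearMap.ker A.mulVecLin).prod (LinearMap.ker B.mulVecLin) with hS
  have hSR : S ≤ pencilRadical A B l m := ker_prod_ker_le_pencilRadical A B l m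
  have hQ : LinearMap.range J ⊔ S = pencilSpace A B := by
    refine le_antisymm (sup_le ?_ (hSR.trans (pencilRadical_le A B l m)))
      (pencilSpace_le_of_real hAB fun a ha => ?_)
    · rintro _ ⟨v, rfl⟩
      exact hJmem v
    · obtain ⟨α, h1⟩ := hj' a ha
      refine Submodule.mem_sup.2 ⟨J (1 ⊗ₜ α), ⟨_, rfl⟩, (a - j α, star (a - j α)), ⟨h1, ?_⟩, ?_⟩
      · have h2 := mem_pencilSpace.1 (Submodule.sub_mem _ ha (hj α))
        rw [Prod.fst_sub, Prod.snd_sub, h1, zero_add, ← star_sub] at h2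
        exact h2
      · rw [hJ, one_smul, star_sub, Prod.mk_add_mk, add_sub_cancel, add_sub_cancel]
  have hform := complexify_form b₁ b₂ j J hJ A B hAB h₁ h₂ l₁ l₂
  -- The range of `J` is all of `pencilSpace` up to `ker A × ker B`, which pairs to zero with
  -- everything, so the kernel of the form is the pull-back of the radical.
  have hker : LinearMap.ker (l₁ • b₁.baseChange ℂ + l₂ • b₂.baseChange ℂ) =
      (pencilRadical A B l m).comap J := by
    ext v
    rw [Submodule.mem_comap, mem_pencilRadical_iff hAs hBs (hJmem v), LinearMap.mem_ker]
    constructor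
    · intro h r hr
      rw [← hQ] at hr
      obtain ⟨_, ⟨w, rfl⟩, s, ⟨hs1, hs2⟩, rfl⟩ := Submodule.mem_sup.1 hr
      have hs1' : A *ᵥ s.1 = 0 := hs1
      have hs2' : B *ᵥ s.2 = 0 := hs2
      rw [Prod.fst_add, Prod.snd_add, Matrix.mulVec_add, Matrix.mulVec_add, hs1', hs2', add_zero,
        add_zero, ← hform, h, LinearMap.zero_apply]
    · intro h
      refine LinearMap.ext fun w => ?_
      rw [hform, LinearMap.zero_apply]
      exact h _ (hJmem w)
  have h1 := LinearMap.finrank_range_add_finrank_ker (l₁ • b₁.baseChange ℂ + l₂ • b₂.baseChange ℂ)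
  have h2 := finrank_add_finrank_of_sup_eq J hSR (pencilRadical_le A B l m) hQ
  have h3 := finrank_pencilSpace hAs hBs
  have h4 := finrank_pencilRadical hlm hA hB
  rw [hker] at h1
  unfold formRank
  omega

lemma exists_represents_sub (hU : IsOpen[orbitTopology e] U) (hp : IsQuotientByRealForm E e p)
    {z : U} {j : (E →ₗ[ℝ] ℝ) →ₗ[ℝ] (ι → ℂ)} (hj : ∀ α, Represents e p z α (j α)) {a : ι → ℂ}
    (ha : (a, star a) ∈ pencilSpace (poissonMatrix e z) (poissonMatrix e (star (z : ι → ℂ)))) :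
    ∃ α, poissonMatrix e (z : ι → ℂ) *ᵥ (a - j α) = 0 := by
  obtain ⟨α, hα⟩ := exists_represents_of_mem_pencilSpace hU hp ha
  refine ⟨α, dotProduct_eq _ _ fun ξ => ?_⟩
  rw [zero_dotProduct, ← neg_eq_zero, ← dotProduct_poissonMatrix_comm]
  have h2 : ∀ ξ, ((a - j α) ⬝ᵥ poissonMatrix e (z : ι → ℂ) *ᵥ ξ).re = 0 := fun ξ => by
    have h3 := (hα ξ).trans (hj α ξ).symm
    rw [coadAt_eq_neg_mulVec, dotProduct_neg, dotProduct_neg, Complex.neg_re, Complex.neg_re] at h3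
    rw [sub_dotProduct, Complex.sub_re]
    linarith
  refine Complex.ext (h2 ξ) ?_
  have h4 := h2 (Complex.I • ξ)
  rw [Matrix.mulVec_smul, dotProduct_smul, smul_eq_mul, Complex.I_mul_re, neg_eq_zero] at h4
  exact h4

/-- The key formula: as the member of the pencil varies, only the rank of `c` at `m z + l z̄`
varies. Both `z` and `z̄` are regular, which gives the inclusions `A (ker B) ⊆ range B` and `B (ker
A) ⊆ range A` needed for the radical. -/
lemma pencilRank_pushBivector (hU : IsOpen[orbitTopology e] U) (hp : IsQuotientByRealForm E e p)
    (z : U) (hz : (poissonMatrix e (z : ι → ℂ)).rank = genericRank e) {l₁ l₂ : ℂ}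
    (hl : (l₁, l₂) ≠ (0, 0)) :
    pencilRank (pushBivector hp 1) (pushBivector hp (-Complex.I)) l₁ l₂ (p z) +
        2 * Fintype.card ι =
      2 * genericRank e + 2 * commonKernelDim e z +
        (poissonMatrix e (((l₁ + Complex.I * l₂) / 2) • (z : ι → ℂ) +
          ((l₁ - Complex.I * l₂) / 2) • star (z : ι → ℂ))).rank := by
  obtain ⟨j, hj⟩ := exists_represents hp z
  have hzs : (poissonMatrix e (star (z : ι → ℂ))).rank = genericRank e :=
    (rank_poissonMatrix_star e _).trans hz
  rw [poissonMatrix_smul_add_smul, ← hz]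
  have : FiniteDimensional ℝ (Module.Dual ℝ (TangentSpace 𝓘(ℝ, E) (p z))) :=
    inferInstanceAs (FiniteDimensional ℝ (Module.Dual ℝ E))
  exact formRank_add (V := Module.Dual ℝ (TangentSpace 𝓘(ℝ, E) (p z)))
    (pushBivector hp 1 (p z)) (pushBivector hp (-Complex.I) (p z)) j
    (poissonMatrix_transpose e _) (poissonMatrix_transpose e _) (poissonMatrix_star e _)
    (rank_poissonMatrix_star e _)
    (fun y hy => exists_mulVec_eq_of_ker e hz hy) (fun y hy => exists_mulVec_eq_of_ker e hzs hy)
    (fun α β => (pushBivector_apply hU hp 1 z (hj α) (hj β)).trans (by rw [one_mul]; rfl))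
    (fun α β => (pushBivector_apply hU hp _ z (hj α) (hj β)).trans (by simp [liePairing]; rfl))
    (fun α => (hj α).mem_pencilSpace hU hp) (fun a ha => exists_represents_sub hU hp hj ha) hl

end PencilRank

/-! ### Density of the complement of the incompleteness set in an orbit -/

section Minors

set_option linter.unusedSectionVars false

variable {κ : Type*} [Fintype κ] [DecidableEq κ]

/-- A nonzero generalized minor, with arbitrary factors in place of a choice of rows and columns:
`Y` lifts a basis of the range and `X` is a left inverse of `M Y`. -/
lemma exists_det_mul_mul_ne_zero (M : Matrix κ κ ℂ) :
    ∃ (X : Matrix (Fin M.rank) κ ℂ) (Y : Matrix κ (Fin M.rank) ℂ), (X * M * Y).det ≠ 0 := by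
  let b := Module.finBasis ℂ (LinearMap.range M.mulVecLin)
  choose v hv using fun i => (b i).2
  let Y : Matrix κ (Fin M.rank) ℂ := Matrix.of fun i k => v k i
  have hcol : ∀ k, (M * Y).col k = ((b k : LinearMap.range M.mulVecLin) : κ → ℂ) := fun k => by
    rw [← hv k]
    rfl
  have hli : LinearIndependent ℂ (M * Y).col := by
    rw [show (M * Y).col = fun k => ((b k : LinearMap.range M.mulVecLin) : κ → ℂ) from funext hcol]
    exact b.linearIndependent.map' (LinearMap.range M.mulVecLin).subtype (Submodule.ker_subtype _)
  obtain ⟨g, hg⟩ := (M * Y).mulVecLin.exists_leftInverse_of_injective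
    (LinearMap.ker_eq_bot.2 (Matrix.mulVec_injective_iff.2 hli))
  refine ⟨LinearMap.toMatrix' g, Y, ?_⟩
  have h : LinearMap.toMatrix' g * M * Y = 1 := by
    have h1 : LinearMap.toMatrix' (M * Y).mulVecLin = M * Y := LinearMap.toMatrix'_toLin' _
    conv_lhs => rw [Matrix.mul_assoc, ← h1]
    rw [← LinearMap.toMatrix'_comp, hg, LinearMap.toMatrix'_id]
  rw [h, Matrix.det_one]
  exact one_ne_zero

lemma le_rank_of_det_mul_mul_ne_zero {r : ℕ} {M : Matrix κ κ ℂ} {X : Matrix (Fin r) κ ℂ}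
    {Y : Matrix κ (Fin r) ℂ} (h : (X * M * Y).det ≠ 0) : r ≤ M.rank := by
  have h1 : (X * M * Y).rank = r := by
    rw [Matrix.rank_of_det_ne_zero h, Fintype.card_fin]
  have h2 := (Matrix.rank_mul_le_left (X * M) Y).trans (Matrix.rank_mul_le_right X M)
  omega

end Minors

/-! ### A real analytic function detecting the drop of rank in the pencil -/

section Certificate

set_option linter.unusedSectionVars false

open Polynomial

variable {𝔤₀ : Type*} [LieRing 𝔤₀] [LieAlgebra ℝ 𝔤₀] {ι : Type*} [Fintype ι] [DecidableEq ι]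

/-- The ring of real analytic functions on `𝔤*`. -/
def analyticSubring (ι : Type*) [Fintype ι] : Subring ((ι → ℂ) → ℂ) where
  carrier := {h | ∀ w, AnalyticAt ℝ h w}
  mul_mem' := fun ha hb w => (ha w).mul (hb w)
  one_mem' := fun _ => analyticAt_const
  add_mem' := fun ha hb w => (ha w).add (hb w)
  zero_mem' := fun _ => analyticAt_const
  neg_mem' := fun ha w => (ha w).neg

/-- Evaluation of analytic functions at a point. -/
def analyticEval (z : ι → ℂ) : analyticSubring ι →+* ℂ :=
  (Pi.evalRingHom (fun _ : ι → ℂ => ℂ) z).comp (analyticSubring ι).subtype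

/-- Constant functions. -/
def analyticConst (ι : Type*) [Fintype ι] : ℂ →+* analyticSubring ι :=
  (Pi.constRingHom (ι → ℂ) ℂ).codRestrict (analyticSubring ι) fun _ _ => analyticAt_const

@[simp] lemma analyticEval_const (z : ι → ℂ) (a : ℂ) : analyticEval z (analyticConst ι a) = a := rfl

/-- The matrix `A` as a matrix of analytic functions. -/
def poissonAnalytic (e : Module.Basis ι ℝ 𝔤₀) : Matrix ι ι (analyticSubring ι) :=
  Matrix.of fun i j => ⟨fun z => poissonMatrix e z i j, fun w => by
    let l : (ι → ℂ) →L[ℝ] ℂ := LinearMap.toContinuousLinearMap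
      { toFun := fun z => poissonMatrix e z i j
        map_add' := fun z w => by rw [poissonMatrix_add, Matrix.add_apply]
        map_smul' := fun t z => by
          rw [← Complex.coe_smul, poissonMatrix_smul, Matrix.smul_apply, Complex.coe_smul,
            RingHom.id_apply] }
    exact l.analyticAt w⟩

/-- The matrix `B` as a matrix of analytic functions. -/
def poissonAnalyticStar (e : Module.Basis ι ℝ 𝔤₀) : Matrix ι ι (analyticSubring ι) :=
  Matrix.of fun i j => ⟨fun z => poissonMatrix e (star z) i j, fun w => by
    let l : (ι → ℂ) →L[ℝ] ℂ := LinearMap.toContinuousLinearMap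
      { toFun := fun z => poissonMatrix e (star z) i j
        map_add' := fun z w => by rw [star_add, poissonMatrix_add, Matrix.add_apply]
        map_smul' := fun t z => by
          rw [star_smul, star_trivial, ← Complex.coe_smul, poissonMatrix_smul, Matrix.smul_apply,
            Complex.coe_smul, RingHom.id_apply] }
    exact l.analyticAt w⟩

/-- A minor of the pencil `A + t B`, as a polynomial in `t` with analytic coefficients. -/
def pencilMinor (e : Module.Basis ι ℝ 𝔤₀) {r : ℕ} (X : Matrix (Fin r) ι ℂ)
    (Y : Matrix ι (Fin r) ℂ) : (analyticSubring ι)[X] :=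
  det ((Polynomial.X : (analyticSubring ι)[X]) •
      (X.map (analyticConst ι) * poissonAnalyticStar e * Y.map (analyticConst ι)).map C +
    (X.map (analyticConst ι) * poissonAnalytic e * Y.map (analyticConst ι)).map C)

lemma map_pencilMinor (e : Module.Basis ι ℝ 𝔤₀) {r : ℕ} (X : Matrix (Fin r) ι ℂ)
    (Y : Matrix ι (Fin r) ℂ) (z : ι → ℂ) :
    (pencilMinor e X Y).map (analyticEval z) =
      det ((Polynomial.X : ℂ[X]) • (X * poissonMatrix e (star z) * Y).map C +
        (X * poissonMatrix e z * Y).map C) := by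
  rw [pencilMinor, ← coe_mapRingHom, RingHom.map_det]
  congr 1
  ext1 i j
  simp only [RingHom.mapMatrix_apply, Matrix.map_apply, Matrix.add_apply, Matrix.smul_apply,
    smul_eq_mul, coe_mapRingHom, Polynomial.map_add, Polynomial.map_mul, Polynomial.map_X,
    Polynomial.map_C, Polynomial.map_sum, Matrix.mul_apply, map_sum, map_mul, analyticEval_const]
  rfl

lemma eval_map_pencilMinor (e : Module.Basis ι ℝ 𝔤₀) {r : ℕ} (X : Matrix (Fin r) ι ℂ)
    (Y : Matrix ι (Fin r) ℂ) (z : ι → ℂ) (t : ℂ) :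
    ((pencilMinor e X Y).map (analyticEval z)).eval t =
      (X * (poissonMatrix e z + t • poissonMatrix e (star z)) * Y).det := by
  rw [map_pencilMinor, ← coe_evalRingHom, RingHom.map_det]
  congr 1
  ext1 i j
  simp only [RingHom.mapMatrix_apply, Matrix.map_apply, Matrix.add_apply, Matrix.smul_apply,
    smul_eq_mul, coe_evalRingHom, eval_add, eval_mul, eval_X, eval_C, Matrix.mul_add,
    Matrix.add_mul, Matrix.mul_smul, Matrix.smul_mul]
  ring

/-- A real analytic function that does not vanish at a given point at which all the members of the
pencil have rank `r`, and only vanishes where this fails. -/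
lemma exists_analytic_certificate (e : Module.Basis ι ℝ 𝔤₀) {r : ℕ} {z₁ : ι → ℂ}
    (hB : (poissonMatrix e (star z₁)).rank = r)
    (hAB : ∀ t : ℂ, (poissonMatrix e z₁ + t • poissonMatrix e (star z₁)).rank = r) :
    ∃ h : (ι → ℂ) → ℂ, (∀ w, AnalyticAt ℝ h w) ∧ h z₁ ≠ 0 ∧ ∀ z, h z ≠ 0 →
      ∀ t : ℂ, r ≤ (poissonMatrix e z + t • poissonMatrix e (star z)).rank := by
  rcases Nat.eq_zero_or_pos r with hr | hr
  · exact ⟨1, fun _ => analyticAt_const, one_ne_zero, fun z _ t => by omega⟩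
  obtain ⟨X₀, Y₀, h₀⟩ : ∃ (X : Matrix (Fin r) ι ℂ) (Y : Matrix ι (Fin r) ℂ),
      (X * poissonMatrix e (star z₁) * Y).det ≠ 0 := by
    have := exists_det_mul_mul_ne_zero (poissonMatrix e (star z₁))
    rwa [hB] at this
  have h₁ : ∀ t : ℂ, ∃ (X : Matrix (Fin r) ι ℂ) (Y : Matrix ι (Fin r) ℂ),
      (X * (poissonMatrix e z₁ + t • poissonMatrix e (star z₁)) * Y).det ≠ 0 := fun t => by
    have := exists_det_mul_mul_ne_zero (poissonMatrix e z₁ + t • poissonMatrix e (star z₁))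
    rwa [hAB] at this
  choose Xs Ys hs using h₁
  -- As a polynomial in `t` its coefficient of degree `r` is the minor of `B`, nonzero at `z₁`;
  -- there its degree is exactly `r` and it has finitely many roots.
  let g := pencilMinor e X₀ Y₀
  have hgdeg : ∀ z, (g.map (analyticEval z)).natDegree ≤ r := fun z => by
    rw [map_pencilMinor]
    exact (natDegree_det_X_add_C_le _ _).trans (Fintype.card_fin r).le
  have hgcoeff : (g.map (analyticEval z₁)).coeff r ≠ 0 := by
    rw [map_pencilMinor]
    have := coeff_det_X_add_C_card (X₀ * poissonMatrix e (star z₁) * Y₀)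
      (X₀ * poissonMatrix e z₁ * Y₀)
    rw [Fintype.card_fin] at this
    rwa [this]
  have hgdeg₁ : (g.map (analyticEval z₁)).natDegree = r :=
    le_antisymm (hgdeg z₁) (le_natDegree_of_ne_zero hgcoeff)
  have hg0 : g.map (analyticEval z₁) ≠ 0 := fun h => hgcoeff (by rw [h, coeff_zero])
  let T : Finset ℂ := (g.map (analyticEval z₁)).roots.toFinset
  -- A Lagrange-type combination: at a root `s` of `g` over `z₁` only the summand of `s` survives,
  -- and its minor was chosen nonzero there. So `f` and `g` have no common root over `z₁`.
  let f : (analyticSubring ι)[X] := ∑ s ∈ T,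
    (∏ s' ∈ T.erase s, (Polynomial.X - C s')).map (analyticConst ι) * pencilMinor e (Xs s) (Ys s)
  have hfeval : ∀ z t, (f.map (analyticEval z)).eval t = ∑ s ∈ T, (∏ s' ∈ T.erase s, (t - s')) *
      (Xs s * (poissonMatrix e z + t • poissonMatrix e (star z)) * Ys s).det := fun z t => by
    simp only [f, Polynomial.map_sum, Polynomial.map_mul, eval_finsetSum, eval_mul,
      eval_map_pencilMinor, Polynomial.map_map]
    refine Finset.sum_congr rfl fun s _ => ?_
    congr 1
    rw [show (analyticEval z).comp (analyticConst ι) = RingHom.id ℂ from rfl, Polynomial.map_id,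
      eval_prod]
    simp
  -- The formal degrees are fixed so that the resultant commutes with evaluation at every point,
  -- even where the degrees drop.
  let ρ : analyticSubring ι := resultant g f r f.natDegree
  have hρ : ∀ z, (ρ : (ι → ℂ) → ℂ) z =
      resultant (g.map (analyticEval z)) (f.map (analyticEval z)) r f.natDegree := fun z =>
    (resultant_map_map g f r f.natDegree (analyticEval z)).symm
  refine ⟨ρ, ρ.2, ?_, fun z hz t => ?_⟩
  · rw [hρ, ← hgdeg₁, resultant_eq_prod_eval _ _ _ (natDegree_map_le) (IsAlgClosed.splits _)]
    refine mul_ne_zero (pow_ne_zero _ (leadingCoeff_ne_zero.2 hg0)) ?_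
    rw [Ne, Multiset.prod_eq_zero_iff, Multiset.mem_map]
    rintro ⟨t, ht, h0⟩
    have htT : t ∈ T := Multiset.mem_toFinset.2 ht
    rw [hfeval, Finset.sum_eq_single_of_mem t htT] at h0
    · refine mul_ne_zero (Finset.prod_ne_zero_iff.2 fun s hs => ?_) (hs t) h0
      exact sub_ne_zero.2 (Finset.ne_of_mem_erase hs).symm
    · intro s hs hst
      rw [Finset.prod_eq_zero (Finset.mem_erase.2 ⟨hst.symm, htT⟩) (sub_self t), zero_mul]
  · by_contra hlt
    have hdet : ∀ (X : Matrix (Fin r) ι ℂ) (Y : Matrix ι (Fin r) ℂ),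
        (X * (poissonMatrix e z + t • poissonMatrix e (star z)) * Y).det = 0 := fun X Y => by
      by_contra h
      exact hlt (le_rank_of_det_mul_mul_ne_zero h)
    -- If the rank drops below `r` at `t`, all minors vanish there, so `f` and `g` share the root
    -- `t` and this Bézout identity makes the resultant zero. It needs a positive degree, hence the
    -- separate case `r = 0`.
    obtain ⟨a, b, -, -, hab⟩ := exists_mul_add_mul_eq_C_resultant (g.map (analyticEval z))
      (f.map (analyticEval z)) (m := r) (n := f.natDegree) (hgdeg z) natDegree_map_le (by omega)
    have h1 := congrArg (eval t) hab
    rw [eval_add, eval_mul, eval_mul, eval_map_pencilMinor, hfeval, hdet, eval_C, ← hρ] at h1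
    refine hz (h1.symm.trans ?_)
    simp [hdet]

end Certificate

/-! ### Completeness of the reduction -/

section Completeness

set_option linter.unusedSectionVars false

open Set Filter TensorProduct

lemma formRank_eq_zero_iff {V : Type*} [AddCommGroup V] [Module ℝ V] [FiniteDimensional ℝ V]
    (b₁ b₂ : LinearMap.BilinForm ℝ V) (s t : ℝ) :
    formRank b₁ b₂ s t = 0 ↔ s • b₁ + t • b₂ = 0 := by
  have hform : ∀ (a b : ℂ) (v w : V),
      ((s : ℂ) • b₁.baseChange ℂ + (t : ℂ) • b₂.baseChange ℂ) (a ⊗ₜ v) (b ⊗ₜ w) =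
        (((s • b₁ + t • b₂) v w : ℝ) : ℂ) * (a * b) := fun a b v w => by
    rw [LinearMap.add_apply, LinearMap.add_apply, LinearMap.smul_apply, LinearMap.smul_apply,
      LinearMap.smul_apply, LinearMap.smul_apply, LinearMap.BilinForm.baseChange_tmul,
      LinearMap.BilinForm.baseChange_tmul, LinearMap.add_apply, LinearMap.add_apply,
      LinearMap.smul_apply, LinearMap.smul_apply, LinearMap.smul_apply, LinearMap.smul_apply]
    simp only [Complex.real_smul, smul_eq_mul, Complex.ofReal_add, Complex.ofReal_mul]
    ring
  rw [formRank, Submodule.finrank_eq_zero, LinearMap.range_eq_bot]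
  constructor
  · intro h
    refine LinearMap.ext₂ fun v w => ?_
    have h1 := hform 1 1 v w
    rw [h, mul_one, mul_one, LinearMap.zero_apply, LinearMap.zero_apply] at h1
    exact_mod_cast h1.symm
  · intro h
    refine LinearMap.ext₂ fun v w => ?_
    rw [LinearMap.zero_apply, LinearMap.zero_apply]
    induction v using TensorProduct.induction_on with
    | zero => rw [map_zero, LinearMap.zero_apply]
    | add v v' hv hv' => rw [map_add, LinearMap.add_apply, hv, hv', add_zero]
    | tmul a v =>
      induction w using TensorProduct.induction_on with
      | zero => rw [map_zero]
      | add w w' hw hw' => rw [map_add, hw, hw', add_zero]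
      | tmul b w =>
        rw [hform, h, LinearMap.zero_apply, LinearMap.zero_apply, Complex.ofReal_zero, zero_mul]

variable {𝔤₀ : Type*} [LieRing 𝔤₀] [LieAlgebra ℝ 𝔤₀] {ι : Type*} [Fintype ι] [DecidableEq ι]
  {E : Type*} [NormedAddCommGroup E] [NormedSpace ℝ E] [FiniteDimensional ℝ E]
  {N : Type*} [TopologicalSpace N] [ChartedSpace E N] [IsManifold 𝓘(ℝ, E) ∞ N]
  {e : Module.Basis ι ℝ 𝔤₀} {U : Set (ι → ℂ)} {p : U → N}

lemma pencilRank_eq_zero_iff (c₁ c₂ : BivectorField E N) (s t : ℝ) (x : N) :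
    pencilRank c₁ c₂ s t x = 0 ↔ s • c₁ x + t • c₂ x = 0 := by
  have : FiniteDimensional ℝ (Module.Dual ℝ (TangentSpace 𝓘(ℝ, E) x)) :=
    inferInstanceAs (FiniteDimensional ℝ (Module.Dual ℝ E))
  exact formRank_eq_zero_iff (V := Module.Dual ℝ (TangentSpace 𝓘(ℝ, E) x)) (c₁ x) (c₂ x) s t

lemma rank_eq_of_notMem_incompletenessSet {z : ι → ℂ} (hz : z ∉ incompletenessSet e) {l₁ l₂ : ℂ}
    (hl : (l₁, l₂) ≠ (0, 0)) : (poissonMatrix e (l₁ • z + l₂ • star z)).rank = genericRank e :=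
  le_antisymm (rank_le_genericRank e _) (not_lt.1 fun h => hz ⟨l₁, l₂, hl, h⟩)

lemma rank_eq_of_notMem_incompletenessSet' {z : ι → ℂ} (hz : z ∉ incompletenessSet e) :
    (poissonMatrix e z).rank = genericRank e := by
  have h := rank_eq_of_notMem_incompletenessSet hz (l₁ := 1) (l₂ := 0) (by simp)
  rwa [one_smul, zero_smul, add_zero] at h

lemma notMem_incompletenessSet {z : ι → ℂ} (hz : (poissonMatrix e z).rank = genericRank e)
    (h : ∀ t : ℂ, genericRank e ≤ (poissonMatrix e z + t • poissonMatrix e (star z)).rank) :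
    z ∉ incompletenessSet e := by
  rintro ⟨l₁, l₂, hl, hs⟩
  have hs' : (poissonMatrix e (l₁ • z + l₂ • star z)).rank < genericRank e := hs
  rw [poissonMatrix_smul_add_smul] at hs'
  refine absurd hs' (not_lt.2 ?_)
  rcases eq_or_ne l₁ 0 with rfl | h1
  · have h2 : l₂ ≠ 0 := fun h => hl (by rw [h])
    rw [zero_smul, zero_add, Matrix.rank_smul_of_mem_nonZeroDivisors _
      (mem_nonZeroDivisors_of_ne_zero h2), rank_poissonMatrix_star, hz]
  · have h2 : l₁ • poissonMatrix e z + l₂ • poissonMatrix e (star z) =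
        l₁ • (poissonMatrix e z + (l₂ / l₁) • poissonMatrix e (star z)) := by
      rw [smul_add, smul_smul, mul_div_cancel₀ _ h1]
    rw [h2, Matrix.rank_smul_of_mem_nonZeroDivisors _ (mem_nonZeroDivisors_of_ne_zero h1)]
    exact h _

lemma pencil_coefficients_ne_zero {l₁ l₂ : ℂ} (hl : (l₁, l₂) ≠ (0, 0)) :
    ((l₁ + Complex.I * l₂) / 2, (l₁ - Complex.I * l₂) / 2) ≠ ((0, 0) : ℂ × ℂ) := by
  intro h
  have h1 := congrArg Prod.fst h
  have h2 := congrArg Prod.snd h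
  simp only at h1 h2
  have h3 : l₁ = 0 := by linear_combination h1 + h2
  have h4 : Complex.I * l₂ = 0 := by linear_combination h1 - h2
  exact hl (by rw [h3, (mul_eq_zero.1 h4).resolve_left Complex.I_ne_zero])

/-- The ranks of the reduced pencil at the image of a point outside of the incompleteness set
are all equal to the maximal rank. -/
lemma isGreatest_pencilRank (hU : IsOpen[orbitTopology e] U) (hp : IsQuotientByRealForm E e p)
    {z₀ : ι → ℂ} (hUM : U ⊆ coadjointOrbit e z₀) (z : U)
    (hz : (z : ι → ℂ) ∉ incompletenessSet e) {l₁ l₂ : ℂ} (hl : (l₁, l₂) ≠ (0, 0)) :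
    IsGreatest {k | ∃ (a b : ℝ) (x : N), k = pencilRank (pushBivector hp 1)
      (pushBivector hp (-Complex.I)) a b x}
      (pencilRank (pushBivector hp 1) (pushBivector hp (-Complex.I)) l₁ l₂ (p z)) := by
  have hR := rank_eq_of_notMem_incompletenessSet' hz
  have hform : ∀ {l₁ l₂ : ℂ}, (l₁, l₂) ≠ (0, 0) →
      pencilRank (pushBivector hp 1) (pushBivector hp (-Complex.I)) l₁ l₂ (p z) +
        2 * Fintype.card ι = 2 * genericRank e + 2 * commonKernelDim e z + genericRank e := by
    intro l₁ l₂ hl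
    rw [pencilRank_pushBivector hU hp z hR hl,
      rank_eq_of_notMem_incompletenessSet hz (pencil_coefficients_ne_zero hl)]
  constructor
  · refine ⟨1, 0, p z, ?_⟩
    have h1 := hform hl
    have h2 := hform (l₁ := ((1 : ℝ) : ℂ)) (l₂ := ((0 : ℝ) : ℂ)) (by simp)
    omega
  -- At another point of `U` the orbit rank and `μ` are the same, so the formula differs only in its
  -- last rank, which is at most generic. The zero member is excluded from the formula and has rank
  -- `0`.
  · rintro _ ⟨a, b, x, rfl⟩
    obtain ⟨w, rfl⟩ := hp.surjective x
    by_cases hab : ((a : ℂ), (b : ℂ)) = (0, 0)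
    · rw [Prod.mk.injEq, Complex.ofReal_eq_zero, Complex.ofReal_eq_zero] at hab
      have h0 : pencilRank (pushBivector hp 1) (pushBivector hp (-Complex.I)) (a : ℂ) (b : ℂ)
          (p w) = 0 := by
        rw [pencilRank_eq_zero_iff, hab.1, hab.2, zero_smul, zero_smul, add_zero]
      rw [h0]
      exact Nat.zero_le _
    · have hw : (poissonMatrix e (w : ι → ℂ)).rank = genericRank e := by
        rw [rank_poissonMatrix_orbit e (hUM w.2), ← rank_poissonMatrix_orbit e (hUM z.2), hR]
      have h1 := hform hl
      have h2 := pencilRank_pushBivector hU hp w hw hab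
      have h3 := rank_le_genericRank e ((((a : ℂ) + Complex.I * b) / 2) • (w : ι → ℂ) +
        (((a : ℂ) - Complex.I * b) / 2) • star (w : ι → ℂ))
      rw [commonKernelDim_eq hU hp hUM w z] at h2
      omega

lemma isCompleteAt_pushBivector (hU : IsOpen[orbitTopology e] U) (hp : IsQuotientByRealForm E e p)
    {z₀ : ι → ℂ} (hUM : U ⊆ coadjointOrbit e z₀) (z : U)
    (hz : (z : ι → ℂ) ∉ incompletenessSet e) :
    IsCompleteAt (pushBivector hp 1) (pushBivector hp (-Complex.I)) (p z) := fun _ _ hl =>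
  (isGreatest_pencilRank hU hp hUM z hz hl).csSup_eq.symm

/-- The open dense set is the image of the nonvanishing locus of the certificate: open by local
sections of `p`, dense because an analytic function nonzero at one point of the orbit is not
identically zero near any other. -/
lemma isComplete_pushBivector (hU : IsOpen[orbitTopology e] U) (hp : IsQuotientByRealForm E e p)
    {z₀ : ι → ℂ} (hUM : U ⊆ coadjointOrbit e z₀) (z₁ : U)
    (hz₁ : (z₁ : ι → ℂ) ∉ incompletenessSet e) :
    IsComplete (pushBivector hp 1) (pushBivector hp (-Complex.I)) := by
  have hrank₁ := rank_eq_of_notMem_incompletenessSet' hz₁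
  obtain ⟨h, hh, hne, hcert⟩ := exists_analytic_certificate e
    ((rank_poissonMatrix_star e (z₁ : ι → ℂ)).trans hrank₁) (fun t => by
      have := rank_eq_of_notMem_incompletenessSet hz₁ (l₁ := 1) (l₂ := t) (by simp)
      rwa [poissonMatrix_smul_add_smul, one_smul] at this)
  refine ⟨p '' {z | h (z : ι → ℂ) ≠ 0}, ?_, ?_, ?_⟩
  · rw [isOpen_iff_mem_nhds]
    rintro _ ⟨z, hz, rfl⟩
    obtain ⟨s, hs, hs0, hsp⟩ := exists_local_section hp z
    have hst : Tendsto s (𝓝 (p z)) (𝓝 0) := by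
      have := hs.continuousAt.tendsto
      rwa [hs0] at this
    have hz' : ∀ᶠ w in 𝓝 (z : ι → ℂ), h w ≠ 0 := (hh z).continuousAt.eventually_ne hz
    filter_upwards [hsp, hst.eventually ((tendsto_coadExp e (z : ι → ℂ)).eventually hz'),
      hst.eventually (eventually_coadExp_mem hU z)] with x h1 h2 h3
    refine ⟨expAt e z (s x), ?_, h1⟩
    rw [mem_ofPred_eq, expAt_coe z h3]
    exact h2
  · intro x
    obtain ⟨z, rfl⟩ := hp.surjective x
    rw [mem_closure_iff_frequently]
    refine (continuousAt_comp_expAt hp z).frequently ?_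
    refine ((frequently_coadExp_ne_zero e hh (hUM z₁.2) (hUM z.2) hne).and_eventually
      (eventually_coadExp_mem hU z)).mono fun ξ h1 => ⟨expAt e z ξ, ?_, rfl⟩
    rw [mem_ofPred_eq, expAt_coe z h1.2]
    exact h1.1
  · rintro _ ⟨z, hz, rfl⟩
    refine isCompleteAt_pushBivector hU hp hUM z (notMem_incompletenessSet ?_ (hcert z hz))
    rw [rank_poissonMatrix_orbit e (hUM z.2), ← rank_poissonMatrix_orbit e (hUM z₁.2), hrank₁]

/-- If the maximal rank is zero, all members vanish. Otherwise a nontrivial real linear relation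
would give a member of rank `0` at the image of `z₁`, against completeness there. -/
lemma isBihamiltonian_pushBivector (hU : IsOpen[orbitTopology e] U)
    (hp : IsQuotientByRealForm E e p) {z₀ : ι → ℂ} (hUM : U ⊆ coadjointOrbit e z₀) (z₁ : U)
    (hz₁ : (z₁ : ι → ℂ) ∉ incompletenessSet e) :
    IsBihamiltonian (pushBivector hp 1) (pushBivector hp (-Complex.I)) where
  poisson a b := by
    have h : (fun x => a • pushBivector hp 1 x + b • pushBivector hp (-Complex.I) x) =
        pushBivector hp (a - b * Complex.I) := funext fun x => pushBivector_add_smul hp a b x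
    rw [h]
    exact isPoisson_pushBivector hU hp _
  indep_or_trivial := by
    by_cases h0 : maxRank (pushBivector hp 1) (pushBivector hp (-Complex.I)) = 0
    · right
      have h1 : ∀ (a b : ℝ) (x : N),
          a • pushBivector hp 1 x + b • pushBivector hp (-Complex.I) x = 0 := fun a b x => by
        rw [← pencilRank_eq_zero_iff, ← Nat.le_zero, ← h0]
        exact le_csSup ⟨_, (isGreatest_pencilRank hU hp hUM z₁ hz₁
          (l₁ := 1) (l₂ := 0) (by simp)).2⟩ ⟨a, b, x, rfl⟩
      constructor
      · intro x
        have h2 := h1 1 0 x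
        rwa [one_smul, zero_smul, add_zero] at h2
      · intro x
        have h2 := h1 0 1 x
        rwa [one_smul, zero_smul, zero_add] at h2
    · left
      intro a b hab
      by_contra hne
      have hne' : ((a : ℂ), (b : ℂ)) ≠ (0, 0) := by
        rwa [Ne, Prod.mk.injEq, Complex.ofReal_eq_zero, Complex.ofReal_eq_zero]
      have h1 := isCompleteAt_pushBivector hU hp hUM z₁ hz₁ a b hne'
      rw [(pencilRank_eq_zero_iff _ _ a b (p z₁)).2 (hab (p z₁))] at h1
      exact h0 h1.symm

end Completeness

end Coadjoint

end

theorem mainTheorem1 {𝔤₀ : Type*} [LieRing 𝔤₀] [LieAlgebra ℝ 𝔤₀]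
    {ι : Type*} [Fintype ι] [DecidableEq ι] (e : Module.Basis ι ℝ 𝔤₀)
    (hna : ¬ IsLieAbelian 𝔤₀) (hsing : 3 ≤ Coadjoint.singularCodim e)
    (z₀ : ι → ℂ) (U : Set (ι → ℂ)) (hUM : U ⊆ Coadjoint.coadjointOrbit e z₀)
    (hU : IsOpen[Coadjoint.orbitTopology e] U)
    {E : Type*} [NormedAddCommGroup E] [NormedSpace ℝ E] [FiniteDimensional ℝ E]
    {N : Type*} [TopologicalSpace N] [ChartedSpace E N] [IsManifold 𝓘(ℝ, E) ∞ N]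
    (p : U → N) (hp : Coadjoint.IsQuotientByRealForm E e p) :
    ∃ c₁ c₂ : Coadjoint.BivectorField E N,
      Coadjoint.IsReduction e p c₁ c₂ ∧
      (∀ x : N, x ∉ p '' {z : U | (z : ι → ℂ) ∈ Coadjoint.irregularitySet e} →
        Coadjoint.IsCompleteAt c₁ c₂ x) ∧
      (¬ U ⊆ Coadjoint.irregularitySet e →
        Coadjoint.IsBihamiltonian c₁ c₂ ∧ Coadjoint.IsComplete c₁ c₂ ∧
          Coadjoint.IsMinimalRealization e p c₁ c₂) ∧
      (z₀ ∉ Coadjoint.singularSet e → Coadjoint.IsCRIsotropicFoliation E e p) := by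
  have hred := Coadjoint.isReduction_pushBivector hU hp
  refine ⟨Coadjoint.pushBivector hp 1, Coadjoint.pushBivector hp (-Complex.I), hred,
    fun x hx => ?_, fun hne => ?_, fun hz₀ => ?_⟩
  · obtain ⟨z, rfl⟩ := hp.surjective x
    exact Coadjoint.isCompleteAt_pushBivector hU hp hUM z
      fun hz => hx ⟨z, Or.inl hz, rfl⟩
  -- A single point outside `𝒞` suffices: it is regular, so the whole orbit is generic, and it seeds
  -- the analytic certificate.
  · obtain ⟨z₁, hz₁U, hz₁⟩ := Set.not_subset.1 hne
    have hz₁' : z₁ ∉ Coadjoint.incompletenessSet e := fun h => hz₁ (Or.inl h)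
    have hcomplete := Coadjoint.isComplete_pushBivector hU hp hUM ⟨z₁, hz₁U⟩ hz₁'
    refine ⟨Coadjoint.isBihamiltonian_pushBivector hU hp hUM ⟨z₁, hz₁U⟩ hz₁', hcomplete, hred,
      hcomplete, Coadjoint.isCRIsotropicFoliation hU hp hUM ?_⟩
    rw [← Coadjoint.rank_poissonMatrix_orbit e (hUM hz₁U),
      Coadjoint.rank_eq_of_notMem_incompletenessSet' hz₁']
  · exact Coadjoint.isCRIsotropicFoliation hU hp hUM
      (le_antisymm (Coadjoint.rank_le_genericRank e z₀) (not_lt.1 hz₀))
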